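/- **Model.** Let $\Theta=[a,b]$ with $a<b$, $\Lambda=b-a$ its diameter, and let $f(\cdot;\theta)$, $\theta\in\Theta$, be everywhere positive probability densities with respect to a measure $\mu$ on a measurable space $D$ (the common support). Write $\ell(x,\theta)=\log f(x;\theta)$, $I(\theta)=E_\theta[(\partial_\theta\ell(X,\theta))^2]$, and assume the following regularity conditions: 1. distinct parameters give distinct distributions; 2. $\ell(x,\cdot)$ is four times continuously differentiable on $\Theta$ for every $x\in D$; 3. there are a measurable $G$ and a $\mu$-integrable $H$ with $|\partial_\theta^j\ell(x,\theta)|\le G(x)$ for $1\le j\le 4$ and $f(x;\theta)(1+G(x))^4\le H(x)$ for all $x\in D$, $\theta\in\Theta$; 4. $I(\theta)>0$ for all $\theta\in\Theta$. **Estimator.** Let $\hat\theta_n:D^n\to\Theta$ be (measurable) maximum likelihood estimators, let $$b_1(\theta)=\frac{2E_\theta[\ell'(X,\theta)\,\ell''(X,\theta)]+E_\theta[\ell'''(X,\theta)]}{2I(\theta)^2},\qquad \hat\theta_{bc,n}=\hat\theta_n-\frac{b_1(\hat\theta_n)}{n},$$ where primes denote $\theta$-derivatives. For $x\in D^n$,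 $k\ge1$ and $\varepsilon>0$ put $t=\lfloor n/k\rfloor$ and $$T^*(x)=\bar z(x)+R,\qquad \bar z(x)=\frac1k\sum_{j=1}^k\hat\theta_{bc,t}(x_{(j-1)t+1},\dots,x_{jt}),$$ where $R$ is independent of the data and has the Laplace distribution $\mathrm{Lap}(\Lambda/(k\varepsilon))$ (the law $\mathrm{Lap}(s)$ has density $\frac1{2s}e^{-|y|/s}$). **Claim.** Let $\varepsilon=\varepsilon_n>0$ with $\varepsilon_n=\omega(n^{-1/6})$. Then $k_n=\lceil n^{3/5}\Lambda^{2/5}/\varepsilon_n^{2/5}\rceil$ satisfies $$k_n=o(n^{2/3})\quad\text{and}\quad k_n=\omega(\sqrt n/\varepsilon_n).\qquad(\ast)$$ Moreover, let $\theta$ be an interior point of $\Theta$ and let $X=(X_1,\dots,X_n)$ be i.i.d. from $f(\cdot;\theta)$. Then $b_1$ is the leading bias coefficient of the maximum likelihood estimator, $$E_\theta[\hat\theta_n-\theta]=b_1(\theta)/n+O(n^{-3/2}),$$ and for every sequence of block counts $k=k_n$ with $(\ast)$ the estimator $T^*=T^*(X)$ is square-integrable and * (asymptotically unbiased) $E_\theta[T^*]-\theta=O((k/n)^{3/2})$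 and $\sqrt n\,(E_\theta[T^*]-\theta)\to0$; * (asymptotically normal) $\sqrt n\,(T^*-\theta)\to N(0,1/I(\theta))$ in distribution; * (efficient) its mean squared error $J_{T^*}(\theta)=E_\theta[(T^*-\theta)^2]$ satisfies $$J_{T^*}(\theta)=\mathrm{Var}_\theta(\bar z(X))+\frac{2\Lambda^2}{k^2\varepsilon^2}+(E_\theta[T^*]-\theta)^2,$$ with $\mathrm{Var}_\theta(\bar z(X))=\frac{1+o(1)}{nI(\theta)}$ and squared bias $O(k^3/n^3)$, and $J_{T^*}(\theta)=\frac{1+o(1)}{nI(\theta)}$. -/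

import Mathlib

open MeasureTheory ProbabilityTheory Filter Topology Asymptotics

/-- A one-parameter statistical model with parameter space the interval `[a, b]`: a family of
everywhere positive probability densities `f · θ` with respect to a fixed measure `μ` on the
data space `D` (`D` is the common support of the densities). -/
structure ParametricModel (D : Type*) [MeasurableSpace D] where
  /-- dominating measure -/
  μ : Measure D
  /-- `f x θ` is the density at the data point `x` under the parameter `θ` -/
  f : D → ℝ → ℝ
  a : ℝ
  b : ℝ
  a_lt_b : a < b
  measurable_f : ∀ θ ∈ Set.Icc a b, Measurable fun x => f x θ
  pos_f : ∀ x, ∀ θ ∈ Set.Icc a b, 0 < f x θ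
  lintegral_f : ∀ θ ∈ Set.Icc a b, ∫⁻ x, ENNReal.ofReal (f x θ) ∂μ = 1

namespace ParametricModel

variable {D : Type*} [MeasurableSpace D] (M : ParametricModel D)

/-- The parameter space. -/
abbrev paramSpace : Set ℝ := Set.Icc M.a M.b

/-- The diameter `Λ` of the parameter space. -/
noncomputable def Lam : ℝ := Metric.diam M.paramSpace

/-- The distribution of one data point under the parameter `θ`. -/
noncomputable def law (θ : M.paramSpace) : Measure D :=
  M.μ.withDensity fun x => ENNReal.ofReal (M.f x θ)

instance isProbabilityMeasure_law (θ : M.paramSpace) : IsProbabilityMeasure (M.law θ) :=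
  ⟨by simpa [law] using M.lintegral_f θ θ.2⟩

/-- The `j`-th derivative in `θ` of `log f(x; θ)` (one-sided at the end points of the parameter
interval). -/
noncomputable def dlog (j : ℕ) (x : D) (θ : M.paramSpace) : ℝ :=
  iteratedDerivWithin j (fun t => Real.log (M.f x t)) M.paramSpace θ

/-- The Fisher information `I_f(θ) = E_θ [(∂/∂θ log f(X; θ))²]`. -/
noncomputable def fisherInfo (θ : M.paramSpace) : ℝ :=
  ∫ x, (M.dlog 1 x θ) ^ 2 ∂(M.law θ)

/-- Regularity conditions on the model. -/
structure Regular : Prop where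
  identifiable : ∀ θ θ' : M.paramSpace, M.law θ = M.law θ' → θ = θ'
  smooth : ∀ x, ContDiffOn ℝ 4 (fun t => Real.log (M.f x t)) M.paramSpace
  /-- The first four log-derivatives have an envelope `G` whose fourth power is integrable,
  uniformly in the parameter. -/
  dominated : ∃ G H : D → ℝ, Measurable G ∧ Integrable H M.μ ∧
    (∀ j ∈ Finset.Icc 1 4, ∀ x (θ : M.paramSpace), |M.dlog j x θ| ≤ G x) ∧
    ∀ x (θ : M.paramSpace), M.f x θ * (1 + G x) ^ 4 ≤ H x
  fisherInfo_pos : ∀ θ : M.paramSpace, 0 < M.fisherInfo θ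

/-- `θhat n` is a measurable maximum likelihood estimator on samples of size `n`. -/
def IsMLE (θhat : (n : ℕ) → (Fin n → D) → M.paramSpace) : Prop :=
  ∀ n, Measurable (θhat n) ∧
    ∀ (x : Fin n → D) (θ : M.paramSpace), ∏ i, M.f (x i) θ ≤ ∏ i, M.f (x i) (θhat n x)

/-- The coefficient `b₁(θ)` of `1/n` in the bias of the maximum likelihood estimator:
`(2 E_θ[ℓ' ℓ''] + E_θ[ℓ''']) / (2 I(θ)²)` where `ℓ = log f`. -/
noncomputable def b₁ (θ : M.paramSpace) : ℝ :=
  (2 * (∫ x, M.dlog 1 x θ * M.dlog 2 x θ ∂(M.law θ)) + (∫ x, M.dlog 3 x θ ∂(M.law θ))) /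
    (2 * M.fisherInfo θ ^ 2)

/-- The bias-corrected maximum likelihood estimator on samples of size `n`. -/
noncomputable def bcMLE (θhat : (n : ℕ) → (Fin n → D) → M.paramSpace) (n : ℕ)
    (x : Fin n → D) : ℝ :=
  (θhat n x : ℝ) - M.b₁ (θhat n x) / n

/-- The distribution of an i.i.d. sample of size `n` under the parameter `θ`. -/
noncomputable def sampleLaw (θ : M.paramSpace) (n : ℕ) : Measure (Fin n → D) :=
  Measure.pi fun _ => M.law θ

instance isProbabilityMeasure_sampleLaw (θ : M.paramSpace) (n : ℕ) :
    IsProbabilityMeasure (M.sampleLaw θ n) := by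
  unfold sampleLaw; infer_instance

end ParametricModel

/-- The `j`-th of the `k` consecutive blocks of `⌊n / k⌋` points of the sample `x` (when `k` does
not divide `n`, the fewer than `k` last points are not used). -/
def sampleBlock {D : Type*} {n k : ℕ} (x : Fin n → D) (j : Fin k) : Fin (n / k) → D :=
  fun i => x ⟨j * (n / k) + i, by
    have h1 : (j : ℕ) * (n / k) + i < (j + 1) * (n / k) := by
      rw [add_mul, one_mul]; exact Nat.add_lt_add_left i.2 _
    have h2 : ((j : ℕ) + 1) * (n / k) ≤ k * (n / k) := Nat.mul_le_mul_right _ j.2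
    exact (h1.trans_le h2).trans_le (Nat.mul_div_le n k)⟩

/-- The Laplace (double-exponential) distribution on `ℝ` with scale `s`, of density
`exp (-|y| / s) / (2 s)`; the point mass at `0` when `s` is not positive. -/
noncomputable def laplaceReal (s : ℝ) : Measure ℝ :=
  if 0 < s then volume.withDensity fun y => ENNReal.ofReal (Real.exp (-|y| / s) / (2 * s))
  else Measure.dirac 0

instance isProbabilityMeasure_laplaceReal (s : ℝ) : IsProbabilityMeasure (laplaceReal s) := by
  unfold laplaceReal
  split_ifs with hs
  · refine ⟨?_⟩
    have hI : ∫ y : ℝ, Real.exp (-|y| / s) = 2 * s := by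
      have h := integral_comp_abs (f := fun y => Real.exp (-y / s))
      have h2 : ∫ y in Set.Ioi (0 : ℝ), Real.exp (-y / s) = s := by
        have := integral_exp_mul_Ioi (a := -s⁻¹) (by simpa using hs) 0
        simpa [div_eq_inv_mul, mul_comm] using this
      rw [h, h2]
    have hint : Integrable fun y : ℝ => Real.exp (-|y| / s) := by
      by_contra h
      rw [integral_undef h] at hI
      linarith
    rw [withDensity_apply _ MeasurableSet.univ, Measure.restrict_univ,
      ← ofReal_integral_eq_lintegral_ofReal (hint.div_const _)
        (ae_of_all _ fun y => by positivity), integral_div, hI, div_self (by positivity),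
      ENNReal.ofReal_one]
  · infer_instance

namespace ParametricModel

variable {D : Type*} [MeasurableSpace D] (M : ParametricModel D)

/-- The average of the bias-corrected maximum likelihood estimates of the `k` blocks. -/
noncomputable def blockAverage (θhat : (n : ℕ) → (Fin n → D) → M.paramSpace) (n k : ℕ)
    (x : Fin n → D) : ℝ :=
  (∑ j : Fin k, M.bcMLE θhat (n / k) (sampleBlock x j)) / k

/-- The private estimator `T*` on the sample `x` with additive noise `r`. -/
noncomputable def tStar (θhat : (n : ℕ) → (Fin n → D) → M.paramSpace) (n k : ℕ)
    (xr : (Fin n → D) × ℝ) : ℝ :=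
  M.blockAverage θhat n k xr.1 + xr.2

/-- The joint distribution of the i.i.d. sample and of the independent noise
`Lap(Λ / (k ε))`. -/
noncomputable def jointLaw (θ : M.paramSpace) (n k : ℕ) (ε : ℝ) : Measure ((Fin n → D) × ℝ) :=
  (M.sampleLaw θ n).prod (laplaceReal (M.Lam / (k * ε)))

instance isProbabilityMeasure_jointLaw (θ : M.paramSpace) (n k : ℕ) (ε : ℝ) :
    IsProbabilityMeasure (M.jointLaw θ n k ε) := by
  unfold jointLaw; infer_instance

/-- The bias `E_θ[T*] - θ`. -/
noncomputable def bias (θhat : (n : ℕ) → (Fin n → D) → M.paramSpace) (θ : M.paramSpace)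
    (n k : ℕ) (ε : ℝ) : ℝ :=
  ∫ xr, (M.tStar θhat n k xr - θ) ∂(M.jointLaw θ n k ε)

/-- The mean squared error `E_θ[(T* - θ)²]`. -/
noncomputable def mse (θhat : (n : ℕ) → (Fin n → D) → M.paramSpace) (θ : M.paramSpace)
    (n k : ℕ) (ε : ℝ) : ℝ :=
  ∫ xr, (M.tStar θhat n k xr - θ) ^ 2 ∂(M.jointLaw θ n k ε)

end ParametricModel

/-- The numbers of blocks for which the block sizes and the noise are adequate:
`k = o(n^(2/3))` and `k = ω(√n / ε)`. -/
def AdmissibleBlockCount (ε : ℕ → ℝ) (k : ℕ → ℕ) : Prop :=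
  ((fun n : ℕ => (k n : ℝ)) =o[atTop] fun n : ℕ => (n : ℝ) ^ (2 / 3 : ℝ)) ∧
    (fun n : ℕ => √(n : ℝ) / ε n) =o[atTop] fun n : ℕ => (k n : ℝ)

/-!
The maximum likelihood estimator is expanded on one block, and the blocks are then averaged.

On one block of `n` observations let `Δ` be the estimation error, and let `S`, `W`, `V` be the
averages of `ℓ'`, `-ℓ'' - I` and `ℓ''' - κ` at the true parameter, where `κ = E ℓ'''`. If the
estimate is interior, the score equation and Taylor's formula give
`S = (I + W) Δ - (κ + V) Δ² / 2 + O(|Δ|³)`, whence `I Δ` agrees with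
`S - W S / I + κ S² / (2 I²)` to second order. All error terms, also on the event where the score
equation is not available, are bounded by the single quantity
`h⁴ + S⁴ + W⁴ + h² V² + β` with `h = n^(-1/2)` and `β` the indicator of the bad event
(`exists_expansion_bound`). Its expectation is `O(n⁻²)`: fourth moments of averages are `O(n⁻²)`
(`exists_integral_sampleMean_pow_four_le`), and the maximum likelihood estimator leaves a
neighbourhood of the true parameter with probability `O(n⁻²)`
(`Regular.exists_measureReal_le_abs_sub`), by Gibbs' inequality, compactness of the parameter
interval and Markov's inequality for fourth moments. Taking expectations (`exists_moment_expansion`)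
yields `E Δ = b₁ / n + O(n^(-3/2))` and `E (Δ - S / I)² = O(n⁻²)` (`Regular.exists_mle_expansion`).
Since `b₁` is Lipschitz, as is seen by differentiating under the integral sign, subtracting
`b₁(θhat) / n` leaves a bias of order `n^(-3/2)` only (`Regular.exists_bcMLE_expansion`).

Averaging over `k` independent blocks of `⌊n / k⌋` observations keeps the bias, which is therefore
`O((k / n)^(3/2))`, and divides the variance by `k`, so that `n` times it tends to `1 / I`. The
noise has variance `2 Λ² / (k ε)² = o(1 / n)` because `k = ω(√n / ε)`, and the squared bias is
`o(1 / n)` because `k = o(n^(2/3))`. Finally `√n (T* - θ)` differs from the normalized sum of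
`ℓ' / I` over the whole sample by a quantity tending to `0` in mean square
(`Regular.tendsto_integral_sq_tStar_sub`). As every sample size has its own probability space, the
central limit theorem and this last comparison are combined through characteristic functions
(`tendstoInDistribution_of_tendsto_integral_sq`).
-/

/-! ### Moments of averages of independent observations -/

section MomentInequalities

variable {Ω : Type*} [MeasurableSpace Ω] {P : Measure Ω}

lemma MeasureTheory.MemLp.integrable_pow_four {f : Ω → ℝ} (hf : MemLp f 4 P) :
    Integrable (fun ω => f ω ^ 4) P := by
  have := hf.integrable_norm_pow (p := 4) (by norm_num)
  simpa [Even.pow_abs (by decide : Even 4)] using this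

lemma MeasureTheory.MemLp.two_of_four [IsFiniteMeasure P] {f : Ω → ℝ} (hf : MemLp f 4 P) :
    MemLp f 2 P := hf.mono_exponent (by norm_num)

lemma MeasureTheory.MemLp.integrable_pow_three [IsFiniteMeasure P] {f : Ω → ℝ}
    (hf : MemLp f 4 P) : Integrable (fun ω => f ω ^ 3) P := by
  have h3 : MemLp f 3 P := hf.mono_exponent (by norm_num)
  have := h3.integrable_norm_pow (p := 3) (by norm_num)
  refine this.mono (h3.1.pow 3) (ae_of_all _ fun ω => by simp)

/-- The fourth moment of a sum of centred independent variables with uniformly bounded second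
and fourth moments grows only quadratically in the number of summands. -/
lemma ProbabilityTheory.iIndepFun.integral_sum_pow_four_le [IsProbabilityMeasure P] {ι : Type*}
    {Y : ι → Ω → ℝ} (hY : iIndepFun Y P) (hm : ∀ i, Measurable (Y i)) (h4 : ∀ i, MemLp (Y i) 4 P)
    (h0 : ∀ i, ∫ ω, Y i ω ∂P = 0) {c d : ℝ} (hc : ∀ i, ∫ ω, Y i ω ^ 2 ∂P ≤ c)
    (hd : ∀ i, ∫ ω, Y i ω ^ 4 ∂P ≤ d) (s : Finset ι) :
    ∫ ω, (∑ i ∈ s, Y i ω) ^ 2 ∂P ≤ s.card * c ∧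
      ∫ ω, (∑ i ∈ s, Y i ω) ^ 4 ∂P ≤ s.card * d + 3 * s.card ^ 2 * c ^ 2 := by
  classical
  induction s using Finset.induction_on with
  | empty => simp
  | insert j s hj ih =>
    set T : Ω → ℝ := fun ω => ∑ i ∈ s, Y i ω with hT
    have hTm : Measurable T := Finset.measurable_sum _ fun i _ => hm i
    have hT4 : MemLp T 4 P := by
      simpa [hT] using memLp_finsetSum s fun i _ => h4 i
    have hind : IndepFun T (Y j) P := by
      have := hY.indepFun_finsetSum_of_notMem hm hj
      convert this using 1
      ext ω; simp [hT]
    have hT0 : ∫ ω, T ω ∂P = 0 := by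
      rw [hT, integral_finsetSum _ fun i _ => (h4 i).integrable (by norm_num)]
      simp [h0]
    have hpow (p q : ℕ) : ∫ ω, T ω ^ p * Y j ω ^ q ∂P = (∫ ω, T ω ^ p ∂P) * ∫ ω, Y j ω ^ q ∂P :=
      (hind.comp (measurable_id.pow_const p) (measurable_id.pow_const q)).integral_fun_mul_eq_mul_integral
        (hTm.pow_const p).aestronglyMeasurable ((hm j).pow_const q).aestronglyMeasurable
    have hint (p q : ℕ) (h1 : Integrable (fun ω => T ω ^ p) P)
        (h2 : Integrable (fun ω => Y j ω ^ q) P) : Integrable (fun ω => T ω ^ p * Y j ω ^ q) P :=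
      (hind.comp (measurable_id.pow_const p) (measurable_id.pow_const q)).integrable_mul h1 h2
    have t1 : Integrable (fun ω => T ω ^ 1) P := by simpa using hT4.integrable (by norm_num)
    have t2 := hT4.two_of_four.integrable_sq
    have t3 := hT4.integrable_pow_three
    have t4 := hT4.integrable_pow_four
    have y1 : Integrable (fun ω => Y j ω ^ 1) P := by simpa using (h4 j).integrable (by norm_num)
    have y2 := (h4 j).two_of_four.integrable_sq
    have y3 := (h4 j).integrable_pow_three
    have y4 := (h4 j).integrable_pow_four
    have hy1 : ∫ ω, Y j ω ^ 1 ∂P = 0 := by simpa using h0 j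
    have ht1 : ∫ ω, T ω ^ 1 ∂P = 0 := by simpa using hT0
    have hc0 : 0 ≤ c := (integral_nonneg fun ω => sq_nonneg (Y j ω)).trans (hc j)
    have e2 : ∫ ω, (∑ i ∈ insert j s, Y i ω) ^ 2 ∂P = ∫ ω, T ω ^ 2 ∂P + ∫ ω, Y j ω ^ 2 ∂P := by
      have : (fun ω => (∑ i ∈ insert j s, Y i ω) ^ 2) =
          fun ω => T ω ^ 2 + 2 * (T ω ^ 1 * Y j ω ^ 1) + Y j ω ^ 2 := by
        ext ω; rw [Finset.sum_insert hj]; ring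
      have i11 := (hint 1 1 t1 y1).const_mul 2
      rw [this, integral_add (t2.fun_add i11) y2, integral_add t2 i11, integral_const_mul, hpow,
        ht1]
      ring
    have e4 : ∫ ω, (∑ i ∈ insert j s, Y i ω) ^ 4 ∂P = ∫ ω, T ω ^ 4 ∂P +
        6 * ((∫ ω, T ω ^ 2 ∂P) * ∫ ω, Y j ω ^ 2 ∂P) + ∫ ω, Y j ω ^ 4 ∂P := by
      have : (fun ω => (∑ i ∈ insert j s, Y i ω) ^ 4) =
          fun ω => T ω ^ 4 + 4 * (T ω ^ 3 * Y j ω ^ 1) + 6 * (T ω ^ 2 * Y j ω ^ 2) +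
            4 * (T ω ^ 1 * Y j ω ^ 3) + Y j ω ^ 4 := by
        ext ω; rw [Finset.sum_insert hj]; ring
      have i31 := (hint 3 1 t3 y1).const_mul 4
      have i22 := (hint 2 2 t2 y2).const_mul 6
      have i13 := (hint 1 3 t1 y3).const_mul 4
      rw [this, integral_add (((t4.fun_add i31).fun_add i22).fun_add i13) y4,
        integral_add ((t4.fun_add i31).fun_add i22) i13, integral_add (t4.fun_add i31) i22,
        integral_add t4 i31]
      simp only [integral_const_mul, hpow, ht1, hy1]
      ring
    have hs : (0 : ℝ) ≤ s.card := Nat.cast_nonneg _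
    rw [e2, e4, Finset.card_insert_of_notMem hj]
    push_cast
    refine ⟨by linarith [hc j, ih.1], ?_⟩
    have hprod : (∫ ω, T ω ^ 2 ∂P) * ∫ ω, Y j ω ^ 2 ∂P ≤ (s.card * c) * c :=
      mul_le_mul ih.1 (hc j) (integral_nonneg fun ω => sq_nonneg _) (by positivity)
    nlinarith [ih.2, hd j, hprod, sq_nonneg c]

end MomentInequalities

section SampleMean

variable {D : Type*} [MeasurableSpace D]

/-- The average of `g` over the points of a sample. -/
noncomputable def sampleMean (g : D → ℝ) {n : ℕ} (x : Fin n → D) : ℝ := (∑ i, g (x i)) / n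

lemma sampleMean_sub_const {D : Type*} (g : D → ℝ) (c : ℝ) {n : ℕ} (hn : n ≠ 0) (x : Fin n → D) :
    sampleMean (fun y => g y - c) x = sampleMean g x - c := by
  have hn' : (n : ℝ) ≠ 0 := by exact_mod_cast hn
  simp only [sampleMean, Finset.sum_sub_distrib]
  simp
  field_simp

lemma measurable_sampleMean {g : D → ℝ} (hg : Measurable g) (n : ℕ) :
    Measurable (sampleMean g : (Fin n → D) → ℝ) := by
  unfold sampleMean; fun_prop

variable (ν : Measure D) [IsProbabilityMeasure ν]

lemma integrable_comp_eval' {ι : Type*} [Fintype ι] {g : D → ℝ} (hg : Integrable g ν) (i : ι) :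
    Integrable (fun x : ι → D => g (x i)) (Measure.pi fun _ => ν) :=
  (measurePreserving_eval (fun _ => ν) i).integrable_comp_of_integrable hg

lemma integral_comp_eval' {ι : Type*} [Fintype ι] {g : D → ℝ} (hg : Measurable g) (i : ι) :
    ∫ x : ι → D, g (x i) ∂(Measure.pi fun _ => ν) = ∫ y, g y ∂ν := by
  have h := measurePreserving_eval (fun _ : ι => ν) i
  calc _ = ∫ y, g y ∂((Measure.pi fun _ : ι => ν).map (Function.eval i)) :=
        (integral_map h.aemeasurable hg.aestronglyMeasurable).symm
    _ = _ := by rw [h.map_eq]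

lemma memLp_comp_eval {ι : Type*} [Fintype ι] {g : D → ℝ} {p : ENNReal} (hg : MemLp g p ν)
    (i : ι) : MemLp (fun x : ι → D => g (x i)) p (Measure.pi fun _ => ν) :=
  hg.comp_measurePreserving (measurePreserving_eval (fun _ => ν) i)

lemma iIndepFun_comp_eval {ι : Type*} [Fintype ι] {g : D → ℝ} (hg : Measurable g) :
    iIndepFun (fun (i : ι) (x : ι → D) => g (x i)) (Measure.pi fun _ => ν) :=
  iIndepFun_pi (X := fun _ => g) fun _ => hg.aemeasurable

lemma memLp_sampleMean {g : D → ℝ} {p : ENNReal} (hg : MemLp g p ν) (n : ℕ) :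
    MemLp (sampleMean g) p (Measure.pi fun _ : Fin n => ν) := by
  have := (memLp_finsetSum Finset.univ fun (i : Fin n) _ => memLp_comp_eval ν hg i).const_mul
    ((n : ℝ)⁻¹)
  refine this.ae_eq (ae_of_all _ fun x => ?_)
  simp [sampleMean, div_eq_inv_mul]

lemma integral_sampleMean {g : D → ℝ} (hg : Measurable g) (hi : Integrable g ν) {n : ℕ}
    (hn : n ≠ 0) : ∫ x, sampleMean g x ∂(Measure.pi fun _ : Fin n => ν) = ∫ y, g y ∂ν := by
  have hn' : (n : ℝ) ≠ 0 := by exact_mod_cast hn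
  unfold sampleMean
  rw [integral_div, integral_finsetSum _ fun i _ => integrable_comp_eval' ν hi i]
  simp only [integral_comp_eval' ν hg]
  simp
  field_simp

/-- Covariances of sums over an i.i.d. sample add up. -/
lemma integral_sum_mul_sum {ι : Type*} [Fintype ι] {g h : D → ℝ} (hg : Measurable g)
    (hh : Measurable h) (hg2 : MemLp g 2 ν) (hh2 : MemLp h 2 ν) (hg0 : ∫ y, g y ∂ν = 0)
    (s t : Finset ι) [DecidableEq ι] :
    ∫ x : ι → D, (∑ i ∈ s, g (x i)) * (∑ i ∈ t, h (x i)) ∂(Measure.pi fun _ => ν) =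
      (s ∩ t).card * ∫ y, g y * h y ∂ν := by
  have hint (i j : ι) : Integrable (fun x : ι → D => g (x i) * h (x j)) (Measure.pi fun _ => ν) :=
    (memLp_comp_eval ν hg2 i).integrable_mul (memLp_comp_eval ν hh2 j)
  have hij (i j : ι) : ∫ x : ι → D, g (x i) * h (x j) ∂(Measure.pi fun _ => ν) =
      if i = j then ∫ y, g y * h y ∂ν else 0 := by
    split_ifs with hij
    · subst hij
      exact integral_comp_eval' ν (hg.mul hh) i
    · have hind : IndepFun (fun x : ι → D => g (x i)) (fun x => h (x j)) (Measure.pi fun _ => ν) :=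
        ((iIndepFun_pi (X := fun _ : ι => (id : D → D)) (μ := fun _ => ν)
          fun _ => aemeasurable_id).indepFun hij).comp hg hh
      rw [hind.integral_fun_mul_eq_mul_integral
        (hg.comp (measurable_pi_apply i)).aestronglyMeasurable
        (hh.comp (measurable_pi_apply j)).aestronglyMeasurable,
        integral_comp_eval' ν hg, hg0, zero_mul]
  simp_rw [Finset.sum_mul_sum]
  rw [integral_finsetSum _ fun i _ => integrable_finsetSum _ fun j _ => hint i j]
  simp_rw [integral_finsetSum _ fun j _ => hint _ j, hij]
  simp [Finset.sum_ite_mem]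

lemma integral_sampleMean_mul_sampleMean {g h : D → ℝ} (hg : Measurable g)
    (hh : Measurable h) (hg2 : MemLp g 2 ν) (hh2 : MemLp h 2 ν) (hg0 : ∫ y, g y ∂ν = 0) {n : ℕ}
    (hn : n ≠ 0) :
    ∫ x, sampleMean g x * sampleMean h x ∂(Measure.pi fun _ : Fin n => ν) =
      (∫ y, g y * h y ∂ν) / n := by
  have hn' : (n : ℝ) ≠ 0 := by exact_mod_cast hn
  have := integral_sum_mul_sum (ι := Fin n) ν hg hh hg2 hh2 hg0 Finset.univ Finset.univ
  simp only [sampleMean, div_mul_div_comm]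
  rw [integral_div, this]
  simp
  field_simp

lemma exists_integral_sampleMean_pow_four_le {g : D → ℝ} (hg : Measurable g) (hg4 : MemLp g 4 ν)
    (hg0 : ∫ y, g y ∂ν = 0) : ∃ C : ℝ, 0 ≤ C ∧ ∀ n : ℕ, n ≠ 0 →
      ∫ x, sampleMean g x ^ 4 ∂(Measure.pi fun _ : Fin n => ν) ≤ C / n ^ 2 := by
  have hd0 : 0 ≤ ∫ y, g y ^ 4 ∂ν := integral_nonneg fun y => by positivity
  refine ⟨(∫ y, g y ^ 4 ∂ν) + 3 * (∫ y, g y ^ 2 ∂ν) ^ 2, by positivity, fun n hn => ?_⟩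
  have hn1 : (1 : ℝ) ≤ n := by exact_mod_cast Nat.one_le_iff_ne_zero.2 hn
  have h := ((iIndepFun_comp_eval (ι := Fin n) ν hg).integral_sum_pow_four_le
    (fun i => hg.comp (measurable_pi_apply i)) (fun i => memLp_comp_eval ν hg4 i)
    (fun i => by rw [integral_comp_eval' ν hg, hg0])
    (fun i => (integral_comp_eval' ν (hg.pow_const 2) i).le)
    (fun i => (integral_comp_eval' ν (hg.pow_const 4) i).le) Finset.univ).2
  simp only [sampleMean, div_pow]
  rw [integral_div, div_le_div_iff₀ (by positivity) (by positivity)]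
  simp only [Finset.card_univ, Fintype.card_fin] at h
  have : (n : ℝ) * (∫ y, g y ^ 4 ∂ν) ≤ n ^ 2 * ∫ y, g y ^ 4 ∂ν :=
    mul_le_mul_of_nonneg_right (by nlinarith) hd0
  calc _ ≤ ((n : ℝ) ^ 2 * ((∫ y, g y ^ 4 ∂ν) + 3 * (∫ y, g y ^ 2 ∂ν) ^ 2)) * n ^ 2 :=
        mul_le_mul_of_nonneg_right (h.trans (by linarith)) (by positivity)
    _ = _ := by ring

/-- Markov's inequality for the fourth power: an average deviates from its mean by a fixed amount
with probability `O(n⁻²)`. -/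
lemma exists_measureReal_sampleMean_sub_le {g : D → ℝ} (hg : Measurable g) (hg4 : MemLp g 4 ν)
    {c : ℝ} (hc : 0 < c) : ∃ C : ℝ, 0 ≤ C ∧ ∀ n : ℕ, n ≠ 0 →
      (Measure.pi fun _ : Fin n => ν).real {x | c ≤ |sampleMean g x - ∫ y, g y ∂ν|} ≤
        C / n ^ 2 := by
  set m := ∫ y, g y ∂ν with hm
  have hgi : Integrable g ν := hg4.integrable (by norm_num)
  have hg' : Measurable fun y => g y - m := hg.sub_const m
  have hg4' : MemLp (fun y => g y - m) 4 ν := hg4.sub (memLp_const m)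
  obtain ⟨C, hC, h⟩ := exists_integral_sampleMean_pow_four_le ν hg' hg4' (by
    rw [integral_sub hgi (integrable_const _)]; simp [hm])
  refine ⟨C / c ^ 4, by positivity, fun n hn => ?_⟩
  have hmk := mul_meas_ge_le_integral_of_nonneg (μ := Measure.pi fun _ : Fin n => ν)
    (f := fun x => sampleMean (fun y => g y - m) x ^ 4) (ae_of_all _ fun x => by positivity)
    (memLp_sampleMean ν hg4' n).integrable_pow_four (c ^ 4)
  have hset : {x : Fin n → D | c ≤ |sampleMean g x - m|} ⊆
      {x | c ^ 4 ≤ sampleMean (fun y => g y - m) x ^ 4} := fun x hx => by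
    have hx' : c ≤ |sampleMean g x - m| := hx
    rw [Set.mem_ofPred_eq, sampleMean_sub_const g m hn,
      ← Even.pow_abs (by decide : Even 4) (sampleMean g x - m)]
    gcongr
  rw [div_div, mul_comm (c ^ 4), ← div_div, le_div_iff₀ (by positivity), mul_comm]
  exact (mul_le_mul_of_nonneg_left (measureReal_mono hset) (by positivity)).trans
    (hmk.trans (h n hn))

end SampleMean

/-! ### Blocks of an i.i.d. sample -/

section Blocks

/-- The position in the sample of the `i`-th point of the `j`-th block. -/
def blockIndex {n k : ℕ} (j : Fin k) (i : Fin (n / k)) : Fin n :=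
  ⟨j * (n / k) + i, by
    have h1 : (j : ℕ) * (n / k) + i < (j + 1) * (n / k) := by
      rw [add_mul, one_mul]; exact Nat.add_lt_add_left i.2 _
    have h2 : ((j : ℕ) + 1) * (n / k) ≤ k * (n / k) := Nat.mul_le_mul_right _ j.2
    exact (h1.trans_le h2).trans_le (Nat.mul_div_le n k)⟩

lemma sampleBlock_apply {D : Type*} {n k : ℕ} (x : Fin n → D) (j : Fin k) (i : Fin (n / k)) :
    sampleBlock x j i = x (blockIndex j i) := rfl

lemma blockIndex_inj {n k : ℕ} {j j' : Fin k} {i i' : Fin (n / k)}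
    (h : blockIndex j i = blockIndex j' i') : j = j' ∧ i = i' := by
  have h' : (j : ℕ) * (n / k) + i = j' * (n / k) + i' := congrArg Fin.val h
  have ht : 0 < n / k := i.pos
  have hj : (j : ℕ) = j' := by
    have := congrArg (· / (n / k)) h'
    simpa [Nat.add_div_of_dvd_right, ht, Nat.mul_div_cancel, Nat.div_eq_of_lt] using this
  refine ⟨Fin.ext hj, Fin.ext ?_⟩
  rw [hj] at h'
  omega

variable {D : Type*} [MeasurableSpace D]

lemma measurable_sampleBlock {n k : ℕ} (j : Fin k) :
    Measurable fun x : Fin n → D => sampleBlock x j :=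
  measurable_pi_lambda _ fun _ => measurable_pi_apply _

variable (ν : Measure D) [IsProbabilityMeasure ν]

lemma measurePreserving_comp_injective {ι κ : Type*} [Fintype ι] [Fintype κ] {e : κ → ι}
    (he : Function.Injective e) :
    MeasurePreserving (fun (x : ι → D) i => x (e i)) (Measure.pi fun _ => ν)
      (Measure.pi fun _ => ν) := by
  have hm : Measurable fun (x : ι → D) (i : κ) => x (e i) :=
    measurable_pi_lambda _ fun _ => measurable_pi_apply _
  refine ⟨hm, ?_⟩
  have h := (iIndepFun_pi (X := fun _ : ι => (id : D → D)) (μ := fun _ => ν)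
    fun _ => aemeasurable_id).precomp he
  replace h := (iIndepFun_iff_map_fun_eq_pi_map (f := fun (i : κ) (x : ι → D) => x (e i))
    fun i => (measurable_pi_apply (e i)).aemeasurable).1 h
  refine h.trans ?_
  congr 1
  ext1 i
  exact (measurePreserving_eval (fun _ : ι => ν) (e i)).map_eq

lemma measurePreserving_sampleBlock {n k : ℕ} (j : Fin k) :
    MeasurePreserving (fun x : Fin n → D => sampleBlock x j) (Measure.pi fun _ => ν)
      (Measure.pi fun _ => ν) :=
  measurePreserving_comp_injective ν fun _ _ h => (blockIndex_inj h).2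

/-- Different blocks use disjoint sets of observations, hence are independent. -/
lemma indepFun_sampleBlock {n k : ℕ} {j j' : Fin k} (hj : j ≠ j') :
    IndepFun (fun x : Fin n → D => sampleBlock x j) (fun x => sampleBlock x j')
      (Measure.pi fun _ => ν) := by
  classical
  have hm (l : Fin k) (i : Fin (n / k)) : blockIndex l i ∈ Finset.univ.image (blockIndex l) :=
    Finset.mem_image_of_mem _ (Finset.mem_univ i)
  have hdisj : Disjoint (Finset.univ.image (blockIndex (n := n) j))
      (Finset.univ.image (blockIndex j')) := by
    rw [Finset.disjoint_left]
    intro i h1 h2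
    simp only [Finset.mem_image, Finset.mem_univ, true_and] at h1 h2
    obtain ⟨p, rfl⟩ := h1
    obtain ⟨q, hq⟩ := h2
    exact hj (blockIndex_inj hq).1.symm
  have h := (iIndepFun_pi (X := fun _ : Fin n => (id : D → D)) (μ := fun _ => ν)
    fun _ => aemeasurable_id).indepFun_finset _ _ hdisj fun i => measurable_pi_apply i
  exact h.comp (φ := fun y i => y ⟨blockIndex j i, hm j i⟩)
    (ψ := fun y i => y ⟨blockIndex j' i, hm j' i⟩)
    (measurable_pi_lambda _ fun _ => measurable_pi_apply _)
    (measurable_pi_lambda _ fun _ => measurable_pi_apply _)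

/-- The average over the blocks of a statistic of a block. -/
noncomputable def blockMean {n k : ℕ} (Z : (Fin (n / k) → D) → ℝ) (x : Fin n → D) : ℝ :=
  (∑ j : Fin k, Z (sampleBlock x j)) / k

variable {n k : ℕ} {Z : (Fin (n / k) → D) → ℝ}

lemma measurable_blockMean (hZ : Measurable Z) : Measurable (blockMean Z) := by
  exact (Finset.measurable_sum _ fun j _ => hZ.comp (measurable_sampleBlock j)).div_const _

lemma memLp_comp_sampleBlock {p : ENNReal} (hZ : MemLp Z p (Measure.pi fun _ => ν)) (j : Fin k) :
    MemLp (fun x : Fin n → D => Z (sampleBlock x j)) p (Measure.pi fun _ => ν) :=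
  hZ.comp_measurePreserving (measurePreserving_sampleBlock ν j)

lemma memLp_blockMean {p : ENNReal} (hZ : MemLp Z p (Measure.pi fun _ => ν)) :
    MemLp (blockMean Z) p (Measure.pi fun _ : Fin n => ν) := by
  have := (memLp_finsetSum Finset.univ fun (j : Fin k) _ =>
    memLp_comp_sampleBlock ν hZ j).const_mul ((k : ℝ)⁻¹)
  refine this.ae_eq (ae_of_all _ fun x => ?_)
  simp [blockMean, div_eq_inv_mul]

lemma integral_blockMean (hk : k ≠ 0) (hZ : MemLp Z 2 (Measure.pi fun _ => ν)) :
    ∫ x, blockMean Z x ∂(Measure.pi fun _ : Fin n => ν) = ∫ y, Z y ∂(Measure.pi fun _ => ν) := by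
  have hk' : (k : ℝ) ≠ 0 := by exact_mod_cast hk
  have hj (j : Fin k) : ∫ x : Fin n → D, Z (sampleBlock x j) ∂(Measure.pi fun _ => ν) =
      ∫ y, Z y ∂(Measure.pi fun _ => ν) := by
    have h := measurePreserving_sampleBlock (n := n) ν j
    conv_rhs => rw [← h.map_eq]
    rw [integral_map h.aemeasurable (by rw [h.map_eq]; exact hZ.1)]
  unfold blockMean
  rw [integral_div, integral_finsetSum _ fun j _ =>
    (memLp_comp_sampleBlock ν hZ j).integrable (by norm_num)]
  simp only [hj]
  simp
  field_simp

lemma variance_blockMean (hk : k ≠ 0) (hZm : Measurable Z)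
    (hZ : MemLp Z 2 (Measure.pi fun _ => ν)) :
    Var[blockMean Z; Measure.pi fun _ : Fin n => ν] = Var[Z; Measure.pi fun _ => ν] / k := by
  have hk' : (k : ℝ) ≠ 0 := by exact_mod_cast hk
  have hj (j : Fin k) : Var[fun x : Fin n → D => Z (sampleBlock x j); Measure.pi fun _ => ν] =
      Var[Z; Measure.pi fun _ => ν] := by
    have h := measurePreserving_sampleBlock (n := n) ν j
    conv_rhs => rw [← h.map_eq]
    rw [variance_map (by rw [h.map_eq]; exact hZ.1.aemeasurable) h.aemeasurable]
    rfl
  have hsum := IndepFun.variance_sum (s := Finset.univ) (μ := Measure.pi fun _ : Fin n => ν)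
    (X := fun (j : Fin k) (x : Fin n → D) => Z (sampleBlock x j))
    (fun j _ => memLp_comp_sampleBlock ν hZ j)
    (fun i _ j _ hij => (indepFun_sampleBlock ν hij).comp hZm hZm)
  have heq : blockMean Z = fun x : Fin n → D => (k : ℝ)⁻¹ *
      (∑ j : Fin k, fun x : Fin n → D => Z (sampleBlock x j)) x := by
    ext x; simp [blockMean, div_eq_inv_mul]
  rw [heq, variance_const_mul, hsum]
  simp only [hj]
  simp
  field_simp

end Blocks

/-! ### The Laplace distribution -/

section Laplace

lemma integral_laplaceReal {s : ℝ} (hs : 0 < s) (g : ℝ → ℝ) :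
    ∫ y, g y ∂(laplaceReal s) = ∫ y, Real.exp (-|y| / s) / (2 * s) * g y := by
  rw [laplaceReal, if_pos hs, integral_withDensity_eq_integral_toReal_smul (by fun_prop)
    (ae_of_all _ fun _ => ENNReal.ofReal_lt_top)]
  refine integral_congr_ae (ae_of_all _ fun y => ?_)
  simp only [smul_eq_mul]
  rw [ENNReal.toReal_ofReal (by positivity)]

lemma integral_id_laplaceReal (s : ℝ) : ∫ y, y ∂(laplaceReal s) = 0 := by
  by_cases hs : 0 < s
  · rw [integral_laplaceReal hs fun y => y]
    have h := integral_neg_eq_self (fun y : ℝ => Real.exp (-|y| / s) / (2 * s) * y) volume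
    simp only [abs_neg, mul_neg, integral_neg] at h
    linarith
  · simp [laplaceReal, hs]

lemma integral_sq_laplaceReal {s : ℝ} (hs : 0 ≤ s) : ∫ y, y ^ 2 ∂(laplaceReal s) = 2 * s ^ 2 := by
  rcases hs.eq_or_lt with rfl | hs
  · simp [laplaceReal]
  · rw [integral_laplaceReal hs fun y => y ^ 2]
    have h := integral_comp_abs (f := fun y : ℝ => Real.exp (-y / s) / (2 * s) * y ^ 2)
    simp only [sq_abs] at h
    have hG := Real.integral_rpow_mul_exp_neg_mul_Ioi (a := 3) (r := s⁻¹) (by norm_num)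
      (by positivity)
    have h3 : Real.Gamma 3 = 2 := by
      rw [show (3 : ℝ) = (2 : ℕ) + 1 by norm_num, Real.Gamma_nat_eq_factorial]
      simp
    rw [h3] at hG
    have he : ∫ y in Set.Ioi (0 : ℝ), Real.exp (-y / s) / (2 * s) * y ^ 2 =
        ∫ y in Set.Ioi (0 : ℝ), (2 * s)⁻¹ * (y ^ ((3 : ℝ) - 1) * Real.exp (-(s⁻¹ * y))) := by
      refine integral_congr_ae (ae_of_all _ fun y => ?_)
      have : y ^ ((3 : ℝ) - 1) = y ^ 2 := by
        rw [show (3 : ℝ) - 1 = (2 : ℕ) by norm_num, Real.rpow_natCast]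
      simp only [this]
      rw [show -y / s = -(s⁻¹ * y) by field_simp]
      ring
    rw [h, he, integral_const_mul, hG]
    have : (1 / s⁻¹) ^ (3 : ℝ) = s ^ 3 := by
      rw [one_div, inv_inv]; exact_mod_cast Real.rpow_natCast s 3
    rw [this]
    field_simp

lemma memLp_id_laplaceReal {s : ℝ} (hs : 0 ≤ s) : MemLp (fun y : ℝ => y) 2 (laplaceReal s) := by
  rw [memLp_two_iff_integrable_sq (by fun_prop)]
  rcases hs.eq_or_lt with rfl | hs
  · rw [laplaceReal, if_neg (lt_irrefl 0)]
    exact integrable_dirac (by simp)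
  · -- a function with nonzero Bochner integral is integrable
    by_contra h
    have := integral_sq_laplaceReal hs.le
    rw [integral_undef h] at this
    have : 0 < 2 * s ^ 2 := by positivity
    linarith

end Laplace

/-! ### Convergence in distribution -/

section ConvergenceInDistribution

lemma integral_abs_le_sqrt {Ω : Type*} [MeasurableSpace Ω] {P : Measure Ω}
    [IsProbabilityMeasure P] {f : Ω → ℝ} (hf : MemLp f 2 P) :
    ∫ ω, |f ω| ∂P ≤ √(∫ ω, f ω ^ 2 ∂P) := by
  apply Real.le_sqrt_of_sq_le
  have h := variance_nonneg (fun ω => |f ω|) P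
  have h2 : MemLp (fun ω => |f ω|) 2 P := hf.abs
  rw [variance_eq_sub h2] at h
  simpa using h

lemma norm_charFun_map_sub_le {Ω : Type*} [MeasurableSpace Ω] {P : Measure Ω}
    [IsProbabilityMeasure P] {X Y : Ω → ℝ} (hX : Measurable X) (hY : Measurable Y)
    (hXY : Integrable (fun ω => X ω - Y ω) P) (t : ℝ) :
    ‖charFun (P.map X) t - charFun (P.map Y) t‖ ≤ |t| * ∫ ω, |X ω - Y ω| ∂P := by
  have hmap {W : Ω → ℝ} (hW : Measurable W) :
      charFun (P.map W) t = ∫ ω, Complex.exp (Complex.I * (t * W ω : ℝ)) ∂P := by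
    rw [charFun_apply_real, integral_map hW.aemeasurable (by fun_prop)]
    refine integral_congr_ae (ae_of_all _ fun ω => ?_)
    simp only
    congr 1; push_cast; ring
  have hint {W : Ω → ℝ} (hW : Measurable W) :
      Integrable (fun ω => Complex.exp (Complex.I * (t * W ω : ℝ))) P := by
    refine Integrable.of_bound (C := 1) (by fun_prop) (ae_of_all _ fun ω => ?_)
    rw [mul_comm, Complex.norm_exp_ofReal_mul_I]
  rw [hmap hX, hmap hY, ← integral_sub (hint hX) (hint hY), ← integral_const_mul]
  refine norm_integral_le_of_norm_le (hXY.abs.const_mul _) (ae_of_all _ fun ω => ?_)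
  have : Complex.exp (Complex.I * (t * X ω : ℝ)) - Complex.exp (Complex.I * (t * Y ω : ℝ)) =
      Complex.exp (Complex.I * (t * Y ω : ℝ)) *
        (Complex.exp (Complex.I * (t * (X ω - Y ω) : ℝ)) - 1) := by
    rw [mul_sub, ← Complex.exp_add]
    congr 2
    · push_cast; ring
    · ring
  rw [this, norm_mul, mul_comm Complex.I, Complex.norm_exp_ofReal_mul_I, one_mul, ← abs_mul]
  exact Real.norm_exp_I_mul_ofReal_sub_one_le

/-- Slutsky's theorem for random variables on varying probability spaces: if the mean square
distance of `X n` and `Y n` tends to `0` and the characteristic functions of the laws of `Y n`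
converge to that of `γ`, then `X n` converges to `γ` in distribution. -/
lemma tendstoInDistribution_of_tendsto_integral_sq {Ω : ℕ → Type*}
    [∀ n, MeasurableSpace (Ω n)] {P : (n : ℕ) → Measure (Ω n)} [∀ n, IsProbabilityMeasure (P n)]
    {X Y : (n : ℕ) → Ω n → ℝ} (hX : ∀ n, Measurable (X n)) (hY : ∀ n, Measurable (Y n))
    (hXY : ∀ n, MemLp (fun ω => X n ω - Y n ω) 2 (P n))
    (h0 : Tendsto (fun n => ∫ ω, (X n ω - Y n ω) ^ 2 ∂(P n)) atTop (𝓝 0))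
    {γ : Measure ℝ} [IsProbabilityMeasure γ]
    (hlim : ∀ t, Tendsto (fun n => charFun ((P n).map (Y n)) t) atTop (𝓝 (charFun γ t))) :
    TendstoInDistribution X atTop id P γ := by
  refine ⟨fun n => (hX n).aemeasurable, aemeasurable_id, ?_⟩
  refine ProbabilityMeasure.tendsto_iff_tendsto_charFun.2 fun t => ?_
  simp only [ProbabilityMeasure.coe_mk, Measure.map_id]
  have hsq : Tendsto (fun n => |t| * √(∫ ω, (X n ω - Y n ω) ^ 2 ∂(P n))) atTop (𝓝 0) := by
    simpa using (h0.sqrt).const_mul |t|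
  have hd : Tendsto (fun n => charFun ((P n).map (X n)) t - charFun ((P n).map (Y n)) t) atTop
      (𝓝 0) :=
    squeeze_zero_norm (fun n => (norm_charFun_map_sub_le (hX n) (hY n)
      ((hXY n).integrable (by norm_num)) t).trans
        (mul_le_mul_of_nonneg_left (integral_abs_le_sqrt (hXY n)) (abs_nonneg t))) hsq
  simpa using hd.add (hlim t)

/-- The central limit theorem for samples of growing size, each on its own product space. -/
lemma tendsto_charFun_map_inv_sqrt_mul_sum {D : Type*} [MeasurableSpace D] (ν : Measure D)
    [IsProbabilityMeasure ν] {g : D → ℝ} (hg : Measurable g) (hg2 : MemLp g 2 ν)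
    (hg0 : ∫ y, g y ∂ν = 0) (t : ℝ) :
    Tendsto (fun n : ℕ => charFun ((Measure.pi fun _ : Fin n => ν).map
      fun x => (√(n : ℝ))⁻¹ * ∑ i, g (x i)) t) atTop
      (𝓝 (charFun (gaussianReal 0 (∫ y, g y ^ 2 ∂ν).toNNReal) t)) := by
  set Q : Measure (ℕ → D) := Measure.infinitePi fun _ => ν with hQ
  set X : ℕ → (ℕ → D) → ℝ := fun i ω => g (ω i) with hXdef
  have hev (i : ℕ) : Q.map (fun ω => ω i) = ν := Measure.infinitePi_map_eval (fun _ => ν) i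
  have hmX (i : ℕ) : Measurable (X i) := hg.comp (measurable_pi_apply i)
  have hmap (i : ℕ) : Q.map (X i) = ν.map g := by
    rw [← hev i, Measure.map_map hg (measurable_pi_apply i)]; rfl
  have hident (i : ℕ) : IdentDistrib (X i) (X 0) Q Q :=
    ⟨(hmX i).aemeasurable, (hmX 0).aemeasurable, by rw [hmap, hmap]⟩
  have hMP : MeasurePreserving (fun ω : ℕ → D => ω 0) Q ν := ⟨measurable_pi_apply 0, hev 0⟩
  have hX2 : MemLp (X 0) 2 Q := hg2.comp_measurePreserving hMP
  have hX0 : ∫ ω, X 0 ω ∂Q = 0 := by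
    rw [← hg0]
    conv_rhs => rw [← hev 0]
    rw [integral_map (measurable_pi_apply 0).aemeasurable hg.aestronglyMeasurable]
  have hvar : Var[X 0; Q] = ∫ y, g y ^ 2 ∂ν := by
    rw [variance_of_integral_eq_zero (hmX 0).aemeasurable hX0]
    conv_rhs => rw [← hev 0]
    rw [integral_map (measurable_pi_apply 0).aemeasurable (hg.pow_const 2).aestronglyMeasurable]
  have hclt := tendstoInDistribution_inv_sqrt_mul_sum_sub (Y := id) (P := Q)
    (P' := gaussianReal 0 Var[X 0; Q].toNNReal) ⟨aemeasurable_id, Measure.map_id⟩ hX2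
    (iIndepFun_infinitePi (P := fun _ : ℕ => ν) (X := fun _ => g) fun _ => hg) hident
  have h := ProbabilityMeasure.tendsto_iff_tendsto_charFun.1 hclt.tendsto t
  simp only [ProbabilityMeasure.coe_mk, Measure.map_id, hvar] at h
  refine h.congr fun n => ?_
  congr 1
  have hr : Q.map (fun ω (i : Fin n) => ω i) = Measure.pi fun _ => ν := by
    rw [← Measure.infinitePi_eq_pi]
    exact Measure.map_infinitePi_infinitePi_of_inj (P := fun _ : ℕ => ν) Fin.val_injective
  rw [← hr, Measure.map_map (by fun_prop) (by fun_prop)]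
  congr 1
  ext ω
  have : ∑ k ∈ Finset.range n, X k ω = ∑ i : Fin n, g (ω i) :=
    (Fin.sum_univ_eq_sum_range (fun k => g (ω k)) n).symm
  simp only [Function.comp, this, hX0]
  ring

end ConvergenceInDistribution

/-! ### The stochastic expansion of a root of an approximate score equation -/

section Expansion

/-- The pointwise estimates behind the expansion of the maximum likelihood estimator. Here `Δ` is
the estimation error, `S` the average score, `I + W` minus its average derivative and `κ + V` its
average second derivative; `β` is `0` where the score equation can be expanded and `1` elsewhere.
Everything is bounded by the single quantity `h⁴ + S⁴ + W⁴ + h² V² + β`, which is homogeneous of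
degree `4` if `Δ`, `S`, `W`, `V` count as multiples of `h`. -/
lemma exists_expansion_bound {I : ℝ} (hI : 0 < I) (κ : ℝ) {r L B : ℝ} (hr : 0 ≤ r) (hL : 0 ≤ L)
    (hB : 0 ≤ B) :
    ∃ C : ℝ, 0 ≤ C ∧ ∀ h Δ S W V β : ℝ, 0 ≤ h → h ≤ 1 → 0 ≤ β → |Δ| ≤ L →
      (1 ≤ β ∨ (|S - (I + W) * Δ| ≤ r * Δ ^ 2 ∧
        |S - (I + W) * Δ + (κ + V) * Δ ^ 2 / 2| ≤ r * |Δ| ^ 3 ∧ |Δ| ≤ B * |S|)) →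
      Δ ^ 4 ≤ C * (h ^ 4 + S ^ 4 + W ^ 4 + h ^ 2 * V ^ 2 + β) ∧
      (Δ - S / I) ^ 2 ≤ C * (h ^ 4 + S ^ 4 + W ^ 4 + h ^ 2 * V ^ 2 + β) ∧
      h * |I * Δ - S + W * S / I - κ * S ^ 2 / (2 * I ^ 2)| ≤
        C * (h ^ 4 + S ^ 4 + W ^ 4 + h ^ 2 * V ^ 2 + β) := by
  -- constants for `Δ⁴`, for `(I Δ - S)²`, and for the second order remainder
  set C₁ : ℝ := B ^ 4 + L ^ 4 with hC₁
  set C₂ : ℝ := 2 + (1 + 2 * r ^ 2) * C₁ + 2 * I ^ 2 * L ^ 2 with hC₂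
  set C₃ : ℝ := (1 + C₁ + r * (1 + C₁)) + (1 + C₂) / I + |κ| / I * (C₂ + C₁ + 1 + 1 / I ^ 2) +
    (I * L + 1 + 1 / I + |κ| / I ^ 2) with hC₃
  have hC₁0 : 0 ≤ C₁ := by positivity
  have hC₂0 : 0 ≤ C₂ := by positivity
  have hC₃0 : 0 ≤ C₃ := by positivity
  refine ⟨C₁ + C₂ / I ^ 2 + C₃, by positivity, fun h Δ S W V β h0 h1 hβ hΔ hcase => ?_⟩
  set M : ℝ := h ^ 4 + S ^ 4 + W ^ 4 + h ^ 2 * V ^ 2 + β with hM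
  have hS4 : 0 ≤ S ^ 4 := by positivity
  have hW4 : 0 ≤ W ^ 4 := by positivity
  have hV2 : 0 ≤ h ^ 2 * V ^ 2 := by positivity
  have hh4 : 0 ≤ h ^ 4 := by positivity
  have hM0 : 0 ≤ M := by positivity
  clear_value M C₁ C₂ C₃
  have hSM : S ^ 4 ≤ M := by linarith
  have hWM : W ^ 4 ≤ M := by linarith
  have hhM : h ^ 4 ≤ M := by linarith
  suffices H : Δ ^ 4 ≤ C₁ * M ∧ (I * Δ - S) ^ 2 ≤ C₂ * M ∧
      h * |I * Δ - S + W * S / I - κ * S ^ 2 / (2 * I ^ 2)| ≤ C₃ * M by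
    obtain ⟨H1, H2, H3⟩ := H
    have h2 : 0 ≤ C₂ / I ^ 2 := by positivity
    refine ⟨H1.trans (mul_le_mul_of_nonneg_right (by linarith) hM0), ?_,
      H3.trans (mul_le_mul_of_nonneg_right (by linarith) hM0)⟩
    have : (Δ - S / I) ^ 2 = (I * Δ - S) ^ 2 / I ^ 2 := by field_simp
    rw [this]
    calc (I * Δ - S) ^ 2 / I ^ 2 ≤ C₂ * M / I ^ 2 := by gcongr
      _ = C₂ / I ^ 2 * M := by ring
      _ ≤ _ := mul_le_mul_of_nonneg_right (by linarith) hM0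
  set Q : ℝ := I * Δ - S with hQ
  clear_value Q
  rcases hcase with hbad | ⟨g1, g2, g3⟩
  · -- off the good event nothing but boundedness of `Δ` is used
    have hM1 : 1 ≤ M := by linarith
    have hS2 : S ^ 2 ≤ M := by linarith [sq_nonneg (S ^ 2 - 1)]
    have hW2 : W ^ 2 ≤ M := by linarith [sq_nonneg (W ^ 2 - 1)]
    have hS1 : |S| ≤ M := by
      have : |S| ≤ (1 + S ^ 2) / 2 := by linarith [sq_nonneg (|S| - 1), sq_abs S]
      linarith
    have hWS : |W * S| ≤ M := by
      rw [abs_mul]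
      linarith [sq_nonneg (|W| - |S|), sq_abs S, sq_abs W]
    have hΔ2 : Δ ^ 2 ≤ L ^ 2 := sq_le_sq' (by linarith [abs_le.1 hΔ]) (abs_le.1 hΔ).2
    have hΔ4 : Δ ^ 4 ≤ L ^ 4 := by
      calc Δ ^ 4 = (Δ ^ 2) ^ 2 := by ring
        _ ≤ (L ^ 2) ^ 2 := by gcongr
        _ = L ^ 4 := by ring
    refine ⟨?_, ?_, ?_⟩
    · calc Δ ^ 4 ≤ L ^ 4 * 1 := by linarith
        _ ≤ C₁ * M := mul_le_mul (by rw [hC₁]; linarith [pow_nonneg hB 4]) hM1 zero_le_one hC₁0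
    · have e1 : Q ^ 2 ≤ 2 * (I ^ 2 * Δ ^ 2) + 2 * S ^ 2 := by
        rw [hQ]; linarith [sq_nonneg (I * Δ + S)]
      have e2 : I ^ 2 * Δ ^ 2 ≤ I ^ 2 * L ^ 2 * M := by
        calc I ^ 2 * Δ ^ 2 ≤ I ^ 2 * L ^ 2 * 1 := by rw [mul_one]; gcongr
          _ ≤ _ := by gcongr
      have e3 : 0 ≤ (1 + 2 * r ^ 2) * C₁ * M := by positivity
      rw [hC₂]; linarith
    · have e0 : |Q + W * S / I - κ * S ^ 2 / (2 * I ^ 2)| ≤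
          I * L * M + M + M / I + |κ| / I ^ 2 * M := by
        have a1 : |I * Δ| ≤ I * L * M := by
          rw [abs_mul, abs_of_pos hI]
          calc I * |Δ| ≤ I * L * 1 := by rw [mul_one]; gcongr
            _ ≤ _ := by gcongr
        have a2 : |W * S / I| ≤ M / I := by rw [abs_div, abs_of_pos hI]; gcongr
        have a3 : |κ * S ^ 2 / (2 * I ^ 2)| ≤ |κ| / I ^ 2 * M := by
          rw [abs_div, abs_mul, abs_of_nonneg (sq_nonneg S),
            abs_of_nonneg (by positivity : 0 ≤ 2 * I ^ 2)]
          calc |κ| * S ^ 2 / (2 * I ^ 2) ≤ |κ| * M / (I ^ 2) := by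
                gcongr; linarith [sq_nonneg I]
            _ = _ := by ring
        calc _ ≤ |I * Δ| + |S| + |W * S / I| + |κ * S ^ 2 / (2 * I ^ 2)| := by
              rw [hQ]
              refine (abs_sub _ _).trans (add_le_add_left ((abs_add_le _ _).trans
                (add_le_add_left (abs_sub _ _) _)) _)
          _ ≤ _ := by linarith
      calc h * |Q + W * S / I - κ * S ^ 2 / (2 * I ^ 2)|
          ≤ 1 * |Q + W * S / I - κ * S ^ 2 / (2 * I ^ 2)| := by gcongr
        _ ≤ I * L * M + M + M / I + |κ| / I ^ 2 * M := by rw [one_mul]; exact e0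
        _ = (I * L + 1 + 1 / I + |κ| / I ^ 2) * M := by ring
        _ ≤ C₃ * M := by
          refine mul_le_mul_of_nonneg_right ?_ hM0
          have : 0 ≤ (1 + C₁ + r * (1 + C₁)) + (1 + C₂) / I +
            |κ| / I * (C₂ + C₁ + 1 + 1 / I ^ 2) := by positivity
          linarith
  · have hΔ4 : Δ ^ 4 ≤ C₁ * M := by
      calc Δ ^ 4 = |Δ| ^ 4 := (Even.pow_abs (by decide) Δ).symm
        _ ≤ (B * |S|) ^ 4 := by gcongr
        _ = B ^ 4 * S ^ 4 := by rw [mul_pow, Even.pow_abs (by decide : Even 4)]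
        _ ≤ C₁ * M := mul_le_mul (by rw [hC₁]; linarith [pow_nonneg hL 4]) hSM hS4 hC₁0
    have hQ1 : |Q| ≤ |W * Δ| + r * Δ ^ 2 := by
      have : Q = -(S - (I + W) * Δ) - W * Δ := by rw [hQ]; ring
      rw [this]
      refine (abs_sub _ _).trans ?_
      rw [abs_neg]; linarith
    have hQ2 : Q ^ 2 ≤ C₂ * M := by
      have e1 : Q ^ 2 ≤ (|W * Δ| + r * Δ ^ 2) ^ 2 := by
        rw [← sq_abs Q]; gcongr
      have e2 : (|W * Δ| + r * Δ ^ 2) ^ 2 ≤ 2 * (W * Δ) ^ 2 + 2 * r ^ 2 * Δ ^ 4 := by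
        linarith [sq_nonneg (|W * Δ| - r * Δ ^ 2), sq_abs (W * Δ)]
      have e3 : 2 * (W * Δ) ^ 2 ≤ W ^ 4 + Δ ^ 4 := by linarith [sq_nonneg (W ^ 2 - Δ ^ 2)]
      have e4 : 2 * r ^ 2 * Δ ^ 4 ≤ 2 * r ^ 2 * (C₁ * M) := by gcongr
      have e5 : 0 ≤ (1 + 2 * I ^ 2 * L ^ 2) * M := by positivity
      rw [hC₂]; linarith
    refine ⟨hΔ4, hQ2, ?_⟩
    -- remainder of the second order expansion
    have hE0 : h * |Q + W * Δ - κ * Δ ^ 2 / 2| ≤ (1 + C₁ + r * (1 + C₁)) * M := by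
      have e1 : |Q + W * Δ - κ * Δ ^ 2 / 2| ≤ r * |Δ| ^ 3 + |V| * Δ ^ 2 / 2 := by
        have : Q + W * Δ - κ * Δ ^ 2 / 2 =
            -(S - (I + W) * Δ + (κ + V) * Δ ^ 2 / 2) + V * Δ ^ 2 / 2 := by rw [hQ]; ring
        rw [this]
        refine (abs_add_le _ _).trans ?_
        rw [abs_neg, abs_div, abs_mul, abs_of_nonneg (sq_nonneg Δ),
          abs_of_pos (by norm_num : (0 : ℝ) < 2)]
        linarith
      have e2 : h * |Δ| ^ 3 ≤ h ^ 4 + Δ ^ 4 := by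
        rw [← Even.pow_abs (by decide : Even 4) Δ]
        have hx := abs_nonneg Δ
        rcases le_total h |Δ| with hle | hle
        · calc h * |Δ| ^ 3 ≤ |Δ| * |Δ| ^ 3 := by gcongr
            _ = |Δ| ^ 4 := by ring
            _ ≤ _ := by linarith
        · calc h * |Δ| ^ 3 ≤ h * h ^ 3 := by gcongr
            _ = h ^ 4 := by ring
            _ ≤ _ := by linarith [pow_nonneg hx 4]
      have e3 : h * (|V| * Δ ^ 2 / 2) ≤ h ^ 2 * V ^ 2 + Δ ^ 4 := by
        rw [← sq_abs V]
        linarith [sq_nonneg (h * |V| - Δ ^ 2), sq_nonneg (h * |V|), sq_nonneg (Δ ^ 2)]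
      calc h * |Q + W * Δ - κ * Δ ^ 2 / 2| ≤ h * (r * |Δ| ^ 3 + |V| * Δ ^ 2 / 2) := by gcongr
        _ = r * (h * |Δ| ^ 3) + h * (|V| * Δ ^ 2 / 2) := by ring
        _ ≤ r * (h ^ 4 + Δ ^ 4) + (h ^ 2 * V ^ 2 + Δ ^ 4) := by gcongr
        _ ≤ r * (M + C₁ * M) + (M + C₁ * M) := by gcongr; linarith
        _ = _ := by ring
    -- replacing `Δ` by `S / I` in the quadratic terms
    have hWQ : h * |W * Q| ≤ (1 + C₂) * M := by
      rw [abs_mul]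
      have e1 : h * (|W| * |Q|) ≤ (h ^ 2 * W ^ 2 + Q ^ 2) / 2 := by
        have e0 : (h * |W|) ^ 2 = h ^ 2 * W ^ 2 := by rw [mul_pow, sq_abs]
        linarith [sq_nonneg (h * |W| - |Q|), sq_abs Q]
      have e2 : h ^ 2 * W ^ 2 ≤ (h ^ 4 + W ^ 4) / 2 := by linarith [sq_nonneg (h ^ 2 - W ^ 2)]
      linarith [mul_nonneg hC₂0 hM0]
    have hQD : h * |Q * (Δ + S / I)| ≤ 2 * (C₂ + C₁ + 1 + 1 / I ^ 2) * M := by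
      rw [abs_mul]
      have e1 : h * (|Q| * |Δ + S / I|) ≤ (Q ^ 2 + h ^ 2 * (Δ + S / I) ^ 2) / 2 := by
        have e0 : (h * |Δ + S / I|) ^ 2 = h ^ 2 * (Δ + S / I) ^ 2 := by rw [mul_pow, sq_abs]
        rw [← e0]
        linarith [sq_nonneg (h * |Δ + S / I| - |Q|), sq_abs Q]
      have e2 : h ^ 2 * (Δ + S / I) ^ 2 ≤ 2 * (h ^ 2 * Δ ^ 2) + 2 * (h ^ 2 * (S ^ 2 / I ^ 2)) := by
        have : (Δ + S / I) ^ 2 ≤ 2 * Δ ^ 2 + 2 * (S ^ 2 / I ^ 2) := by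
          rw [← div_pow]; linarith [sq_nonneg (Δ - S / I)]
        linarith [mul_le_mul_of_nonneg_left this (sq_nonneg h)]
      have e3 : h ^ 2 * Δ ^ 2 ≤ (h ^ 4 + Δ ^ 4) / 2 := by linarith [sq_nonneg (h ^ 2 - Δ ^ 2)]
      have e4 : h ^ 2 * (S ^ 2 / I ^ 2) ≤ 1 / I ^ 2 * M := by
        have : h ^ 2 * S ^ 2 ≤ M := by linarith [sq_nonneg (h ^ 2 - S ^ 2)]
        calc h ^ 2 * (S ^ 2 / I ^ 2) = 1 / I ^ 2 * (h ^ 2 * S ^ 2) := by ring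
          _ ≤ _ := by gcongr
      have e5 : 0 ≤ 1 / I ^ 2 * M := by positivity
      linarith [mul_nonneg hC₂0 hM0, mul_nonneg hC₁0 hM0]
    have hsplit : Q + W * S / I - κ * S ^ 2 / (2 * I ^ 2) =
        (Q + W * Δ - κ * Δ ^ 2 / 2) - W * Q / I + κ / (2 * I) * (Q * (Δ + S / I)) := by
      rw [hQ]; field_simp; ring
    calc h * |Q + W * S / I - κ * S ^ 2 / (2 * I ^ 2)|
        ≤ h * (|Q + W * Δ - κ * Δ ^ 2 / 2| + |W * Q| / I +
            |κ| / (2 * I) * |Q * (Δ + S / I)|) := by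
          gcongr
          rw [hsplit]
          refine (abs_add_le _ _).trans (add_le_add ((abs_sub _ _).trans ?_) ?_)
          · rw [abs_div, abs_of_pos hI]
          · rw [abs_mul, abs_div, abs_of_pos (by positivity : 0 < 2 * I)]
      _ = h * |Q + W * Δ - κ * Δ ^ 2 / 2| + (h * |W * Q|) / I +
            |κ| / (2 * I) * (h * |Q * (Δ + S / I)|) := by ring
      _ ≤ (1 + C₁ + r * (1 + C₁)) * M + ((1 + C₂) * M) / I +
            |κ| / (2 * I) * (2 * (C₂ + C₁ + 1 + 1 / I ^ 2) * M) := by gcongr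
      _ = ((1 + C₁ + r * (1 + C₁)) + (1 + C₂) / I +
            |κ| / I * (C₂ + C₁ + 1 + 1 / I ^ 2)) * M := by field_simp
      _ ≤ C₃ * M := by
          refine mul_le_mul_of_nonneg_right ?_ hM0
          have : 0 ≤ I * L + 1 + 1 / I + |κ| / I ^ 2 := by positivity
          linarith

/-- The moments of the estimation error `Δ`: it has fourth moment `O(h⁴)`, it is `S / I` up to
`O(h²)` in mean square, and its mean is determined by the second moments of `S` and `W` up to
`O(h³)`. -/
lemma exists_moment_expansion {I : ℝ} (hI : 0 < I) (κ : ℝ) {r L B c : ℝ} (hr : 0 ≤ r) (hL : 0 ≤ L)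
    (hB : 0 ≤ B) (hc : 0 ≤ c) :
    ∃ C : ℝ, 0 ≤ C ∧ ∀ {Ω : Type _} [MeasurableSpace Ω] (P : Measure Ω) [IsProbabilityMeasure P]
      (h : ℝ) (Δ S W V : Ω → ℝ) (A : Set Ω), 0 < h → h ≤ 1 → MeasurableSet A → Measurable Δ →
      MemLp S 4 P → MemLp W 4 P → MemLp V 2 P → (∀ ω, |Δ ω| ≤ L) →
      (∀ ω ∈ A, |S ω - (I + W ω) * Δ ω| ≤ r * Δ ω ^ 2 ∧
        |S ω - (I + W ω) * Δ ω + (κ + V ω) * Δ ω ^ 2 / 2| ≤ r * |Δ ω| ^ 3 ∧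
        |Δ ω| ≤ B * |S ω|) →
      ∫ ω, S ω ^ 4 ∂P ≤ c * h ^ 4 → ∫ ω, W ω ^ 4 ∂P ≤ c * h ^ 4 → ∫ ω, V ω ^ 2 ∂P ≤ c * h ^ 2 →
      P.real Aᶜ ≤ c * h ^ 4 →
      ∫ ω, Δ ω ^ 4 ∂P ≤ C * h ^ 4 ∧ ∫ ω, (Δ ω - S ω / I) ^ 2 ∂P ≤ C * h ^ 4 ∧
      |I * ∫ ω, Δ ω ∂P - ∫ ω, S ω ∂P + (∫ ω, W ω * S ω ∂P) / I -
        κ * (∫ ω, S ω ^ 2 ∂P) / (2 * I ^ 2)| ≤ C * h ^ 3 := by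
  obtain ⟨C, hC, H⟩ := exists_expansion_bound hI κ hr hL hB
  refine ⟨C * (1 + 4 * c), by positivity, fun P _ h Δ S W V A h0 h1 hA hΔm hS hW hV hΔ hgood
    hS4 hW4 hV2 hPA => ?_⟩
  set β : _ → ℝ := Aᶜ.indicator 1 with hβ
  set M : _ → ℝ := fun ω => h ^ 4 + S ω ^ 4 + W ω ^ 4 + h ^ 2 * V ω ^ 2 + β ω with hM
  have key ω := H h (Δ ω) (S ω) (W ω) (V ω) (β ω) h0.le h1
    (Set.indicator_nonneg (fun _ _ => zero_le_one) ω) (hΔ ω) (by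
      by_cases hω : ω ∈ A
      · exact Or.inr (hgood ω hω)
      · left; simp [hβ, hω])
  have iβ : Integrable β P := (integrable_const (1 : ℝ)).indicator hA.compl
  have iS := hS.integrable_pow_four
  have iW := hW.integrable_pow_four
  have iV := hV.integrable_sq.const_mul (h ^ 2)
  have i0 : Integrable (fun _ => h ^ 4) P := integrable_const _
  have iM : Integrable M P := (((i0.fun_add iS).fun_add iW).fun_add iV).fun_add iβ
  have hEM : ∫ ω, M ω ∂P ≤ (1 + 4 * c) * h ^ 4 := by
    have e1 : ∫ ω, M ω ∂P = h ^ 4 + ∫ ω, S ω ^ 4 ∂P + ∫ ω, W ω ^ 4 ∂P +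
        h ^ 2 * ∫ ω, V ω ^ 2 ∂P + P.real Aᶜ := by
      rw [hM, integral_add (((i0.fun_add iS).fun_add iW).fun_add iV) iβ,
        integral_add ((i0.fun_add iS).fun_add iW) iV, integral_add (i0.fun_add iS) iW,
        integral_add i0 iS, integral_const_mul, hβ, integral_indicator_one hA.compl]
      simp
    have e2 : h ^ 2 * ∫ ω, V ω ^ 2 ∂P ≤ h ^ 2 * (c * h ^ 2) := by gcongr
    rw [e1]; nlinarith
  have hCM : ∫ ω, C * M ω ∂P ≤ C * (1 + 4 * c) * h ^ 4 := by
    rw [integral_const_mul, mul_assoc]; gcongr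
  have iCM : Integrable (fun ω => C * M ω) P := iM.const_mul C
  have hΔb : MemLp Δ 2 P := MemLp.of_bound hΔm.aestronglyMeasurable L (ae_of_all _ hΔ)
  have hS2 := hS.two_of_four
  have hW2 := hW.two_of_four
  refine ⟨(integral_mono_of_nonneg (ae_of_all _ fun ω => by positivity) iCM
    (ae_of_all _ fun ω => (key ω).1)).trans hCM,
    (integral_mono_of_nonneg (ae_of_all _ fun ω => by positivity) iCM
    (ae_of_all _ fun ω => (key ω).2.1)).trans hCM, ?_⟩
  have iΔ : Integrable (fun ω => I * Δ ω) P := (hΔb.integrable (by norm_num)).const_mul I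
  have iS1 : Integrable S P := hS2.integrable (by norm_num)
  have iWS : Integrable (fun ω => W ω * S ω / I) P := (hW2.integrable_mul hS2).div_const I
  have iSS : Integrable (fun ω => κ * S ω ^ 2 / (2 * I ^ 2)) P :=
    (hS2.integrable_sq.const_mul κ).div_const _
  have e1 : I * ∫ ω, Δ ω ∂P - ∫ ω, S ω ∂P + (∫ ω, W ω * S ω ∂P) / I -
        κ * (∫ ω, S ω ^ 2 ∂P) / (2 * I ^ 2) =
      ∫ ω, (I * Δ ω - S ω + W ω * S ω / I - κ * S ω ^ 2 / (2 * I ^ 2)) ∂P := by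
    rw [integral_sub ((iΔ.sub' iS1).fun_add iWS) iSS, integral_add (iΔ.sub' iS1) iWS,
      integral_sub iΔ iS1, integral_const_mul, integral_div, integral_div, integral_const_mul]
  have e2 : h * |∫ ω, (I * Δ ω - S ω + W ω * S ω / I - κ * S ω ^ 2 / (2 * I ^ 2)) ∂P| ≤
      C * (1 + 4 * c) * h ^ 4 := by
    calc _ = ‖∫ ω, h * (I * Δ ω - S ω + W ω * S ω / I - κ * S ω ^ 2 / (2 * I ^ 2)) ∂P‖ := by
          rw [integral_const_mul, norm_mul, Real.norm_eq_abs, Real.norm_eq_abs, abs_of_pos h0]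
      _ ≤ ∫ ω, C * M ω ∂P := norm_integral_le_of_norm_le iCM (ae_of_all _ fun ω => by
          rw [norm_mul, Real.norm_eq_abs, Real.norm_eq_abs, abs_of_pos h0]
          exact (key ω).2.2)
      _ ≤ _ := hCM
  rw [e1]
  refine le_of_mul_le_mul_left (e2.trans_eq ?_) h0
  ring

end Expansion

/-! ### Regularity of the log-likelihood -/

namespace ParametricModel

variable {D : Type*} [MeasurableSpace D] {M : ParametricModel D}

/-- The `j`-th derivative of the log-density as a function of a real parameter. -/
noncomputable def logDeriv (M : ParametricModel D) (j : ℕ) (x : D) (t : ℝ) : ℝ :=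
  iteratedDerivWithin j (fun t => Real.log (M.f x t)) M.paramSpace t

lemma dlog_eq_logDeriv (j : ℕ) (x : D) (θ : M.paramSpace) : M.dlog j x θ = M.logDeriv j x θ := rfl

lemma logDeriv_zero (x : D) (t : ℝ) : M.logDeriv 0 x t = Real.log (M.f x t) := by
  simp [logDeriv]

/-- A smooth model whose log-derivatives up to order four are dominated by `G`, where `(1 + G)⁴`
times the density is dominated by the integrable function `H`, uniformly in the parameter. -/
structure IsEnvelope (M : ParametricModel D) (G H : D → ℝ) : Prop where
  smooth : ∀ x, ContDiffOn ℝ 4 (fun t => Real.log (M.f x t)) M.paramSpace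
  measurable_left : Measurable G
  integrable_right : Integrable H M.μ
  abs_logDeriv_le : ∀ j, 1 ≤ j → j ≤ 4 → ∀ x, ∀ t ∈ M.paramSpace, |M.logDeriv j x t| ≤ G x
  mul_pow_le : ∀ x, ∀ t ∈ M.paramSpace, M.f x t * (1 + G x) ^ 4 ≤ H x

lemma Regular.exists_isEnvelope (hM : M.Regular) : ∃ G H, M.IsEnvelope G H := by
  obtain ⟨G, H, hG, hH, h1, h2⟩ := hM.dominated
  exact ⟨G, H, hM.smooth, hG, hH,
    fun j hj hj' x t ht => h1 j (Finset.mem_Icc.2 ⟨hj, hj'⟩) x ⟨t, ht⟩, fun x t ht => h2 x ⟨t, ht⟩⟩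

namespace IsEnvelope

variable {G H : D → ℝ} (hE : M.IsEnvelope G H)
include hE

lemma hasDerivWithinAt_logDeriv {j : ℕ} (hj : j < 4) (x : D) {t : ℝ} (ht : t ∈ M.paramSpace) :
    HasDerivWithinAt (M.logDeriv j x) (M.logDeriv (j + 1) x t) M.paramSpace t := by
  have hd := (hE.smooth x).differentiableOn_iteratedDerivWithin (m := j) (by exact_mod_cast hj)
    (uniqueDiffOn_Icc M.a_lt_b)
  have := (hd t ht).hasDerivWithinAt
  rwa [← iteratedDerivWithin_succ] at this

lemma nonneg_left (x : D) : 0 ≤ G x :=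
  (abs_nonneg _).trans (hE.abs_logDeriv_le 1 le_rfl (by norm_num) x M.a ⟨le_rfl, M.a_lt_b.le⟩)

lemma abs_logDeriv_sub_le {j : ℕ} (hj : j < 4) (x : D) {t u : ℝ} (ht : t ∈ M.paramSpace)
    (hu : u ∈ M.paramSpace) : |M.logDeriv j x t - M.logDeriv j x u| ≤ G x * |t - u| :=
  Convex.norm_image_sub_le_of_norm_hasDerivWithin_le
    (fun _ hv => hE.hasDerivWithinAt_logDeriv hj x hv)
    (fun v hv => hE.abs_logDeriv_le (j + 1) (by omega) (by omega) x v hv) (convex_Icc _ _) hu ht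

/-- Taylor expansion of the score to first order. -/
lemma abs_taylor_one_le (x : D) {t u : ℝ} (ht : t ∈ M.paramSpace) (hu : u ∈ M.paramSpace)
    {j : ℕ} (hj : j < 3) :
    |M.logDeriv j x t - M.logDeriv j x u - M.logDeriv (j + 1) x u * (t - u)| ≤
      G x * |t - u| ^ 2 := by
  set s : Set ℝ := M.paramSpace ∩ Metric.closedBall u |t - u| with hs
  have hsub : s ⊆ M.paramSpace := Set.inter_subset_left
  have hconv : Convex ℝ s := (convex_Icc _ _).inter (convex_closedBall _ _)
  have hts : t ∈ s := ⟨ht, by rw [Metric.mem_closedBall, Real.dist_eq]⟩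
  have hus : u ∈ s := ⟨hu, by simp⟩
  have := Convex.norm_image_sub_le_of_norm_hasDerivWithin_le (C := G x * |t - u|)
    (f := fun v => M.logDeriv j x v - M.logDeriv (j + 1) x u * (v - u))
    (f' := fun v => M.logDeriv (j + 1) x v - M.logDeriv (j + 1) x u) (s := s)
    (fun v hv => by
      have h1 := (hE.hasDerivWithinAt_logDeriv (by omega : j < 4) x (hsub hv)).mono hsub
      have h2 := ((hasDerivWithinAt_id v s).sub_const u).const_mul (M.logDeriv (j + 1) x u)
      exact (h1.sub h2).congr_deriv (by simp))
    (fun v hv => (hE.abs_logDeriv_sub_le (by omega) x (hsub hv) hu).trans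
      (mul_le_mul_of_nonneg_left (by simpa [Real.dist_eq] using hv.2) (hE.nonneg_left x)))
    hconv hus hts
  simp only [Real.norm_eq_abs, sub_self, mul_zero, sub_zero] at this
  calc _ = |M.logDeriv j x t - M.logDeriv (j + 1) x u * (t - u) - M.logDeriv j x u| := by
        congr 1; ring
    _ ≤ G x * |t - u| * |t - u| := this
    _ = _ := by ring

/-- Taylor expansion of the score to second order. -/
lemma abs_taylor_two_le (x : D) {t u : ℝ} (ht : t ∈ M.paramSpace) (hu : u ∈ M.paramSpace) :
    |M.logDeriv 1 x t - M.logDeriv 1 x u - M.logDeriv 2 x u * (t - u) -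
      M.logDeriv 3 x u * (t - u) ^ 2 / 2| ≤ G x * |t - u| ^ 3 := by
  set s : Set ℝ := M.paramSpace ∩ Metric.closedBall u |t - u| with hs
  have hsub : s ⊆ M.paramSpace := Set.inter_subset_left
  have hconv : Convex ℝ s := (convex_Icc _ _).inter (convex_closedBall _ _)
  have hts : t ∈ s := ⟨ht, by rw [Metric.mem_closedBall, Real.dist_eq]⟩
  have hus : u ∈ s := ⟨hu, by simp⟩
  have := Convex.norm_image_sub_le_of_norm_hasDerivWithin_le (C := G x * |t - u| ^ 2)
    (f := fun v => M.logDeriv 1 x v - M.logDeriv 2 x u * (v - u) -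
      M.logDeriv 3 x u * ((v - u) ^ 2 / 2))
    (f' := fun v => M.logDeriv 2 x v - M.logDeriv 2 x u - M.logDeriv 3 x u * (v - u)) (s := s)
    (fun v hv => by
      have h1 := (hE.hasDerivWithinAt_logDeriv (by norm_num : 1 < 4) x (hsub hv)).mono hsub
      have h0 := (hasDerivWithinAt_id v s).sub_const u
      have h2 := h0.const_mul (M.logDeriv 2 x u)
      have h3 := ((h0.pow 2).div_const 2).const_mul (M.logDeriv 3 x u)
      refine ((h1.sub h2).sub h3).congr_deriv ?_
      simp)
    (fun v hv => (hE.abs_taylor_one_le x (hsub hv) hu (by norm_num : 2 < 3)).trans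
      (mul_le_mul_of_nonneg_left (pow_le_pow_left₀ (abs_nonneg _)
        (by simpa [Real.dist_eq] using hv.2) 2) (hE.nonneg_left x)))
    hconv hus hts
  simp only [Real.norm_eq_abs, sub_self, mul_zero, sub_zero, ne_eq, OfNat.ofNat_ne_zero,
    not_false_eq_true, zero_pow, zero_div] at this
  calc _ = |M.logDeriv 1 x t - M.logDeriv 2 x u * (t - u) -
          M.logDeriv 3 x u * ((t - u) ^ 2 / 2) - M.logDeriv 1 x u| := by congr 1; ring
    _ ≤ G x * |t - u| ^ 2 * |t - u| := this
    _ = _ := by ring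

/-- The derivatives of the log-likelihood are limits of difference quotients, hence measurable in
the observation. -/
lemma measurable_logDeriv {j : ℕ} (hj : j ≤ 4) {t : ℝ} (ht : t ∈ M.paramSpace) :
    Measurable fun x => M.logDeriv j x t := by
  induction j generalizing t with
  | zero => simp only [logDeriv_zero]; exact (M.measurable_f t ht).log
  | succ j ih =>
    have hacc : (𝓝[M.paramSpace \ {t}] t).NeBot := accPt_principal_iff_nhdsWithin.1
      (uniqueDiffWithinAt_iff_accPt.1 (uniqueDiffOn_Icc M.a_lt_b t ht))
    obtain ⟨u, hu, hut⟩ := mem_closure_iff_seq_limit.1 (mem_closure_iff_nhdsWithin_neBot.2 hacc)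
    have hlim : Tendsto u atTop (𝓝[M.paramSpace \ {t}] t) :=
      tendsto_nhdsWithin_iff.2 ⟨hut, Eventually.of_forall hu⟩
    refine measurable_of_tendsto_metrizable
      (f := fun n x => slope (M.logDeriv j x) t (u n)) (fun n => ?_)
      (tendsto_pi_nhds.2 fun x => (hasDerivWithinAt_iff_tendsto_slope.1
        (hE.hasDerivWithinAt_logDeriv (by omega) x ht)).comp hlim)
    simp only [slope_def_field]
    exact ((ih (by omega) (hu n).1).sub (ih (by omega) ht)).div_const _

lemma hasDerivWithinAt_f (x : D) {t : ℝ} (ht : t ∈ M.paramSpace) :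
    HasDerivWithinAt (M.f x) (M.logDeriv 1 x t * M.f x t) M.paramSpace t := by
  have h := (hE.hasDerivWithinAt_logDeriv (by norm_num : 0 < 4) x ht).exp
  have heq (u : ℝ) (hu : u ∈ M.paramSpace) : M.f x u = Real.exp (M.logDeriv 0 x u) := by
    rw [logDeriv_zero, Real.exp_log (M.pos_f x u hu)]
  rw [← heq t ht, mul_comm] at h
  exact h.congr heq (heq t ht)

end IsEnvelope

/-! ### Expectations under the model -/

lemma integral_law (θ : M.paramSpace) (g : D → ℝ) :
    ∫ x, g x ∂(M.law θ) = ∫ x, g x * M.f x θ ∂M.μ := by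
  rw [law, integral_withDensity_eq_integral_toReal_smul
    (M.measurable_f θ θ.2).ennreal_ofReal (ae_of_all _ fun _ => ENNReal.ofReal_lt_top)]
  refine integral_congr_ae (ae_of_all _ fun x => ?_)
  simp only [smul_eq_mul]
  rw [ENNReal.toReal_ofReal (M.pos_f x θ θ.2).le, mul_comm]

lemma integrable_law_iff (θ : M.paramSpace) (g : D → ℝ) :
    Integrable g (M.law θ) ↔ Integrable (fun x => g x * M.f x θ) M.μ := by
  rw [law, integrable_withDensity_iff (M.measurable_f θ θ.2).ennreal_ofReal
    (ae_of_all _ fun _ => ENNReal.ofReal_lt_top)]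
  refine integrable_congr (ae_of_all _ fun x => ?_)
  simp only
  rw [ENNReal.toReal_ofReal (M.pos_f x θ θ.2).le]

namespace IsEnvelope

variable {G H : D → ℝ} (hE : M.IsEnvelope G H)
include hE

lemma memLp_left (θ : M.paramSpace) : MemLp (fun x => 1 + G x) 4 (M.law θ) := by
  have hm := hE.measurable_left
  rw [← integrable_norm_rpow_iff (by fun_prop) (by norm_num) (by norm_num), integrable_law_iff]
  have h4 (y : ℝ) : y ^ (4 : ENNReal).toReal = y ^ 4 := by
    rw [show (4 : ENNReal).toReal = (4 : ℕ) by norm_num, Real.rpow_natCast]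
  simp only [h4]
  refine hE.integrable_right.mono' ?_ (ae_of_all _ fun x => ?_)
  · have := M.measurable_f θ θ.2
    fun_prop
  · have h0 := hE.nonneg_left x
    have hf := M.pos_f x θ θ.2
    rw [Real.norm_of_nonneg (by positivity), Real.norm_of_nonneg (by positivity), mul_comm]
    simpa using hE.mul_pow_le x θ θ.2

lemma memLp_four {g : D → ℝ} (hg : Measurable g) {C : ℝ} (h : ∀ x, |g x| ≤ C * (1 + G x))
    (θ : M.paramSpace) : MemLp g 4 (M.law θ) :=
  (hE.memLp_left θ).of_le_mul hg.aestronglyMeasurable (ae_of_all _ fun x => by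
    rw [Real.norm_eq_abs, Real.norm_of_nonneg (by linarith [hE.nonneg_left x])]; exact h x)

lemma memLp_G (θ : M.paramSpace) : MemLp G 4 (M.law θ) :=
  hE.memLp_four hE.measurable_left (C := 1) (fun x => by
    rw [abs_of_nonneg (hE.nonneg_left x)]; linarith) θ

lemma memLp_logDeriv {j : ℕ} (h1 : 1 ≤ j) (h4 : j ≤ 4) {t : ℝ} (ht : t ∈ M.paramSpace)
    (θ : M.paramSpace) : MemLp (fun x => M.logDeriv j x t) 4 (M.law θ) :=
  hE.memLp_four (hE.measurable_logDeriv h4 ht) (C := 1) (fun x => by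
    linarith [hE.abs_logDeriv_le j h1 h4 x t ht]) θ

/-- Differentiating `∫ f = 1` once and twice under the integral sign: the score is centred, and the
information is minus the expected second derivative of the log-likelihood. -/
lemma integral_logDeriv_one_and_two (θ : M.paramSpace) (hθ : (θ : ℝ) ∈ interior M.paramSpace) :
    ∫ x, M.logDeriv 1 x θ ∂(M.law θ) = 0 ∧
      ∫ x, M.logDeriv 2 x θ ∂(M.law θ) = -M.fisherInfo θ := by
  have hnhds (t : ℝ) (ht : t ∈ interior M.paramSpace) : interior M.paramSpace ∈ 𝓝 t :=
    isOpen_interior.mem_nhds ht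
  have hsub : interior M.paramSpace ⊆ M.paramSpace := interior_subset
  have hpow (x : D) (t : ℝ) (ht : t ∈ M.paramSpace) {c : ℝ} (hc : c ≤ (1 + G x) ^ 4) :
      c * M.f x t ≤ H x := by
    refine le_trans ?_ (hE.mul_pow_le x t ht)
    rw [mul_comm]
    exact mul_le_mul_of_nonneg_left hc (M.pos_f x t ht).le
  have hG1 (x : D) : G x ≤ (1 + G x) ^ 4 := by
    have h0 := hE.nonneg_left x
    nlinarith [one_le_pow₀ (by linarith : 1 ≤ 1 + G x) (n := 3),
      show (1 + G x) ^ 4 = (1 + G x) ^ 3 * (1 + G x) by ring]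
  have hG2 (x : D) : G x + G x ^ 2 ≤ (1 + G x) ^ 4 := by
    have h0 := hE.nonneg_left x
    nlinarith [one_le_pow₀ (by linarith : 1 ≤ 1 + G x) (n := 2),
      show (1 + G x) ^ 4 = (1 + G x) ^ 2 * (1 + G x) ^ 2 by ring]
  have hfd (x : D) (t : ℝ) (ht : t ∈ interior M.paramSpace) :
      HasDerivAt (M.f x) (M.logDeriv 1 x t * M.f x t) t :=
    (hE.hasDerivWithinAt_f x (hsub ht)).hasDerivAt (mem_interior_iff_mem_nhds.1 ht)
  have hmeas (j : ℕ) (hj : j ≤ 4) (t : ℝ) (ht : t ∈ M.paramSpace) :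
      Measurable fun x => M.logDeriv j x t * M.f x t :=
    (hE.measurable_logDeriv hj ht).mul (M.measurable_f t ht)
  have hint (t : ℝ) (ht : t ∈ M.paramSpace) : Integrable (fun x => M.f x t) M.μ := by
    have := (integrable_law_iff ⟨t, ht⟩ (fun _ => (1 : ℝ))).1 (integrable_const _)
    simpa using this
  have hone (t : ℝ) (ht : t ∈ M.paramSpace) : ∫ x, M.f x t ∂M.μ = 1 := by
    have := integral_law ⟨t, ht⟩ (fun _ => (1 : ℝ))
    simpa using this.symm
  have habs (x : D) (j : ℕ) (h1 : 1 ≤ j) (h4 : j ≤ 4) (t : ℝ) (ht : t ∈ M.paramSpace) :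
      ‖M.logDeriv j x t * M.f x t‖ ≤ H x := by
    rw [norm_mul, Real.norm_of_nonneg (M.pos_f x t ht).le]
    exact hpow x t ht ((hE.abs_logDeriv_le j h1 h4 x t ht).trans (hG1 x))
  have hfirst (t : ℝ) (ht : t ∈ interior M.paramSpace) :
      ∫ x, M.logDeriv 1 x t * M.f x t ∂M.μ = 0 := by
    have h := (hasDerivAt_integral_of_dominated_loc_of_deriv_le (μ := M.μ) (hnhds t ht)
      (F := fun t x => M.f x t) (F' := fun t x => M.logDeriv 1 x t * M.f x t) (bound := H)
      (by filter_upwards [hnhds t ht] with u hu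
          exact (M.measurable_f u (hsub hu)).aestronglyMeasurable)
      (hint t (hsub ht)) (hmeas 1 (by norm_num) t (hsub ht)).aestronglyMeasurable
      (ae_of_all _ fun x u hu => habs x 1 le_rfl (by norm_num) u (hsub hu)) hE.integrable_right
      (ae_of_all _ fun x u hu => hfd x u hu)).2
    have hc : HasDerivAt (fun u => ∫ x, M.f x u ∂M.μ) 0 t :=
      (hasDerivAt_const t (1 : ℝ)).congr_of_eventuallyEq (by
        filter_upwards [hnhds t ht] with u hu using hone u (hsub hu))
    exact h.unique hc
  refine ⟨by rw [integral_law]; exact hfirst θ hθ, ?_⟩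
  have hi1 : Integrable (fun x => M.logDeriv 1 x θ * M.f x θ) M.μ :=
    (integrable_law_iff θ _).1
      ((hE.memLp_logDeriv le_rfl (by norm_num) θ.2 θ).integrable (by norm_num))
  have h := (hasDerivAt_integral_of_dominated_loc_of_deriv_le (μ := M.μ) (hnhds θ hθ)
    (F := fun t x => M.logDeriv 1 x t * M.f x t)
    (F' := fun t x => (M.logDeriv 2 x t + M.logDeriv 1 x t ^ 2) * M.f x t) (bound := H)
    (by filter_upwards [hnhds θ hθ] with u hu
        exact (hmeas 1 (by norm_num) u (hsub hu)).aestronglyMeasurable)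
    hi1
    (((hE.measurable_logDeriv (by norm_num : 2 ≤ 4) θ.2).add
      ((hE.measurable_logDeriv (by norm_num : 1 ≤ 4) θ.2).pow_const 2)).mul
        (M.measurable_f θ θ.2)).aestronglyMeasurable
    (ae_of_all _ fun x u hu => by
      rw [norm_mul, Real.norm_of_nonneg (M.pos_f x u (hsub hu)).le]
      refine hpow x u (hsub hu) (le_trans ?_ (hG2 x))
      have h1 := hE.abs_logDeriv_le 1 le_rfl (by norm_num) x u (hsub hu)
      have h2 := hE.abs_logDeriv_le 2 (by norm_num) (by norm_num) x u (hsub hu)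
      refine (norm_add_le _ _).trans (add_le_add h2 ?_)
      rw [norm_pow]
      exact pow_le_pow_left₀ (norm_nonneg _) h1 2) hE.integrable_right
    (ae_of_all _ fun x u hu => by
      have h1 := (hE.hasDerivWithinAt_logDeriv (by norm_num : 1 < 4) x (hsub hu)).hasDerivAt
        (mem_interior_iff_mem_nhds.1 hu)
      refine (h1.mul (hfd x u hu)).congr_deriv ?_
      ring)).2
  have hc : HasDerivAt (fun u => ∫ x, M.logDeriv 1 x u * M.f x u ∂M.μ) 0 θ :=
    (hasDerivAt_const (θ : ℝ) (0 : ℝ)).congr_of_eventuallyEq (by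
      filter_upwards [hnhds θ hθ] with u hu using hfirst u hu)
  have h0 := h.unique hc
  rw [← integral_law θ fun x => M.logDeriv 2 x θ + M.logDeriv 1 x θ ^ 2, integral_add
    ((hE.memLp_logDeriv (by norm_num) (by norm_num) θ.2 θ).integrable (by norm_num))
    (hE.memLp_logDeriv le_rfl (by norm_num) θ.2 θ).two_of_four.integrable_sq] at h0
  have hI : M.fisherInfo θ = ∫ x, M.logDeriv 1 x θ ^ 2 ∂(M.law θ) := rfl
  rw [hI]; linarith

lemma pow_le_one_add_pow (x : D) {j : ℕ} (hj : j ≤ 4) : G x ^ j ≤ (1 + G x) ^ 4 := by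
  have h0 := hE.nonneg_left x
  exact (pow_le_pow_left₀ h0 (by linarith) j).trans (pow_le_pow_right₀ (by linarith) hj)

/-- An expectation `E_θ[p(X, θ)]` is Lipschitz in `θ`, since the derivative of `p · f` in the
parameter is dominated by an integrable function. -/
lemma abs_integral_law_sub_le {p p' : D → ℝ → ℝ} {K : ℝ}
    (hp : ∀ x, ∀ t ∈ M.paramSpace, HasDerivWithinAt (p x) (p' x t) M.paramSpace t)
    (hint : ∀ θ : M.paramSpace, Integrable (fun x => p x θ) (M.law θ))
    (hb : ∀ x, ∀ t ∈ M.paramSpace,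
      |p' x t + p x t * M.logDeriv 1 x t| ≤ K * (1 + G x) ^ 4) (hK : 0 ≤ K)
    (θ θ' : M.paramSpace) :
    |∫ x, p x θ ∂(M.law θ) - ∫ x, p x θ' ∂(M.law θ')| ≤ K * (∫ x, H x ∂M.μ) * |(θ : ℝ) - θ'| := by
  rw [integral_law, integral_law, ← integral_sub ((integrable_law_iff θ _).1 (hint θ))
    ((integrable_law_iff θ' _).1 (hint θ'))]
  have hmv (x : D) : ‖p x θ * M.f x θ - p x θ' * M.f x θ'‖ ≤ K * H x * |(θ : ℝ) - θ'| := by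
    refine Convex.norm_image_sub_le_of_norm_hasDerivWithin_le (s := M.paramSpace)
      (f := fun t => p x t * M.f x t)
      (fun t ht => (hp x t ht).mul (hE.hasDerivWithinAt_f x ht)) (fun t ht => ?_)
      (convex_Icc _ _) θ'.2 θ.2
    have hf := (M.pos_f x t ht).le
    rw [show p' x t * M.f x t + p x t * (M.logDeriv 1 x t * M.f x t) =
      (p' x t + p x t * M.logDeriv 1 x t) * M.f x t by ring, norm_mul, Real.norm_of_nonneg hf]
    calc _ ≤ K * (1 + G x) ^ 4 * M.f x t := mul_le_mul_of_nonneg_right (hb x t ht) hf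
      _ = K * (M.f x t * (1 + G x) ^ 4) := by ring
      _ ≤ K * H x := mul_le_mul_of_nonneg_left (hE.mul_pow_le x t ht) hK
  calc _ ≤ ∫ x, K * H x * |(θ : ℝ) - θ'| ∂M.μ := norm_integral_le_of_norm_le
        ((hE.integrable_right.const_mul K).mul_const _) (ae_of_all _ hmv)
    _ = _ := by rw [integral_mul_const, integral_const_mul]

lemma exists_abs_fisherInfo_sub_le : ∃ K, 0 ≤ K ∧ ∀ θ θ' : M.paramSpace,
    |M.fisherInfo θ - M.fisherInfo θ'| ≤ K * |(θ : ℝ) - θ'| := by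
  have hH : 0 ≤ ∫ x, H x ∂M.μ := integral_nonneg fun x =>
    (by have := M.pos_f x M.a ⟨le_rfl, M.a_lt_b.le⟩; positivity : (0 : ℝ) ≤ _).trans
      (hE.mul_pow_le x M.a ⟨le_rfl, M.a_lt_b.le⟩)
  refine ⟨3 * ∫ x, H x ∂M.μ, by positivity, hE.abs_integral_law_sub_le
    (p := fun x t => M.logDeriv 1 x t ^ 2)
    (p' := fun x t => 2 * M.logDeriv 1 x t * M.logDeriv 2 x t) (fun x t ht => ?_) (fun θ => ?_)
    (fun x t ht => ?_) (by norm_num)⟩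
  · refine ((hE.hasDerivWithinAt_logDeriv (by norm_num : 1 < 4) x ht).pow 2).congr_deriv ?_
    simp
  · exact (hE.memLp_logDeriv le_rfl (by norm_num) θ.2 θ).two_of_four.integrable_sq
  · have h1 := hE.abs_logDeriv_le 1 le_rfl (by norm_num) x t ht
    have h2 := hE.abs_logDeriv_le 2 (by norm_num) (by norm_num) x t ht
    have h0 := hE.nonneg_left x
    calc _ ≤ |2 * M.logDeriv 1 x t * M.logDeriv 2 x t| +
          |M.logDeriv 1 x t ^ 2 * M.logDeriv 1 x t| := abs_add_le _ _
      _ = 2 * |M.logDeriv 1 x t| * |M.logDeriv 2 x t| + |M.logDeriv 1 x t| ^ 3 := by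
          rw [← pow_succ, abs_pow, abs_mul, abs_mul, abs_two]
      _ ≤ 2 * G x * G x + G x ^ 3 := by gcongr
      _ ≤ _ := by
          have := hE.pow_le_one_add_pow x (by norm_num : 2 ≤ 4)
          have := hE.pow_le_one_add_pow x (by norm_num : 3 ≤ 4)
          linarith

lemma exists_abs_b₁_numerator_sub_le : ∃ K, 0 ≤ K ∧ ∀ θ θ' : M.paramSpace,
    |(2 * (∫ x, M.dlog 1 x θ * M.dlog 2 x θ ∂(M.law θ)) + ∫ x, M.dlog 3 x θ ∂(M.law θ)) -
      (2 * (∫ x, M.dlog 1 x θ' * M.dlog 2 x θ' ∂(M.law θ')) + ∫ x, M.dlog 3 x θ' ∂(M.law θ'))| ≤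
        K * |(θ : ℝ) - θ'| := by
  have hH : 0 ≤ ∫ x, H x ∂M.μ := integral_nonneg fun x =>
    (by have := M.pos_f x M.a ⟨le_rfl, M.a_lt_b.le⟩; positivity : (0 : ℝ) ≤ _).trans
      (hE.mul_pow_le x M.a ⟨le_rfl, M.a_lt_b.le⟩)
  have hA := hE.abs_integral_law_sub_le (K := 3)
    (p := fun x t => M.logDeriv 1 x t * M.logDeriv 2 x t)
    (p' := fun x t => M.logDeriv 2 x t * M.logDeriv 2 x t + M.logDeriv 1 x t * M.logDeriv 3 x t)
    (fun x t ht => (hE.hasDerivWithinAt_logDeriv (by norm_num : 1 < 4) x ht).mul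
      (hE.hasDerivWithinAt_logDeriv (by norm_num : 2 < 4) x ht))
    (fun θ => (hE.memLp_logDeriv le_rfl (by norm_num) θ.2 θ).two_of_four.integrable_mul
      (hE.memLp_logDeriv (by norm_num) (by norm_num) θ.2 θ).two_of_four)
    (fun x t ht => by
      have h1 := hE.abs_logDeriv_le 1 le_rfl (by norm_num) x t ht
      have h2 := hE.abs_logDeriv_le 2 (by norm_num) (by norm_num) x t ht
      have h3 := hE.abs_logDeriv_le 3 (by norm_num) (by norm_num) x t ht
      have h0 := hE.nonneg_left x
      calc _ ≤ |M.logDeriv 2 x t * M.logDeriv 2 x t| + |M.logDeriv 1 x t * M.logDeriv 3 x t| +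
            |M.logDeriv 1 x t * M.logDeriv 2 x t * M.logDeriv 1 x t| := abs_add_three _ _ _
        _ ≤ G x * G x + G x * G x + G x * G x * G x := by simp only [abs_mul]; gcongr
        _ ≤ _ := by
            have := hE.pow_le_one_add_pow x (by norm_num : 2 ≤ 4)
            have := hE.pow_le_one_add_pow x (by norm_num : 3 ≤ 4)
            linarith) (by norm_num)
  have hB := hE.abs_integral_law_sub_le (K := 2) (p := fun x t => M.logDeriv 3 x t)
    (p' := fun x t => M.logDeriv 4 x t)
    (fun x t ht => hE.hasDerivWithinAt_logDeriv (by norm_num : 3 < 4) x ht)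
    (fun θ => (hE.memLp_logDeriv (by norm_num) (by norm_num) θ.2 θ).integrable (by norm_num))
    (fun x t ht => by
      have h1 := hE.abs_logDeriv_le 1 le_rfl (by norm_num) x t ht
      have h3 := hE.abs_logDeriv_le 3 (by norm_num) (by norm_num) x t ht
      have h4 := hE.abs_logDeriv_le 4 (by norm_num) (by norm_num) x t ht
      have h0 := hE.nonneg_left x
      calc _ ≤ |M.logDeriv 4 x t| + |M.logDeriv 3 x t * M.logDeriv 1 x t| := abs_add_le _ _
        _ ≤ G x + G x * G x := by simp only [abs_mul]; gcongr
        _ ≤ _ := by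
            have := hE.pow_le_one_add_pow x (by norm_num : 1 ≤ 4)
            have := hE.pow_le_one_add_pow x (by norm_num : 2 ≤ 4)
            linarith) (by norm_num)
  refine ⟨8 * ∫ x, H x ∂M.μ, by positivity, fun θ θ' => ?_⟩
  have h1 := abs_le.1 (hA θ θ')
  have h2 := abs_le.1 (hB θ θ')
  simp only [dlog_eq_logDeriv]
  rw [abs_le]
  constructor <;> linarith [h1.1, h1.2, h2.1, h2.2]

end IsEnvelope

lemma continuous_of_abs_sub_le {g : M.paramSpace → ℝ} {K : ℝ}
    (h : ∀ θ θ' : M.paramSpace, |g θ - g θ'| ≤ K * |(θ : ℝ) - θ'|) : Continuous g := by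
  have : LipschitzWith K.toNNReal g := LipschitzWith.of_dist_le_mul fun θ θ' => by
    rw [Real.dist_eq, Subtype.dist_eq, Real.dist_eq]
    exact (h θ θ').trans (mul_le_mul_of_nonneg_right (Real.le_coe_toNNReal K) (abs_nonneg _))
  exact this.continuous

lemma exists_abs_le_of_continuous {g : M.paramSpace → ℝ} (hg : Continuous g) :
    ∃ C, 0 ≤ C ∧ ∀ θ, |g θ| ≤ C := by
  obtain ⟨C, hC⟩ := isCompact_univ.exists_bound_of_continuousOn hg.continuousOn
  exact ⟨max C 0, le_max_right _ _, fun θ => (hC θ trivial).trans (le_max_left _ _)⟩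

/-- The bias coefficient is a Lipschitz function of the parameter. -/
lemma Regular.exists_abs_b₁_sub_le (hM : M.Regular) : ∃ K, 0 ≤ K ∧ ∀ θ θ' : M.paramSpace,
    |M.b₁ θ - M.b₁ θ'| ≤ K * |(θ : ℝ) - θ'| := by
  obtain ⟨G, H, hE⟩ := hM.exists_isEnvelope
  obtain ⟨K, hK, hI⟩ := hE.exists_abs_fisherInfo_sub_le
  obtain ⟨L, hL, hN⟩ := hE.exists_abs_b₁_numerator_sub_le
  set N : M.paramSpace → ℝ := fun θ =>
    2 * (∫ x, M.dlog 1 x θ * M.dlog 2 x θ ∂(M.law θ)) + ∫ x, M.dlog 3 x θ ∂(M.law θ) with hNdef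
  have hIc := continuous_of_abs_sub_le hI
  obtain ⟨i₁, hi₁, hI₁⟩ := exists_abs_le_of_continuous hIc
  obtain ⟨n₁, hn₁, hN₁⟩ := exists_abs_le_of_continuous (continuous_of_abs_sub_le (g := N) hN)
  obtain ⟨θ₀, -, hmin⟩ := isCompact_univ.exists_isMinOn
    (⟨⟨M.a, le_rfl, M.a_lt_b.le⟩, trivial⟩ : (Set.univ : Set M.paramSpace).Nonempty)
    hIc.continuousOn
  set i₀ := M.fisherInfo θ₀ with hi₀
  have hi₀pos : 0 < i₀ := hM.fisherInfo_pos θ₀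
  have hI₀ (θ) : i₀ ≤ M.fisherInfo θ := hmin (Set.mem_univ θ)
  refine ⟨(L * i₁ ^ 2 + n₁ * (2 * i₁ * K)) / (2 * i₀ ^ 4), by positivity, fun θ θ' => ?_⟩
  have hp := hM.fisherInfo_pos θ
  have hp' := hM.fisherInfo_pos θ'
  have hb (θ) : M.b₁ θ = N θ / (2 * M.fisherInfo θ ^ 2) := rfl
  have hle := (abs_of_pos hp).symm.trans_le (hI₁ θ)
  have hle' := (abs_of_pos hp').symm.trans_le (hI₁ θ')
  have heq : M.b₁ θ - M.b₁ θ' = ((N θ - N θ') * M.fisherInfo θ' ^ 2 -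
      N θ' * ((M.fisherInfo θ + M.fisherInfo θ') * (M.fisherInfo θ - M.fisherInfo θ'))) /
        (2 * (M.fisherInfo θ ^ 2 * M.fisherInfo θ' ^ 2)) := by
    rw [hb, hb]; field_simp; ring
  have hden : 2 * i₀ ^ 4 ≤ 2 * (M.fisherInfo θ ^ 2 * M.fisherInfo θ' ^ 2) := by
    have h1 := hI₀ θ
    have h2 := hI₀ θ'
    calc 2 * i₀ ^ 4 = 2 * (i₀ ^ 2 * i₀ ^ 2) := by ring
      _ ≤ _ := by gcongr
  rw [heq, abs_div, abs_of_pos (by positivity : 0 < 2 * (M.fisherInfo θ ^ 2 * M.fisherInfo θ' ^ 2))]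
  have hnum : |(N θ - N θ') * M.fisherInfo θ' ^ 2 -
      N θ' * ((M.fisherInfo θ + M.fisherInfo θ') * (M.fisherInfo θ - M.fisherInfo θ'))| ≤
        (L * i₁ ^ 2 + n₁ * (2 * i₁ * K)) * |(θ : ℝ) - θ'| := by
    calc _ ≤ |N θ - N θ'| * M.fisherInfo θ' ^ 2 +
          |N θ'| * ((M.fisherInfo θ + M.fisherInfo θ') *
            |M.fisherInfo θ - M.fisherInfo θ'|) := by
          refine (abs_sub _ _).trans_eq ?_
          rw [abs_mul, abs_mul, abs_mul, abs_of_nonneg (sq_nonneg (M.fisherInfo θ')),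
            abs_of_pos (by linarith : 0 < M.fisherInfo θ + M.fisherInfo θ')]
      _ ≤ (L * |(θ : ℝ) - θ'|) * i₁ ^ 2 + n₁ * ((i₁ + i₁) * (K * |(θ : ℝ) - θ'|)) := by
          have h1 := hN θ θ'
          have h2 := hI θ θ'
          have h3 := hN₁ θ'
          gcongr
      _ = _ := by ring
  calc _ ≤ (L * i₁ ^ 2 + n₁ * (2 * i₁ * K)) * |(θ : ℝ) - θ'| / (2 * i₀ ^ 4) := by gcongr
    _ = _ := by ring

/-! ### Consistency of the maximum likelihood estimator -/

namespace IsEnvelope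

variable {G H : D → ℝ} (hE : M.IsEnvelope G H)
include hE

lemma memLp_logDeriv_zero_sub (t u θ : M.paramSpace) :
    MemLp (fun x => M.logDeriv 0 x t - M.logDeriv 0 x u) 4 (M.law θ) :=
  hE.memLp_four ((hE.measurable_logDeriv (by norm_num) t.2).sub
    (hE.measurable_logDeriv (by norm_num) u.2)) (C := |(t : ℝ) - u|) (fun x => by
      have := hE.abs_logDeriv_sub_le (by norm_num : 0 < 4) x t.2 u.2
      simp only [Pi.sub_apply]
      linarith [mul_comm (G x) |(t : ℝ) - u|, abs_nonneg ((t : ℝ) - u)]) θ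

/-- Gibbs' inequality: the expected log-likelihood ratio of a wrong parameter is negative. This
is `exp u - 1 - u ≥ 0`, with equality only for `u = 0`, integrated over `u` the log-likelihood
ratio. -/
lemma integral_logDeriv_zero_sub_neg (hid : ∀ θ θ' : M.paramSpace, M.law θ = M.law θ' → θ = θ')
    {θ θ₀ : M.paramSpace} (hne : θ ≠ θ₀) :
    ∫ x, (M.logDeriv 0 x θ - M.logDeriv 0 x θ₀) ∂(M.law θ₀) < 0 := by
  by_contra! hcon
  apply hne
  apply hid
  set u : D → ℝ := fun x => M.logDeriv 0 x θ - M.logDeriv 0 x θ₀ with hu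
  have hexp (x : D) : Real.exp (u x) * M.f x θ₀ = M.f x θ := by
    simp only [hu, logDeriv_zero]
    rw [Real.exp_sub, Real.exp_log (M.pos_f x θ θ.2), Real.exp_log (M.pos_f x θ₀ θ₀.2),
      div_mul_cancel₀ _ (M.pos_f x θ₀ θ₀.2).ne']
  have hfi : Integrable (fun x => M.f x θ) M.μ := by
    have := (integrable_law_iff θ (fun _ => (1 : ℝ))).1 (integrable_const _)
    simpa using this
  have hone : ∫ x, M.f x θ ∂M.μ = 1 := by
    have := integral_law θ (fun _ => (1 : ℝ))
    simpa using this.symm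
  have iu : Integrable u (M.law θ₀) :=
    (hE.memLp_logDeriv_zero_sub θ θ₀ θ₀).integrable (by norm_num)
  have ie : Integrable (fun x => Real.exp (u x)) (M.law θ₀) := by
    rw [integrable_law_iff]; simpa only [hexp] using hfi
  have h1 : Integrable (fun _ : D => (1 : ℝ)) (M.law θ₀) := integrable_const _
  have hint : ∫ x, (Real.exp (u x) - 1 - u x) ∂(M.law θ₀) = -∫ x, u x ∂(M.law θ₀) := by
    rw [integral_sub (ie.sub' h1) iu, integral_sub ie h1, integral_law θ₀ fun x => Real.exp (u x)]
    simp [hexp, hone]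
  have hnn (x : D) : 0 ≤ Real.exp (u x) - 1 - u x := by linarith [Real.add_one_le_exp (u x)]
  have hz : ∫ x, (Real.exp (u x) - 1 - u x) ∂(M.law θ₀) = 0 :=
    le_antisymm (by rw [hint]; linarith) (integral_nonneg hnn)
  have hae := (integral_eq_zero_iff_of_nonneg hnn ((ie.sub' h1).sub' iu)).1 hz
  rw [law, Filter.EventuallyEq, ae_withDensity_iff (M.measurable_f θ₀ θ₀.2).ennreal_ofReal] at hae
  unfold law
  refine withDensity_congr_ae ?_
  filter_upwards [hae] with x hx
  have hx' := hx (by simpa using M.pos_f x θ₀ θ₀.2)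
  have hux : u x = 0 := by
    by_contra h0
    have := Real.add_one_lt_exp h0
    simp only [Pi.zero_apply] at hx'
    linarith
  rw [← hexp x, hux, Real.exp_zero, one_mul]

end IsEnvelope

variable {θhat : (n : ℕ) → (Fin n → D) → M.paramSpace}

lemma IsMLE.sum_logDeriv_zero_le (hθ : M.IsMLE θhat) {n : ℕ} (x : Fin n → D) (θ : M.paramSpace) :
    ∑ i, M.logDeriv 0 (x i) θ ≤ ∑ i, M.logDeriv 0 (x i) (θhat n x) := by
  simp only [logDeriv_zero]
  rw [← Real.log_prod fun i _ => (M.pos_f (x i) θ θ.2).ne',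
    ← Real.log_prod fun i _ => (M.pos_f (x i) _ (θhat n x).2).ne']
  exact Real.log_le_log (Finset.prod_pos fun i _ => M.pos_f (x i) θ θ.2) ((hθ n).2 x θ)

lemma IsMLE.measurable_coe (hθ : M.IsMLE θhat) (n : ℕ) :
    Measurable fun x : Fin n → D => (θhat n x : ℝ) := measurable_subtype_coe.comp (hθ n).1

/-- At an interior maximum likelihood estimate the average score vanishes. -/
lemma IsEnvelope.sum_logDeriv_one_eq_zero {G H : D → ℝ} (hE : M.IsEnvelope G H)
    (hθ : M.IsMLE θhat) {n : ℕ} (x : Fin n → D)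
    (hx : (θhat n x : ℝ) ∈ interior M.paramSpace) :
    ∑ i, M.logDeriv 1 (x i) (θhat n x) = 0 := by
  have hnhds : M.paramSpace ∈ 𝓝 (θhat n x : ℝ) := mem_interior_iff_mem_nhds.1 hx
  have hmax : IsLocalMax (fun t => ∑ i, M.logDeriv 0 (x i) t) (θhat n x : ℝ) := by
    filter_upwards [hnhds] with t ht using hθ.sum_logDeriv_zero_le x ⟨t, ht⟩
  refine hmax.hasDerivAt_eq_zero (HasDerivAt.fun_sum fun i _ => ?_)
  exact (hE.hasDerivWithinAt_logDeriv (by norm_num : 0 < 4) (x i) (θhat n x).2).hasDerivAt hnhds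

lemma isCompact_setOf_le_abs_sub (θ₀ : M.paramSpace) (δ : ℝ) :
    IsCompact {θ : M.paramSpace | δ ≤ |(θ : ℝ) - θ₀|} := by
  refine IsClosed.isCompact (isClosed_le continuous_const ?_)
  fun_prop

/-- Away from the true parameter the expected log-likelihood ratio is negative, uniformly. -/
lemma IsEnvelope.exists_gap {G H : D → ℝ} (hE : M.IsEnvelope G H)
    (hid : ∀ θ θ' : M.paramSpace, M.law θ = M.law θ' → θ = θ') (θ₀ : M.paramSpace) {δ : ℝ}
    (hδ : 0 < δ) : ∃ c, 0 < c ∧ ∀ θ : M.paramSpace, δ ≤ |(θ : ℝ) - θ₀| →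
      ∫ x, (M.logDeriv 0 x θ - M.logDeriv 0 x θ₀) ∂(M.law θ₀) ≤ -c := by
  set g : M.paramSpace → ℝ := fun θ =>
    ∫ x, (M.logDeriv 0 x θ - M.logDeriv 0 x θ₀) ∂(M.law θ₀) with hg
  have hi (θ : M.paramSpace) :
      Integrable (fun x => M.logDeriv 0 x θ - M.logDeriv 0 x θ₀) (M.law θ₀) :=
    (hE.memLp_logDeriv_zero_sub θ θ₀ θ₀).integrable (by norm_num)
  have hlip (θ θ' : M.paramSpace) :
      |g θ - g θ'| ≤ (∫ x, G x ∂(M.law θ₀)) * |(θ : ℝ) - θ'| := by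
    rw [hg, ← integral_mul_const, ← integral_sub (hi θ) (hi θ')]
    refine norm_integral_le_of_norm_le
      (f := fun x => M.logDeriv 0 x θ - M.logDeriv 0 x θ₀ -
        (M.logDeriv 0 x θ' - M.logDeriv 0 x θ₀))
      (((hE.memLp_G θ₀).integrable (by norm_num)).mul_const _) (ae_of_all _ fun x => ?_)
    rw [sub_sub_sub_cancel_right]
    exact hE.abs_logDeriv_sub_le (by norm_num) x θ.2 θ'.2
  rcases Set.eq_empty_or_nonempty {θ : M.paramSpace | δ ≤ |(θ : ℝ) - θ₀|} with hem | hne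
  · exact ⟨1, one_pos, fun θ hθ => absurd (show θ ∈ {θ : M.paramSpace | δ ≤ |(θ : ℝ) - θ₀|} from hθ)
      (by rw [hem]; exact Set.notMem_empty θ)⟩
  · obtain ⟨θ₁, h1, hmax⟩ := (isCompact_setOf_le_abs_sub θ₀ δ).exists_isMaxOn hne
      (continuous_of_abs_sub_le hlip).continuousOn
    refine ⟨-g θ₁, ?_, fun θ hθ => by rw [neg_neg]; exact hmax hθ⟩
    have hne1 : θ₁ ≠ θ₀ := by
      rintro rfl
      simp only [Set.mem_ofPred_eq, sub_self, abs_zero] at h1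
      linarith
    linarith [hE.integral_logDeriv_zero_sub_neg hid hne1]

lemma abs_sampleMean_le {D : Type*} {g G : D → ℝ} {n : ℕ} (x : Fin n → D) {c : ℝ}
    (h : ∀ i, |g (x i)| ≤ G (x i) * c) : |sampleMean g x| ≤ sampleMean G x * c := by
  unfold sampleMean
  rw [abs_div, Nat.abs_cast, div_mul_eq_mul_div, Finset.sum_mul]
  gcongr
  exact (Finset.abs_sum_le_sum_abs _ _).trans (Finset.sum_le_sum fun i _ => h i)

/-- The maximum likelihood estimator misses a neighbourhood of the true parameter only with
probability `O(n⁻²)`: the likelihood ratios are controlled at the points of a finite net by the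
fourth moment inequality, and between them by the Lipschitz constant `G`. -/
lemma Regular.exists_measureReal_le_abs_sub (hM : M.Regular) {G H : D → ℝ}
    (hE : M.IsEnvelope G H) (hθ : M.IsMLE θhat) (θ₀ : M.paramSpace) {δ : ℝ} (hδ : 0 < δ) :
    ∃ C, 0 ≤ C ∧ ∀ n : ℕ, n ≠ 0 →
      (M.sampleLaw θ₀ n).real {x | δ ≤ |(θhat n x : ℝ) - θ₀|} ≤ C / n ^ 2 := by
  obtain ⟨c, hc, hgap⟩ := hE.exists_gap hM.identifiable θ₀ hδ
  set ρ : ℝ := (∫ x, G x ∂(M.law θ₀)) + 1 with hρ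
  have hρpos : 0 < ρ := by
    have : 0 ≤ ∫ x, G x ∂(M.law θ₀) := integral_nonneg hE.nonneg_left
    linarith
  obtain ⟨F, hFsub, hFfin, hcover⟩ := (isCompact_setOf_le_abs_sub θ₀ δ).finite_cover_balls
    (by positivity : 0 < c / (4 * ρ))
  set F' := hFfin.toFinset with hF'
  obtain ⟨C₀, hC₀, hG⟩ := exists_measureReal_sampleMean_sub_le (M.law θ₀) hE.measurable_left
    (hE.memLp_G θ₀) one_pos
  have hcj (θ : M.paramSpace) := exists_measureReal_sampleMean_sub_le (M.law θ₀)
    ((hE.measurable_logDeriv (by norm_num : 0 ≤ 4) θ.2).sub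
      (hE.measurable_logDeriv (by norm_num : 0 ≤ 4) θ₀.2))
    (hE.memLp_logDeriv_zero_sub θ θ₀ θ₀) (by positivity : 0 < c / 4)
  choose Cj hCj hj using hcj
  refine ⟨C₀ + ∑ θ ∈ F', Cj θ, add_nonneg hC₀ (Finset.sum_nonneg fun θ _ => hCj θ),
    fun n hn => ?_⟩
  have hn' : (0 : ℝ) < n := by exact_mod_cast Nat.pos_of_ne_zero hn
  set B₀ : Set (Fin n → D) := {x | 1 ≤ |sampleMean G x - ∫ y, G y ∂(M.law θ₀)|} with hB₀
  set Bj : M.paramSpace → Set (Fin n → D) := fun θ =>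
    {x | c / 4 ≤ |sampleMean ((fun y => M.logDeriv 0 y θ) - fun y => M.logDeriv 0 y θ₀) x -
      ∫ y, ((fun y => M.logDeriv 0 y θ) - fun y => M.logDeriv 0 y θ₀) y ∂(M.law θ₀)|} with hBj
  have hsub : {x : Fin n → D | δ ≤ |(θhat n x : ℝ) - θ₀|} ⊆ B₀ ∪ ⋃ θ ∈ F', Bj θ := by
    intro x hx
    by_contra hnot
    rw [Set.mem_union, not_or] at hnot
    obtain ⟨h0, hnj⟩ := hnot
    simp only [Set.mem_iUnion, not_exists] at hnj
    obtain ⟨θ, hθF, hθball⟩ := Set.mem_iUnion₂.1 (hcover hx)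
    have hR : sampleMean G x ≤ ρ := by
      have : |sampleMean G x - ∫ y, G y ∂(M.law θ₀)| < 1 := not_le.1 h0
      linarith [(abs_lt.1 this).2]
    have hu : |sampleMean ((fun y => M.logDeriv 0 y θ) - fun y => M.logDeriv 0 y θ₀) x -
        ∫ y, ((fun y => M.logDeriv 0 y θ) - fun y => M.logDeriv 0 y θ₀) y ∂(M.law θ₀)| < c / 4 :=
      not_le.1 (hnj θ (hFfin.mem_toFinset.2 hθF))
    have hg := hgap θ (hFsub hθF)
    have hdist : |(θhat n x : ℝ) - θ| ≤ c / (4 * ρ) := by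
      have := Metric.mem_ball.1 hθball
      rw [Subtype.dist_eq, Real.dist_eq] at this
      exact this.le
    have h1 : |sampleMean (fun y => M.logDeriv 0 y (θhat n x) - M.logDeriv 0 y θ) x| ≤ c / 4 := by
      refine (abs_sampleMean_le (G := G) x fun i =>
        hE.abs_logDeriv_sub_le (by norm_num : 0 < 4) (x i) (θhat n x).2 θ.2).trans ?_
      calc sampleMean G x * |(θhat n x : ℝ) - θ| ≤ ρ * (c / (4 * ρ)) := by gcongr
        _ = c / 4 := by field_simp
    have h2 : 0 ≤ sampleMean (fun y => M.logDeriv 0 y (θhat n x) - M.logDeriv 0 y θ) x +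
        sampleMean ((fun y => M.logDeriv 0 y θ) - fun y => M.logDeriv 0 y θ₀) x := by
      have hle := hθ.sum_logDeriv_zero_le x θ₀
      simp only [sampleMean, Pi.sub_apply, ← add_div, ← Finset.sum_add_distrib]
      refine div_nonneg ?_ hn'.le
      simp only [sub_add_sub_cancel, Finset.sum_sub_distrib]
      linarith
    simp only [Pi.sub_apply] at hu
    linarith [(abs_lt.1 hu).2, (abs_le.1 h1).2]
  calc (M.sampleLaw θ₀ n).real {x | δ ≤ |(θhat n x : ℝ) - θ₀|}
      ≤ (M.sampleLaw θ₀ n).real (B₀ ∪ ⋃ θ ∈ F', Bj θ) := measureReal_mono hsub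
    _ ≤ (M.sampleLaw θ₀ n).real B₀ + ∑ θ ∈ F', (M.sampleLaw θ₀ n).real (Bj θ) :=
        (measureReal_union_le _ _).trans
          (add_le_add le_rfl (measureReal_biUnion_finset_le _ _))
    _ ≤ C₀ / n ^ 2 + ∑ θ ∈ F', Cj θ / n ^ 2 :=
        add_le_add (hG n hn) (Finset.sum_le_sum fun θ _ => hj θ n hn)
    _ = _ := by rw [add_div, Finset.sum_div]

/-! ### Expansion of the maximum likelihood estimator -/

/-- The moment expansion of the maximum likelihood estimator at an interior parameter. With
`S`, `W` the averages of `ℓ'` and of `-ℓ'' - I`, the mean of the estimation error is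
`κ E[S²] / (2 I³) - E[W S] / I²` up to `O(n^(-3/2))`, where `κ = E ℓ'''`; as `E[S²] = I / n` and
`E[W S] = -E[ℓ' ℓ''] / n`, this is `b₁ / n`. -/
theorem Regular.exists_mle_expansion (hM : M.Regular) (hθ : M.IsMLE θhat) (θ : M.paramSpace)
    (hint : (θ : ℝ) ∈ interior M.paramSpace) :
    ∃ C : ℝ, 0 ≤ C ∧ ∀ n : ℕ, n ≠ 0 →
      ∫ x, ((θhat n x : ℝ) - θ) ^ 4 ∂(M.sampleLaw θ n) ≤ C / n ^ 2 ∧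
      ∫ x, ((θhat n x : ℝ) - θ - sampleMean (M.dlog 1 · θ) x / M.fisherInfo θ) ^ 2
        ∂(M.sampleLaw θ n) ≤ C / n ^ 2 ∧
      |∫ x, ((θhat n x : ℝ) - θ) ∂(M.sampleLaw θ n) - M.b₁ θ / n| ≤ C * ((√(n : ℝ))⁻¹) ^ 3 := by
  obtain ⟨G, H, hE⟩ := hM.exists_isEnvelope
  set I := M.fisherInfo θ with hIdef
  have hI : 0 < I := hM.fisherInfo_pos θ
  set ν := M.law θ with hν
  set κ := ∫ x, M.logDeriv 3 x θ ∂ν with hκ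
  set l₁ : D → ℝ := fun x => M.logDeriv 1 x θ with hl₁
  set w : D → ℝ := fun x => -M.logDeriv 2 x θ - I with hw
  set v : D → ℝ := fun x => M.logDeriv 3 x θ - κ with hv
  have m1 : Measurable l₁ := hE.measurable_logDeriv (by norm_num) θ.2
  have m2 : Measurable fun x => M.logDeriv 2 x θ := hE.measurable_logDeriv (by norm_num) θ.2
  have m3 : Measurable fun x => M.logDeriv 3 x θ := hE.measurable_logDeriv (by norm_num) θ.2
  have mw : Measurable w := m2.neg.sub_const I
  have mv : Measurable v := m3.sub_const κ
  have p1 : MemLp l₁ 4 ν := hE.memLp_logDeriv (by norm_num) (by norm_num) θ.2 θ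
  have p2 : MemLp (fun x => M.logDeriv 2 x θ) 4 ν :=
    hE.memLp_logDeriv (by norm_num) (by norm_num) θ.2 θ
  have p3 : MemLp (fun x => M.logDeriv 3 x θ) 4 ν :=
    hE.memLp_logDeriv (by norm_num) (by norm_num) θ.2 θ
  have pw : MemLp w 4 ν := p2.neg.sub (memLp_const I)
  have pv : MemLp v 4 ν := p3.sub (memLp_const κ)
  obtain ⟨e1, e2⟩ := hE.integral_logDeriv_one_and_two θ hint
  have ew : ∫ x, w x ∂ν = 0 := by
    rw [hw, integral_sub (p2.integrable (by norm_num)).fun_neg (integrable_const _), integral_neg,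
      e2]
    simp [hIdef]
  have ev : ∫ x, v x ∂ν = 0 := by
    rw [hv, integral_sub (p3.integrable (by norm_num)) (integrable_const _)]
    simp [hκ]
  -- the neighbourhood of `θ` is so small that the quadratic Taylor remainder of the score cannot
  -- compete with its linear term, and all its points are interior
  set ρ : ℝ := (∫ x, G x ∂ν) + 1 with hρ
  have hρpos : 0 < ρ := by
    have : 0 ≤ ∫ x, G x ∂ν := integral_nonneg hE.nonneg_left
    linarith
  obtain ⟨δ₀, hδ₀, hball⟩ := Metric.isOpen_iff.1 isOpen_interior _ hint
  set δ := min δ₀ (I / (4 * ρ)) with hδ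
  have hδpos : 0 < δ := lt_min hδ₀ (by positivity)
  have hδρ : ρ * δ ≤ I / 4 := by
    calc ρ * δ ≤ ρ * (I / (4 * ρ)) := by gcongr; exact min_le_right _ _
      _ = I / 4 := by field_simp
  obtain ⟨CA, hCA, hA1⟩ := hM.exists_measureReal_le_abs_sub hE hθ θ hδpos
  obtain ⟨CG, hCG, hA2⟩ := exists_measureReal_sampleMean_sub_le ν hE.measurable_left
    (hE.memLp_G θ) one_pos
  obtain ⟨CW, hCW, hA3⟩ := exists_measureReal_sampleMean_sub_le ν mw pw
    (by positivity : 0 < I / 4)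
  obtain ⟨D₁, hD₁, hS4⟩ := exists_integral_sampleMean_pow_four_le ν m1 p1 e1
  obtain ⟨D₂, hD₂, hW4⟩ := exists_integral_sampleMean_pow_four_le ν mw pw ew
  set Vv := ∫ y, v y * v y ∂ν with hVv
  have hVv0 : 0 ≤ Vv := integral_nonneg fun y => mul_self_nonneg _
  set c := CA + CG + CW + D₁ + D₂ + Vv with hc
  have hc0 : 0 ≤ c := by positivity
  have hL (n : ℕ) (x : Fin n → D) : |(θhat n x : ℝ) - θ| ≤ M.b - M.a := by
    have h1 := (θhat n x).2
    have h2 := θ.2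
    rw [abs_le]
    constructor <;> linarith [h1.1, h1.2, h2.1, h2.2]
  obtain ⟨C, hC, hmain⟩ := exists_moment_expansion hI κ hρpos.le
    (by linarith [M.a_lt_b] : 0 ≤ M.b - M.a) (by positivity : 0 ≤ 2 / I) hc0
  refine ⟨C + C / I, by positivity, fun n hn => ?_⟩
  have hn' : (0 : ℝ) < n := by exact_mod_cast Nat.pos_of_ne_zero hn
  have hn1 : (1 : ℝ) ≤ n := by exact_mod_cast Nat.one_le_iff_ne_zero.2 hn
  set h : ℝ := (√(n : ℝ))⁻¹ with hh
  have hh0 : 0 < h := by positivity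
  have hh1 : h ≤ 1 := inv_le_one_of_one_le₀ (Real.one_le_sqrt.2 hn1)
  have hh2 : h ^ 2 = 1 / n := by rw [hh, inv_pow, Real.sq_sqrt hn'.le, one_div]
  have hh4 : h ^ 4 = 1 / n ^ 2 := by
    rw [show h ^ 4 = (h ^ 2) ^ 2 by ring, hh2, div_pow, one_pow]
  have hcn {y : ℝ} (hy : y ≤ c) : y / (n : ℝ) ^ 2 ≤ c * h ^ 4 := by
    rw [hh4, mul_one_div]; gcongr
  -- the event that the estimate is close to `θ`, hence solves the score equation, that the Taylor
  -- remainders are bounded by `ρ`, and that the average second derivative is close to `-I`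
  set A : Set (Fin n → D) := {x | δ ≤ |(θhat n x : ℝ) - θ|}ᶜ ∩
    ({x | 1 ≤ |sampleMean G x - ∫ y, G y ∂ν|}ᶜ ∩
      {x | I / 4 ≤ |sampleMean w x - ∫ y, w y ∂ν|}ᶜ) with hA
  have hΔm : Measurable fun x : Fin n → D => (θhat n x : ℝ) - θ :=
    (hθ.measurable_coe n).sub_const _
  have hAm : MeasurableSet A := by
    refine (measurableSet_le measurable_const (by fun_prop)).compl.inter
      ((measurableSet_le measurable_const ?_).compl.inter
        (measurableSet_le measurable_const ?_).compl)
    · exact ((measurable_sampleMean hE.measurable_left n).sub_const _).abs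
    · exact ((measurable_sampleMean mw n).sub_const _).abs
  have hgood : ∀ x ∈ A,
      |sampleMean l₁ x - (I + sampleMean w x) * ((θhat n x : ℝ) - θ)| ≤
          ρ * ((θhat n x : ℝ) - θ) ^ 2 ∧
      |sampleMean l₁ x - (I + sampleMean w x) * ((θhat n x : ℝ) - θ) +
          (κ + sampleMean v x) * ((θhat n x : ℝ) - θ) ^ 2 / 2| ≤ ρ * |(θhat n x : ℝ) - θ| ^ 3 ∧
      |(θhat n x : ℝ) - θ| ≤ 2 / I * |sampleMean l₁ x| := by
    rintro x ⟨hx1, hx2, hx3⟩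
    set Δ : ℝ := (θhat n x : ℝ) - θ with hΔ
    have hΔδ : |Δ| < δ := not_le.1 hx1
    have hR : sampleMean G x ≤ ρ := by
      have : |sampleMean G x - ∫ y, G y ∂ν| < 1 := not_le.1 hx2
      linarith [(abs_lt.1 this).2]
    have hW : -(I / 4) < sampleMean w x := by
      have : |sampleMean w x - ∫ y, w y ∂ν| < I / 4 := not_le.1 hx3
      rw [ew, sub_zero] at this
      exact (abs_lt.1 this).1
    have hin : (θhat n x : ℝ) ∈ interior M.paramSpace := by
      apply hball
      rw [Metric.mem_ball, Real.dist_eq]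
      exact hΔδ.trans_le (min_le_left _ _)
    have hscore : sampleMean (fun y => M.logDeriv 1 y (θhat n x)) x = 0 := by
      rw [sampleMean, hE.sum_logDeriv_one_eq_zero hθ x hin, zero_div]
    have hw' : sampleMean (fun y => M.logDeriv 2 y θ) x = -(I + sampleMean w x) := by
      rw [hw, sampleMean_sub_const _ _ hn]
      simp [sampleMean, neg_div]
    have hv' : sampleMean (fun y => M.logDeriv 3 y θ) x = κ + sampleMean v x := by
      rw [hv, sampleMean_sub_const _ _ hn]; ring
    have t1 := abs_sampleMean_le (G := G) (c := |Δ| ^ 2) (g := fun y => M.logDeriv 1 y (θhat n x) -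
      M.logDeriv 1 y θ - M.logDeriv 2 y θ * Δ) x
      fun i => hE.abs_taylor_one_le (x i) (θhat n x).2 θ.2 (by norm_num : 1 < 3)
    have t2 := abs_sampleMean_le (G := G) (c := |Δ| ^ 3) (g := fun y => M.logDeriv 1 y (θhat n x) -
      M.logDeriv 1 y θ - M.logDeriv 2 y θ * Δ - M.logDeriv 3 y θ * Δ ^ 2 / 2) x
      fun i => hE.abs_taylor_two_le (x i) (θhat n x).2 θ.2
    have s1 : sampleMean (fun y => M.logDeriv 1 y (θhat n x) -
        M.logDeriv 1 y θ - M.logDeriv 2 y θ * Δ) x =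
        -(sampleMean l₁ x - (I + sampleMean w x) * Δ) := by
      have : sampleMean (fun y => M.logDeriv 1 y (θhat n x) -
          M.logDeriv 1 y θ - M.logDeriv 2 y θ * Δ) x =
          sampleMean (fun y => M.logDeriv 1 y (θhat n x)) x - sampleMean l₁ x -
            sampleMean (fun y => M.logDeriv 2 y θ) x * Δ := by
        simp only [sampleMean, Finset.sum_sub_distrib, ← Finset.sum_mul, hl₁]; ring
      rw [this, hscore, hw']; ring
    have s2 : sampleMean (fun y => M.logDeriv 1 y (θhat n x) -
        M.logDeriv 1 y θ - M.logDeriv 2 y θ * Δ - M.logDeriv 3 y θ * Δ ^ 2 / 2) x =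
        -(sampleMean l₁ x - (I + sampleMean w x) * Δ + (κ + sampleMean v x) * Δ ^ 2 / 2) := by
      have : sampleMean (fun y => M.logDeriv 1 y (θhat n x) -
          M.logDeriv 1 y θ - M.logDeriv 2 y θ * Δ - M.logDeriv 3 y θ * Δ ^ 2 / 2) x =
          sampleMean (fun y => M.logDeriv 1 y (θhat n x)) x - sampleMean l₁ x -
            sampleMean (fun y => M.logDeriv 2 y θ) x * Δ -
            sampleMean (fun y => M.logDeriv 3 y θ) x * Δ ^ 2 / 2 := by
        simp only [sampleMean, Finset.sum_sub_distrib, ← Finset.sum_mul, ← Finset.sum_div, hl₁]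
        ring
      rw [this, hscore, hw', hv']; ring
    rw [s1, abs_neg] at t1
    rw [s2, abs_neg] at t2
    have g1 : |sampleMean l₁ x - (I + sampleMean w x) * Δ| ≤ ρ * |Δ| ^ 2 :=
      t1.trans (by gcongr)
    refine ⟨by rwa [sq_abs] at g1, t2.trans (by gcongr), ?_⟩
    have hΔ0 := abs_nonneg Δ
    have b1 : (I + sampleMean w x) * |Δ| ≤ |sampleMean l₁ x| + ρ * |Δ| ^ 2 := by
      have hpos : 0 < I + sampleMean w x := by linarith
      calc (I + sampleMean w x) * |Δ| = |(I + sampleMean w x) * Δ| := by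
            rw [abs_mul, abs_of_pos hpos]
        _ = |sampleMean l₁ x - (sampleMean l₁ x - (I + sampleMean w x) * Δ)| := by
            congr 1; ring
        _ ≤ |sampleMean l₁ x| + |sampleMean l₁ x - (I + sampleMean w x) * Δ| := abs_sub _ _
        _ ≤ _ := by linarith
    have b2 : ρ * |Δ| ^ 2 ≤ I / 4 * |Δ| := by
      calc ρ * |Δ| ^ 2 = ρ * |Δ| * |Δ| := by ring
        _ ≤ ρ * δ * |Δ| := by gcongr
        _ ≤ I / 4 * |Δ| := by gcongr
    have b3 : 3 / 4 * I * |Δ| ≤ (I + sampleMean w x) * |Δ| := by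
      gcongr; linarith
    rw [div_mul_eq_mul_div, le_div_iff₀ hI]
    linarith
  have hPA : (M.sampleLaw θ n).real Aᶜ ≤ c * h ^ 4 := by
    have hAc : Aᶜ = {x | δ ≤ |(θhat n x : ℝ) - θ|} ∪
      ({x | 1 ≤ |sampleMean G x - ∫ y, G y ∂ν|} ∪
        {x | I / 4 ≤ |sampleMean w x - ∫ y, w y ∂ν|}) := by
      rw [hA]; simp only [Set.compl_inter, compl_compl]
    rw [hAc]
    refine ((measureReal_union_le _ _).trans (add_le_add (hA1 n hn)
      ((measureReal_union_le _ _).trans (add_le_add (hA2 n hn) (hA3 n hn))))).trans ?_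
    rw [← add_div, ← add_div]
    exact hcn (by linarith)
  have hV2 : ∫ x, sampleMean v x ^ 2 ∂(M.sampleLaw θ n) ≤ c * h ^ 2 := by
    simp only [sq (sampleMean v _)]
    refine (integral_sampleMean_mul_sampleMean ν mv mv pv.two_of_four pv.two_of_four ev hn).trans_le
      ?_
    rw [hh2, mul_one_div]
    gcongr
    linarith
  obtain ⟨r1, r2, r3⟩ := hmain (M.sampleLaw θ n) h (fun x => (θhat n x : ℝ) - θ) (sampleMean l₁)
    (sampleMean w) (sampleMean v) A hh0 hh1 hAm hΔm (memLp_sampleMean ν p1 n)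
    (memLp_sampleMean ν pw n) (memLp_sampleMean ν pv.two_of_four n) (hL n) hgood
    ((hS4 n hn).trans (hcn (by linarith))) ((hW4 n hn).trans (hcn (by linarith))) hV2 hPA
  have hCn : C * h ^ 4 ≤ (C + C / I) / n ^ 2 := by
    rw [hh4, mul_one_div]; gcongr
    linarith [div_nonneg hC hI.le]
  refine ⟨r1.trans hCn, r2.trans hCn, ?_⟩
  have q1 : ∫ x, sampleMean l₁ x ∂(M.sampleLaw θ n) = 0 :=
    (integral_sampleMean ν m1 (p1.integrable (by norm_num)) hn).trans e1
  have q2 : ∫ x, sampleMean w x * sampleMean l₁ x ∂(M.sampleLaw θ n) =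
      -(∫ y, M.logDeriv 1 y θ * M.logDeriv 2 y θ ∂ν) / n := by
    refine (integral_sampleMean_mul_sampleMean ν mw m1 pw.two_of_four p1.two_of_four ew hn).trans ?_
    congr 1
    have i12 : Integrable (fun y => M.logDeriv 1 y θ * M.logDeriv 2 y θ) ν :=
      p1.two_of_four.integrable_mul p2.two_of_four
    have : (fun y => w y * l₁ y) =
        fun y => -(M.logDeriv 1 y θ * M.logDeriv 2 y θ) - I * M.logDeriv 1 y θ := by
      ext y; simp only [hw, hl₁]; ring
    rw [this, integral_sub i12.fun_neg ((p1.integrable (by norm_num)).const_mul I), integral_neg,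
      integral_const_mul, e1, mul_zero, sub_zero]
  have q3 : ∫ x, sampleMean l₁ x ^ 2 ∂(M.sampleLaw θ n) = I / n := by
    simp only [sq (sampleMean l₁ _)]
    refine (integral_sampleMean_mul_sampleMean ν m1 m1 p1.two_of_four p1.two_of_four e1 hn).trans ?_
    congr 1
    simp only [← sq]
    rfl
  rw [q1, q2, q3] at r3
  have hb : M.b₁ θ = (2 * (∫ y, M.logDeriv 1 y θ * M.logDeriv 2 y θ ∂ν) + κ) / (2 * I ^ 2) := rfl
  set E := ∫ x, ((θhat n x : ℝ) - θ) ∂(M.sampleLaw θ n) with hEdef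
  have heq : E - M.b₁ θ / n = (I * E - 0 + -(∫ y, M.logDeriv 1 y θ * M.logDeriv 2 y θ ∂ν) / n / I -
      κ * (I / n) / (2 * I ^ 2)) / I := by
    rw [hb]; field_simp; ring
  rw [heq, abs_div, abs_of_pos hI]
  calc _ ≤ C * h ^ 3 / I := by gcongr
    _ = C / I * h ^ 3 := by ring
    _ ≤ _ := by gcongr; linarith

/-! ### The bias-corrected estimator on one block -/

lemma Regular.measurable_b₁ (hM : M.Regular) : Measurable M.b₁ := by
  obtain ⟨K, -, h⟩ := hM.exists_abs_b₁_sub_le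
  exact (continuous_of_abs_sub_le h).measurable

lemma Regular.measurable_bcMLE (hM : M.Regular) (hθ : M.IsMLE θhat) (n : ℕ) :
    Measurable (M.bcMLE θhat n) :=
  (hθ.measurable_coe n).sub ((hM.measurable_b₁.comp (hθ n).1).div_const _)

lemma Regular.memLp_bcMLE (hM : M.Regular) (hθ : M.IsMLE θhat) (θ : M.paramSpace) (n : ℕ)
    (p : ENNReal) : MemLp (M.bcMLE θhat n) p (M.sampleLaw θ n) := by
  obtain ⟨K, -, h⟩ := hM.exists_abs_b₁_sub_le
  obtain ⟨B, hB, hb⟩ := exists_abs_le_of_continuous (continuous_of_abs_sub_le h)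
  refine MemLp.of_bound (hM.measurable_bcMLE hθ n).aestronglyMeasurable
    (max |M.a| |M.b| + B / n) (ae_of_all _ fun x => ?_)
  refine (norm_sub_le _ _).trans (add_le_add ?_ ?_)
  · exact abs_le_max_abs_abs (θhat n x).2.1 (θhat n x).2.2
  · rw [norm_div, Real.norm_natCast]
    gcongr
    exact hb _

/-- On one block the bias-corrected estimator has bias `O(n ^ (-3/2))` and is approximated by the
average score divided by the information, up to `O(n⁻²)` in mean square. -/
theorem Regular.exists_bcMLE_expansion (hM : M.Regular) (hθ : M.IsMLE θhat) (θ : M.paramSpace)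
    (hint : (θ : ℝ) ∈ interior M.paramSpace) :
    ∃ C : ℝ, 0 ≤ C ∧ ∀ n : ℕ, n ≠ 0 →
      ∫ x, (M.bcMLE θhat n x - θ - sampleMean (M.dlog 1 · θ) x / M.fisherInfo θ) ^ 2
        ∂(M.sampleLaw θ n) ≤ C / n ^ 2 ∧
      |∫ x, M.bcMLE θhat n x ∂(M.sampleLaw θ n) - θ| ≤ C * ((√(n : ℝ))⁻¹) ^ 3 := by
  obtain ⟨C, hC, hexp⟩ := hM.exists_mle_expansion hθ θ hint
  obtain ⟨K, hK, hlip⟩ := hM.exists_abs_b₁_sub_le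
  obtain ⟨B, hB, hb⟩ := exists_abs_le_of_continuous (continuous_of_abs_sub_le hlip)
  obtain ⟨G, H, hE⟩ := hM.exists_isEnvelope
  have p1 : MemLp (fun x => M.dlog 1 x θ) 2 (M.law θ) :=
    (hE.memLp_logDeriv le_rfl (by norm_num) θ.2 θ).two_of_four
  refine ⟨2 * C + 2 * B ^ 2 + C + K * (1 + C), by positivity, fun n hn => ?_⟩
  obtain ⟨h1, h2, h3⟩ := hexp n hn
  have hn' : (0 : ℝ) < n := by exact_mod_cast Nat.pos_of_ne_zero hn
  set h : ℝ := (√(n : ℝ))⁻¹ with hh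
  have hh0 : 0 < h := by positivity
  have hh2 : h ^ 2 = 1 / n := by rw [hh, inv_pow, Real.sq_sqrt hn'.le, one_div]
  have hh4 : h ^ 4 = 1 / n ^ 2 := by
    rw [show h ^ 4 = (h ^ 2) ^ 2 by ring, hh2, div_pow, one_pow]
  set Δ : (Fin n → D) → ℝ := fun x => (θhat n x : ℝ) - θ with hΔ
  have hΔm : Measurable Δ := (hθ.measurable_coe n).sub_const _
  have hΔp (p : ENNReal) : MemLp Δ p (M.sampleLaw θ n) :=
    MemLp.of_bound hΔm.aestronglyMeasurable (M.b - M.a) (ae_of_all _ fun x => by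
      have h1 := (θhat n x).2
      have h2 := θ.2
      rw [Real.norm_eq_abs, abs_le]
      constructor <;> simp only [hΔ] <;> linarith [h1.1, h1.2, h2.1, h2.2])
  have hbm : Measurable fun x => M.b₁ (θhat n x) := hM.measurable_b₁.comp (hθ n).1
  have hbi : Integrable (fun x => M.b₁ (θhat n x)) (M.sampleLaw θ n) :=
    Integrable.of_bound hbm.aestronglyMeasurable B (ae_of_all _ fun x => hb _)
  constructor
  · set Q : (Fin n → D) → ℝ := fun x => Δ x - sampleMean (M.dlog 1 · θ) x / M.fisherInfo θ with hQ
    have hQ2 : MemLp Q 2 (M.sampleLaw θ n) := by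
      have hS : MemLp (sampleMean (M.dlog 1 · θ)) 2 (M.sampleLaw θ n) :=
        memLp_sampleMean (M.law θ) p1 n
      refine (hΔp 2).sub ?_
      simpa only [div_eq_inv_mul] using hS.const_mul (M.fisherInfo θ)⁻¹
    have hle : ∫ x, (M.bcMLE θhat n x - θ - sampleMean (M.dlog 1 · θ) x / M.fisherInfo θ) ^ 2
        ∂(M.sampleLaw θ n) ≤ ∫ x, (2 * Q x ^ 2 + 2 * (B / n) ^ 2) ∂(M.sampleLaw θ n) := by
      refine integral_mono_of_nonneg (ae_of_all _ fun x => sq_nonneg _)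
        ((hQ2.integrable_sq.const_mul 2).add (integrable_const _)) (ae_of_all _ fun x => ?_)
      have hb2 : (M.b₁ (θhat n x) / n) ^ 2 ≤ (B / n) ^ 2 := by
        rw [← sq_abs (M.b₁ (θhat n x) / n), abs_div, Nat.abs_cast]
        gcongr
        exact hb _
      have : M.bcMLE θhat n x - θ - sampleMean (M.dlog 1 · θ) x / M.fisherInfo θ =
          Q x - M.b₁ (θhat n x) / n := by simp only [bcMLE, hQ, hΔ]; ring
      simp only [this]
      linarith [sq_nonneg (Q x + M.b₁ (θhat n x) / n)]
    refine hle.trans ?_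
    rw [integral_add (hQ2.integrable_sq.const_mul 2) (integrable_const _), integral_const_mul]
    simp only [integral_const, probReal_univ, one_smul]
    calc 2 * ∫ x, Q x ^ 2 ∂(M.sampleLaw θ n) + 2 * (B / n) ^ 2
        ≤ 2 * (C / n ^ 2) + 2 * (B / n) ^ 2 := by gcongr
      _ = (2 * C + 2 * B ^ 2) / n ^ 2 := by ring
      _ ≤ _ := div_le_div_of_nonneg_right
          (by linarith [mul_nonneg hK (by linarith : 0 ≤ 1 + C)]) (by positivity)
  · have hΔ1 : ∫ x, |Δ x| ∂(M.sampleLaw θ n) ≤ (1 + C) * h := by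
      -- `|Δ| ≤ h + Δ⁴ / h³` distinguishes whether `|Δ|` exceeds `h`
      have hpt (x) : |Δ x| ≤ h + Δ x ^ 4 / h ^ 3 := by
        rcases le_total |Δ x| h with hle | hle
        · have : 0 ≤ Δ x ^ 4 / h ^ 3 := by positivity
          linarith
        · have : |Δ x| ≤ Δ x ^ 4 / h ^ 3 := by
            rw [le_div_iff₀ (by positivity), ← Even.pow_abs (by decide : Even 4) (Δ x)]
            calc |Δ x| * h ^ 3 ≤ |Δ x| * |Δ x| ^ 3 := by gcongr
              _ = |Δ x| ^ 4 := by ring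
          linarith
      calc ∫ x, |Δ x| ∂(M.sampleLaw θ n) ≤ ∫ x, (h + Δ x ^ 4 / h ^ 3) ∂(M.sampleLaw θ n) :=
            integral_mono_of_nonneg (ae_of_all _ fun x => abs_nonneg _)
              ((integrable_const h).add ((hΔp 4).integrable_pow_four.div_const _))
              (ae_of_all _ hpt)
        _ = h + (∫ x, Δ x ^ 4 ∂(M.sampleLaw θ n)) / h ^ 3 := by
            rw [integral_add (integrable_const h) ((hΔp 4).integrable_pow_four.div_const _),
              integral_div]
            simp
        _ ≤ h + (C * h ^ 4) / h ^ 3 := by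
            gcongr
            rw [hh4, mul_one_div]; exact h1
        _ = (1 + C) * h := by field_simp
    have hΔi : Integrable Δ (M.sampleLaw θ n) := (hΔp 1).integrable le_rfl
    have hdi : Integrable (fun x => M.b₁ (θhat n x) - M.b₁ θ) (M.sampleLaw θ n) :=
      hbi.sub (integrable_const _)
    have hsplit : ∫ x, M.bcMLE θhat n x ∂(M.sampleLaw θ n) - θ =
        (∫ x, Δ x ∂(M.sampleLaw θ n) - M.b₁ θ / n) -
          (∫ x, (M.b₁ (θhat n x) - M.b₁ θ) ∂(M.sampleLaw θ n)) / n := by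
      have : (fun x => M.bcMLE θhat n x) = fun x => Δ x + θ - M.b₁ (θhat n x) / n := by
        ext x; simp only [bcMLE, hΔ]; ring
      rw [this, integral_sub (hΔi.fun_add (integrable_const _)) (hbi.div_const _),
        integral_add hΔi (integrable_const _), integral_div, integral_sub hbi (integrable_const _)]
      simp
      ring
    have hB1 : |∫ x, (M.b₁ (θhat n x) - M.b₁ θ) ∂(M.sampleLaw θ n)| ≤ K * ((1 + C) * h) := by
      calc _ ≤ ∫ x, K * |Δ x| ∂(M.sampleLaw θ n) :=
            norm_integral_le_of_norm_le (f := fun x => M.b₁ (θhat n x) - M.b₁ θ)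
              (hΔi.abs.const_mul K) (ae_of_all _ fun x => hlip (θhat n x) θ)
        _ ≤ _ := by rw [integral_const_mul]; gcongr
    rw [hsplit]
    refine (abs_sub _ _).trans ?_
    rw [abs_div, Nat.abs_cast]
    calc _ ≤ C * h ^ 3 + K * ((1 + C) * h) / n := by gcongr
      _ = C * h ^ 3 + K * (1 + C) * h * h ^ 2 := by rw [hh2]; ring
      _ = (C + K * (1 + C)) * h ^ 3 := by ring
      _ ≤ _ := by
        gcongr
        linarith [sq_nonneg B]

/-! ### Bias and mean squared error of the private estimator -/

lemma Lam_eq : M.Lam = M.b - M.a := Real.diam_Icc M.a_lt_b.le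

lemma Lam_pos : 0 < M.Lam := by rw [Lam_eq]; linarith [M.a_lt_b]

lemma noiseScale_nonneg {ε : ℝ} (hε : 0 < ε) (k : ℕ) : 0 ≤ M.Lam / (k * ε) :=
  div_nonneg M.Lam_pos.le (by positivity)

lemma blockAverage_eq_blockMean (n k : ℕ) :
    M.blockAverage θhat n k = blockMean (M.bcMLE θhat (n / k)) := rfl

lemma Regular.memLp_blockAverage (hM : M.Regular) (hθ : M.IsMLE θhat) (θ : M.paramSpace)
    (n k : ℕ) : MemLp (M.blockAverage θhat n k) 2 (M.sampleLaw θ n) :=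
  memLp_blockMean (M.law θ) (hM.memLp_bcMLE hθ θ (n / k) 2)

lemma Regular.measurable_blockAverage (hM : M.Regular) (hθ : M.IsMLE θhat) (n k : ℕ) :
    Measurable (M.blockAverage θhat n k) :=
  measurable_blockMean (hM.measurable_bcMLE hθ (n / k))

lemma measurePreserving_fst_jointLaw (θ : M.paramSpace) (n k : ℕ) (ε : ℝ) :
    MeasurePreserving Prod.fst (M.jointLaw θ n k ε) (M.sampleLaw θ n) :=
  measurePreserving_fst

lemma measurePreserving_snd_jointLaw (θ : M.paramSpace) (n k : ℕ) (ε : ℝ) :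
    MeasurePreserving Prod.snd (M.jointLaw θ n k ε) (laplaceReal (M.Lam / (k * ε))) :=
  measurePreserving_snd

lemma integral_comp_fst_jointLaw (θ : M.paramSpace) (n k : ℕ) (ε : ℝ) (g : (Fin n → D) → ℝ) :
    ∫ xr, g xr.1 ∂(M.jointLaw θ n k ε) = ∫ x, g x ∂(M.sampleLaw θ n) := by
  unfold jointLaw
  rw [integral_fun_fst]
  simp

lemma integral_comp_snd_jointLaw (θ : M.paramSpace) (n k : ℕ) (ε : ℝ) (g : ℝ → ℝ) :
    ∫ xr, g xr.2 ∂(M.jointLaw θ n k ε) = ∫ r, g r ∂(laplaceReal (M.Lam / (k * ε))) := by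
  unfold jointLaw
  rw [integral_fun_snd]
  simp

lemma memLp_snd_jointLaw (θ : M.paramSpace) (n k : ℕ) {ε : ℝ} (hε : 0 < ε) :
    MemLp (fun xr : (Fin n → D) × ℝ => xr.2) 2 (M.jointLaw θ n k ε) :=
  (memLp_id_laplaceReal (noiseScale_nonneg hε k)).comp_measurePreserving
    (measurePreserving_snd_jointLaw θ n k ε)

lemma Regular.memLp_tStar (hM : M.Regular) (hθ : M.IsMLE θhat) (θ : M.paramSpace) (n k : ℕ)
    {ε : ℝ} (hε : 0 < ε) : MemLp (M.tStar θhat n k) 2 (M.jointLaw θ n k ε) :=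
  ((hM.memLp_blockAverage hθ θ n k).comp_measurePreserving
    (measurePreserving_fst_jointLaw θ n k ε)).add (memLp_snd_jointLaw θ n k hε)

/-- The noise is centred, so that it does not contribute to the bias. -/
lemma Regular.bias_eq (hM : M.Regular) (hθ : M.IsMLE θhat) (θ : M.paramSpace) (n k : ℕ)
    {ε : ℝ} (hε : 0 < ε) : M.bias θhat θ n k ε =
      ∫ x, M.blockAverage θhat n k x ∂(M.sampleLaw θ n) - θ := by
  have hB := hM.memLp_blockAverage hθ θ n k
  have h1 : Integrable (fun xr : (Fin n → D) × ℝ => M.blockAverage θhat n k xr.1)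
      (M.jointLaw θ n k ε) := (hB.comp_measurePreserving
    (measurePreserving_fst_jointLaw θ n k ε)).integrable (by norm_num)
  have h2 : Integrable (fun xr : (Fin n → D) × ℝ => xr.2) (M.jointLaw θ n k ε) :=
    (memLp_snd_jointLaw θ n k hε).integrable (by norm_num)
  unfold bias tStar
  rw [integral_sub (h1.fun_add h2) (integrable_const _), integral_add h1 h2,
    integral_comp_fst_jointLaw, integral_comp_snd_jointLaw θ n k ε fun r => r,
    integral_id_laplaceReal]
  simp

/-- Bias–variance decomposition: the variances of the block average and of the noise add up. -/
lemma Regular.mse_eq (hM : M.Regular) (hθ : M.IsMLE θhat) (θ : M.paramSpace) (n k : ℕ)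
    {ε : ℝ} (hε : 0 < ε) : M.mse θhat θ n k ε =
      Var[M.blockAverage θhat n k; M.sampleLaw θ n] + 2 * M.Lam ^ 2 / ((k : ℝ) ^ 2 * ε ^ 2) +
        M.bias θhat θ n k ε ^ 2 := by
  have hB := hM.memLp_blockAverage hθ θ n k
  set u : (Fin n → D) → ℝ := fun x => M.blockAverage θhat n k x - θ with hu
  have hu2 : MemLp u 2 (M.sampleLaw θ n) := hB.sub (memLp_const _)
  have hu2' : MemLp (fun xr : (Fin n → D) × ℝ => u xr.1) 2 (M.jointLaw θ n k ε) :=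
    hu2.comp_measurePreserving (measurePreserving_fst_jointLaw θ n k ε)
  have hr := memLp_snd_jointLaw θ n k hε
  have hbias : M.bias θhat θ n k ε = ∫ x, u x ∂(M.sampleLaw θ n) := by
    rw [hM.bias_eq hθ θ n k hε, hu, integral_sub (hB.integrable (by norm_num)) (integrable_const _)]
    simp
  have hvar : Var[M.blockAverage θhat n k; M.sampleLaw θ n] =
      ∫ x, u x ^ 2 ∂(M.sampleLaw θ n) - (∫ x, u x ∂(M.sampleLaw θ n)) ^ 2 := by
    rw [← variance_sub_const hB.1 (θ : ℝ)]
    exact variance_eq_sub hu2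
  have hcross : ∫ xr : (Fin n → D) × ℝ, u xr.1 * xr.2 ∂(M.jointLaw θ n k ε) = 0 := by
    unfold jointLaw
    rw [integral_prod_mul u fun r => r, integral_id_laplaceReal, mul_zero]
  have hmse : M.mse θhat θ n k ε = ∫ xr : (Fin n → D) × ℝ,
      (u xr.1 ^ 2 + 2 * (u xr.1 * xr.2) + xr.2 ^ 2) ∂(M.jointLaw θ n k ε) := by
    unfold mse tStar
    refine integral_congr_ae (ae_of_all _ fun xr => ?_)
    simp only [hu]; ring
  have i1 : Integrable (fun xr : (Fin n → D) × ℝ => 2 * (u xr.1 * xr.2)) (M.jointLaw θ n k ε) :=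
    (hu2'.integrable_mul hr).const_mul 2
  rw [hmse, integral_add (hu2'.integrable_sq.fun_add i1) hr.integrable_sq,
    integral_add hu2'.integrable_sq i1]
  rw [integral_const_mul, hcross, integral_comp_fst_jointLaw θ n k ε fun x => u x ^ 2,
    integral_comp_snd_jointLaw θ n k ε fun r => r ^ 2,
    integral_sq_laplaceReal (noiseScale_nonneg hε k), hvar, hbias, div_pow, mul_pow]
  ring

/-! ### Variance of the bias-corrected estimator -/

/-- The score has variance `I(θ)`, so that the average score divided by the information has
second moment `1 / (n I(θ))`. -/
lemma IsEnvelope.integral_sampleMean_dlog_div_sq {G H : D → ℝ} (hE : M.IsEnvelope G H)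
    (hM : M.Regular) (θ : M.paramSpace) (hint : (θ : ℝ) ∈ interior M.paramSpace) {n : ℕ}
    (hn : n ≠ 0) :
    ∫ x, (sampleMean (M.dlog 1 · θ) x / M.fisherInfo θ) ^ 2 ∂(M.sampleLaw θ n) =
      1 / (n * M.fisherInfo θ) := by
  have hI := hM.fisherInfo_pos θ
  have m1 : Measurable fun x => M.dlog 1 x θ := hE.measurable_logDeriv (by norm_num) θ.2
  have p1 : MemLp (fun x => M.dlog 1 x θ) 2 (M.law θ) :=
    (hE.memLp_logDeriv le_rfl (by norm_num) θ.2 θ).two_of_four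
  have h := integral_sampleMean_mul_sampleMean (M.law θ) m1 m1 p1 p1
    (hE.integral_logDeriv_one_and_two θ hint).1 hn
  simp only [← sq] at h
  simp only [div_pow]
  rw [integral_div]
  refine (congrArg (· / M.fisherInfo θ ^ 2) h).trans ?_
  change M.fisherInfo θ / n / M.fisherInfo θ ^ 2 = _
  field_simp

lemma Regular.tendsto_mul_variance_bcMLE (hM : M.Regular) (hθ : M.IsMLE θhat) (θ : M.paramSpace)
    (hint : (θ : ℝ) ∈ interior M.paramSpace) :
    Tendsto (fun n : ℕ => n * Var[M.bcMLE θhat n; M.sampleLaw θ n]) atTop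
      (𝓝 (1 / M.fisherInfo θ)) := by
  obtain ⟨C, hC, hexp⟩ := hM.exists_bcMLE_expansion hθ θ hint
  obtain ⟨G, H, hE⟩ := hM.exists_isEnvelope
  have hI := hM.fisherInfo_pos θ
  have p1 : MemLp (fun x => M.dlog 1 x θ) 2 (M.law θ) :=
    (hE.memLp_logDeriv le_rfl (by norm_num) θ.2 θ).two_of_four
  have hlim : Tendsto (fun n : ℕ => (1 / M.fisherInfo θ + 2 * C + C ^ 2) * (√(n : ℝ))⁻¹) atTop
      (𝓝 0) := by
    have := (tendsto_inv_atTop_zero.comp (Real.tendsto_sqrt_atTop.comp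
      tendsto_natCast_atTop_atTop)).const_mul (1 / M.fisherInfo θ + 2 * C + C ^ 2)
    simpa using this
  rw [tendsto_iff_norm_sub_tendsto_zero]
  refine squeeze_zero' (Eventually.of_forall fun _ => norm_nonneg _) ?_ hlim
  filter_upwards [eventually_ne_atTop 0] with n hn
  obtain ⟨h1, h2⟩ := hexp n hn
  have hn' : (0 : ℝ) < n := by exact_mod_cast Nat.pos_of_ne_zero hn
  have hn1 : (1 : ℝ) ≤ n := by exact_mod_cast Nat.one_le_iff_ne_zero.2 hn
  set h : ℝ := (√(n : ℝ))⁻¹ with hh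
  have hh0 : 0 < h := by positivity
  have hh1 : h ≤ 1 := inv_le_one_of_one_le₀ (Real.one_le_sqrt.2 hn1)
  have hh2 : h ^ 2 = 1 / n := by rw [hh, inv_pow, Real.sq_sqrt hn'.le, one_div]
  have hnh : (n : ℝ) * h ^ 2 = 1 := by rw [hh2]; field_simp
  set X : (Fin n → D) → ℝ := fun x => sampleMean (M.dlog 1 · θ) x / M.fisherInfo θ with hX
  set Z : (Fin n → D) → ℝ := M.bcMLE θhat n with hZ
  set Q : (Fin n → D) → ℝ := fun x => Z x - θ - X x with hQ
  have hZ2 : MemLp Z 2 (M.sampleLaw θ n) := hM.memLp_bcMLE hθ θ n 2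
  have hX2 : MemLp X 2 (M.sampleLaw θ n) := by
    have hS : MemLp (sampleMean (M.dlog 1 · θ)) 2 (M.sampleLaw θ n) :=
      memLp_sampleMean (M.law θ) p1 n
    simpa only [hX, div_eq_inv_mul] using hS.const_mul (M.fisherInfo θ)⁻¹
  have hY2 : MemLp (fun x => Z x - θ) 2 (M.sampleLaw θ n) := hZ2.sub (memLp_const _)
  have hQ2 : MemLp Q 2 (M.sampleLaw θ n) := hY2.sub hX2
  have eX : ∫ x, X x ^ 2 ∂(M.sampleLaw θ n) = 1 / (n * M.fisherInfo θ) :=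
    hE.integral_sampleMean_dlog_div_sq hM θ hint hn
  have hvar : Var[Z; M.sampleLaw θ n] =
      ∫ x, (Z x - θ) ^ 2 ∂(M.sampleLaw θ n) - (∫ x, Z x ∂(M.sampleLaw θ n) - θ) ^ 2 := by
    rw [← variance_sub_const hZ2.1 (θ : ℝ), variance_eq_sub hY2,
      integral_sub (hZ2.integrable (by norm_num)) (integrable_const _)]
    simp
  have hsq : |∫ x, (Z x - θ) ^ 2 ∂(M.sampleLaw θ n) - ∫ x, X x ^ 2 ∂(M.sampleLaw θ n)| ≤
      h * (1 / (n * M.fisherInfo θ)) + (1 / h + 1) * (C / n ^ 2) := by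
    -- the cross term `2 X Q` is split with the weight `h = n^(-1/2)`, as `X` is of order `n^(-1/2)`
    -- and `Q` of order `n⁻¹`
    rw [← integral_sub hY2.integrable_sq hX2.integrable_sq]
    have hi : Integrable (fun x => h * X x ^ 2 + (1 / h + 1) * Q x ^ 2) (M.sampleLaw θ n) :=
      (hX2.integrable_sq.const_mul h).add (hQ2.integrable_sq.const_mul (1 / h + 1))
    calc _ ≤ ∫ x, (h * X x ^ 2 + (1 / h + 1) * Q x ^ 2) ∂(M.sampleLaw θ n) := by
          refine norm_integral_le_of_norm_le (f := fun x => (Z x - θ) ^ 2 - X x ^ 2) hi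
            (ae_of_all _ fun x => ?_)
          have e : (Z x - θ) ^ 2 - X x ^ 2 = 2 * (X x * Q x) + Q x ^ 2 := by
            simp only [hQ]; ring
          have e' : h * X x ^ 2 + (1 / h + 1) * Q x ^ 2 - (2 * (|X x| * |Q x|) + Q x ^ 2) =
              (h * |X x| - |Q x|) ^ 2 / h := by
            rw [← sq_abs (X x), ← sq_abs (Q x)]; field_simp; ring
          have e'' : 0 ≤ (h * |X x| - |Q x|) ^ 2 / h := by positivity
          rw [e, Real.norm_eq_abs]
          refine (abs_add_le _ _).trans ?_
          rw [abs_mul, abs_mul, abs_two, abs_of_nonneg (sq_nonneg (Q x))]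
          linarith
      _ = h * ∫ x, X x ^ 2 ∂(M.sampleLaw θ n) + (1 / h + 1) * ∫ x, Q x ^ 2 ∂(M.sampleLaw θ n) := by
          rw [integral_add (hX2.integrable_sq.const_mul h)
            (hQ2.integrable_sq.const_mul (1 / h + 1)), integral_const_mul, integral_const_mul]
      _ ≤ _ := by rw [eX]; gcongr
  have hb : (∫ x, Z x ∂(M.sampleLaw θ n) - θ) ^ 2 ≤ C ^ 2 * h ^ 6 := by
    rw [← sq_abs]
    calc |∫ x, Z x ∂(M.sampleLaw θ n) - θ| ^ 2 ≤ (C * h ^ 3) ^ 2 := by gcongr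
      _ = _ := by ring
  rw [eX] at hsq
  have hsplit : (n : ℝ) * Var[Z; M.sampleLaw θ n] - 1 / M.fisherInfo θ =
      n * (∫ x, (Z x - θ) ^ 2 ∂(M.sampleLaw θ n) - 1 / (n * M.fisherInfo θ)) -
        n * (∫ x, Z x ∂(M.sampleLaw θ n) - θ) ^ 2 := by
    rw [hvar]; field_simp; ring
  rw [hsplit, Real.norm_eq_abs]
  have hn4 : C / (n : ℝ) ^ 2 = C * h ^ 4 := by
    rw [show h ^ 4 = (h ^ 2) ^ 2 by ring, hh2, div_pow, one_pow, mul_one_div]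
  have hnI : 1 / ((n : ℝ) * M.fisherInfo θ) = h ^ 2 / M.fisherInfo θ := by rw [hh2]; field_simp
  calc _ ≤ n * |∫ x, (Z x - θ) ^ 2 ∂(M.sampleLaw θ n) - 1 / (n * M.fisherInfo θ)| +
        n * (∫ x, Z x ∂(M.sampleLaw θ n) - θ) ^ 2 := by
        refine (abs_sub _ _).trans_eq ?_
        rw [abs_mul, abs_mul, Nat.abs_cast,
          abs_of_nonneg (sq_nonneg (∫ x, Z x ∂(M.sampleLaw θ n) - θ))]
    _ ≤ n * (h * (1 / (n * M.fisherInfo θ)) + (1 / h + 1) * (C / n ^ 2)) +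
        n * (C ^ 2 * h ^ 6) := by gcongr
    _ = (n * h ^ 2) * ((1 / M.fisherInfo θ) * h + C * h + C * h ^ 2 + C ^ 2 * h ^ 4) := by
        rw [hn4, hnI]; field_simp; ring
    _ ≤ (1 / M.fisherInfo θ) * h + C * h + C * h + C ^ 2 * h := by
        rw [hnh, one_mul]
        have b2 : h ^ 2 ≤ h := by nlinarith
        have b4 : h ^ 4 ≤ h := pow_le_of_le_one hh0.le hh1 (by norm_num)
        gcongr
    _ = _ := by ring

/-! ### Comparison with the average score of the whole sample -/

/-- The positions of the sample that belong to one of the blocks. -/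
noncomputable def usedIndices (n k : ℕ) : Finset (Fin n) :=
  Finset.univ.image fun p : Fin k × Fin (n / k) => blockIndex p.1 p.2

lemma injective_blockIndex (n k : ℕ) :
    Function.Injective fun p : Fin k × Fin (n / k) => (blockIndex p.1 p.2 : Fin n) :=
  fun _ _ h => Prod.ext_iff.2 (blockIndex_inj h)

lemma card_usedIndices (n k : ℕ) : (usedIndices n k).card = k * (n / k) := by
  rw [usedIndices, Finset.card_image_of_injective _ (injective_blockIndex n k)]
  simp

lemma blockMean_sampleMean {D : Type*} (g : D → ℝ) {n k : ℕ} (x : Fin n → D) :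
    blockMean (k := k) (sampleMean g) x =
      (∑ i ∈ usedIndices n k, g (x i)) / ((k : ℝ) * (n / k : ℕ)) := by
  rw [usedIndices, Finset.sum_image (injective_blockIndex n k).injOn, Fintype.sum_prod_type]
  simp only [blockMean, sampleMean, sampleBlock_apply, ← Finset.sum_div]
  rw [div_div, mul_comm]

/-- Dropping the observations outside the blocks changes the normalized sum of `g` by the excess
of `n / (k ⌊n / k⌋)` over one, in mean square. -/
lemma integral_blockMean_sub_sum_sq {D : Type*} [MeasurableSpace D] (ν : Measure D)
    [IsProbabilityMeasure ν] {g : D → ℝ} (hg : Measurable g) (hg2 : MemLp g 2 ν)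
    (hg0 : ∫ y, g y ∂ν = 0) {n k : ℕ} (hk : k ≠ 0) (hnk : n / k ≠ 0) :
    ∫ x : Fin n → D, (√(n : ℝ) * blockMean (k := k) (sampleMean g) x -
        (√(n : ℝ))⁻¹ * ∑ i, g (x i)) ^ 2 ∂(Measure.pi fun _ => ν) =
      (n / ((k : ℝ) * (n / k : ℕ)) - 1) * ∫ y, g y ^ 2 ∂ν := by
  have hn : n ≠ 0 := by rintro rfl; simp at hnk
  have hn' : (0 : ℝ) < n := by exact_mod_cast Nat.pos_of_ne_zero hn
  set m : ℝ := (k : ℝ) * (n / k : ℕ) with hm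
  have hm0 : m ≠ 0 := mul_ne_zero (by exact_mod_cast hk) (by exact_mod_cast hnk)
  set U := usedIndices n k with hU
  have hcard : (U.card : ℝ) = m := by rw [hU, card_usedIndices]; push_cast; rfl
  have hint (s t : Finset (Fin n)) : Integrable
      (fun x : Fin n → D => (∑ i ∈ s, g (x i)) * ∑ i ∈ t, g (x i)) (Measure.pi fun _ => ν) :=
    (memLp_finsetSum s fun i _ => memLp_comp_eval ν hg2 i).integrable_mul
      (memLp_finsetSum t fun i _ => memLp_comp_eval ν hg2 i)
  have hE (s t : Finset (Fin n)) := integral_sum_mul_sum ν hg hg hg2 hg2 hg0 s t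
  have hs : √(n : ℝ) ^ 2 = n := Real.sq_sqrt hn'.le
  have hs0 : √(n : ℝ) ≠ 0 := (Real.sqrt_pos.2 hn').ne'
  have hexp : (fun x : Fin n → D => (√(n : ℝ) * blockMean (k := k) (sampleMean g) x -
      (√(n : ℝ))⁻¹ * ∑ i, g (x i)) ^ 2) = fun x =>
        n / m ^ 2 * ((∑ i ∈ U, g (x i)) * ∑ i ∈ U, g (x i)) -
          2 / m * ((∑ i ∈ U, g (x i)) * ∑ i, g (x i)) +
            1 / n * ((∑ i, g (x i)) * ∑ i, g (x i)) := by
    ext x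
    rw [blockMean_sampleMean]
    have h1 : (√(n : ℝ))⁻¹ ^ 2 = 1 / n := by rw [inv_pow, hs, one_div]
    have h2 : √(n : ℝ) * (√(n : ℝ))⁻¹ = 1 := mul_inv_cancel₀ hs0
    calc _ = √(n : ℝ) ^ 2 / m ^ 2 * ((∑ i ∈ U, g (x i)) * ∑ i ∈ U, g (x i)) -
          2 / m * (√(n : ℝ) * (√(n : ℝ))⁻¹) * ((∑ i ∈ U, g (x i)) * ∑ i, g (x i)) +
            (√(n : ℝ))⁻¹ ^ 2 * ((∑ i, g (x i)) * ∑ i, g (x i)) := by ring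
      _ = _ := by rw [hs, h1, h2, mul_one]
  rw [hexp, integral_add (((hint _ _).const_mul _).sub' ((hint _ _).const_mul _))
    ((hint _ _).const_mul _), integral_sub ((hint _ _).const_mul _) ((hint _ _).const_mul _),
    integral_const_mul, integral_const_mul, integral_const_mul, hE, hE, hE]
  simp only [Finset.inter_self, Finset.inter_univ, Finset.card_univ, Fintype.card_fin, hcard,
    ← sq]
  field_simp
  ring

end ParametricModel

/-! ### Admissible numbers of blocks -/

section Rates

lemma tendsto_rpow_natCast_neg {y : ℝ} (hy : 0 < y) :
    Tendsto (fun n : ℕ => (n : ℝ) ^ (-y)) atTop (𝓝 0) :=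
  (tendsto_rpow_neg_atTop hy).comp tendsto_natCast_atTop_atTop

/-- The choice `⌈n^(3/5) Λ^(2/5) / ε^(2/5)⌉` is admissible: both rates are powers of
`n^(-1/6) / ε`. -/
lemma admissibleBlockCount_ceil {ε : ℕ → ℝ} (hε : ∀ n, 0 < ε n)
    (hεω : (fun n : ℕ => (n : ℝ) ^ (-(1 / 6) : ℝ)) =o[atTop] ε) {L : ℝ} (hL : 0 < L) :
    AdmissibleBlockCount ε
      (fun n => ⌈(n : ℝ) ^ (3 / 5 : ℝ) * L ^ (2 / 5 : ℝ) / ε n ^ (2 / 5 : ℝ)⌉₊) := by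
  set e : ℕ → ℝ := fun n => (n : ℝ) ^ (-(1 / 6) : ℝ) / ε n with he
  have he0 : Tendsto e atTop (𝓝 0) := hεω.tendsto_div_nhds_zero
  have hepow {y : ℝ} (hy : 0 < y) : Tendsto (fun n => e n ^ y) atTop (𝓝 0) := by
    have := he0.rpow_const (p := y) (Or.inr hy.le)
    rwa [Real.zero_rpow hy.ne'] at this
  have hed (n : ℕ) (y : ℝ) : e n ^ y = (n : ℝ) ^ (-(1 / 6) * y) / ε n ^ y := by
    rw [he]
    simp only
    rw [Real.div_rpow (by positivity) (hε n).le, ← Real.rpow_mul (Nat.cast_nonneg n)]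
  set A : ℕ → ℝ := fun n => (n : ℝ) ^ (3 / 5 : ℝ) * L ^ (2 / 5 : ℝ) / ε n ^ (2 / 5 : ℝ) with hA
  have hA0 (n : ℕ) : 0 ≤ A n := by have := hε n; positivity
  constructor
  · refine (isLittleO_iff_tendsto' ?_).2 ?_
    · filter_upwards [eventually_ne_atTop 0] with n hn h0
      have : (0 : ℝ) < (n : ℝ) ^ (2 / 3 : ℝ) :=
        Real.rpow_pos_of_pos (by exact_mod_cast Nat.pos_of_ne_zero hn) _
      exact absurd h0 this.ne'
    · have hlim : Tendsto (fun n : ℕ => L ^ (2 / 5 : ℝ) * e n ^ (2 / 5 : ℝ) +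
          (n : ℝ) ^ (-(2 / 3 : ℝ))) atTop (𝓝 0) := by
        simpa using ((hepow (y := 2 / 5) (by norm_num)).const_mul (L ^ (2 / 5 : ℝ))).add
          (tendsto_rpow_natCast_neg (by norm_num : (0 : ℝ) < 2 / 3))
      refine squeeze_zero' (Eventually.of_forall fun n => by positivity) ?_ hlim
      filter_upwards [eventually_ne_atTop 0] with n hn
      have hn' : (0 : ℝ) < n := by exact_mod_cast Nat.pos_of_ne_zero hn
      have hp : (0 : ℝ) < (n : ℝ) ^ (2 / 3 : ℝ) := Real.rpow_pos_of_pos hn' _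
      have hq : 0 < ε n ^ (2 / 5 : ℝ) := Real.rpow_pos_of_pos (hε n) _
      rw [div_le_iff₀ hp]
      refine (Nat.ceil_lt_add_one (hA0 n)).le.trans (le_of_eq ?_)
      rw [add_mul, ← Real.rpow_add hn', hed, hA]
      have h1 : (n : ℝ) ^ (3 / 5 : ℝ) =
          (n : ℝ) ^ (-(1 / 6) * (2 / 5) : ℝ) * (n : ℝ) ^ (2 / 3 : ℝ) := by
        rw [← Real.rpow_add hn']; norm_num
      have h2 : (n : ℝ) ^ (-(2 / 3) + 2 / 3 : ℝ) = 1 := by norm_num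
      rw [h2]
      simp only
      rw [h1]
      ring
  · have hApos (n : ℕ) (hn : n ≠ 0) : 0 < A n := by
      have hn' : (0 : ℝ) < n := by exact_mod_cast Nat.pos_of_ne_zero hn
      have := hε n
      positivity
    refine (isLittleO_iff_tendsto' ?_).2 ?_
    · filter_upwards [eventually_ne_atTop 0] with n hn h0
      have h1 : 0 < (⌈A n⌉₊ : ℝ) := by exact_mod_cast Nat.ceil_pos.2 (hApos n hn)
      exact absurd h0 h1.ne'
    · have hlim : Tendsto (fun n : ℕ => (L ^ (2 / 5 : ℝ))⁻¹ * e n ^ (3 / 5 : ℝ)) atTop (𝓝 0) := by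
        simpa using (hepow (y := 3 / 5) (by norm_num)).const_mul (L ^ (2 / 5 : ℝ))⁻¹
      refine squeeze_zero' (Eventually.of_forall fun n => by have := hε n; positivity) ?_ hlim
      filter_upwards [eventually_ne_atTop 0] with n hn
      have hn' : (0 : ℝ) < n := by exact_mod_cast Nat.pos_of_ne_zero hn
      have hpos := hε n
      have hL5 : 0 < L ^ (2 / 5 : ℝ) := Real.rpow_pos_of_pos hL _
      calc √(n : ℝ) / ε n / (⌈A n⌉₊ : ℝ) ≤ √(n : ℝ) / ε n / A n := by
            have := hApos n hn
            gcongr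
            exact Nat.le_ceil _
        _ = _ := by
            have h1 : (n : ℝ) ^ (1 / 2 : ℝ) =
                (n : ℝ) ^ (-(1 / 6) * (3 / 5) : ℝ) * (n : ℝ) ^ (3 / 5 : ℝ) := by
              rw [← Real.rpow_add hn']; norm_num
            have h2 : ε n = ε n ^ (3 / 5 : ℝ) * ε n ^ (2 / 5 : ℝ) := by
              rw [← Real.rpow_add hpos]; norm_num
            have h3 : (0 : ℝ) < (n : ℝ) ^ (3 / 5 : ℝ) := Real.rpow_pos_of_pos hn' _
            have h4 : 0 < ε n ^ (2 / 5 : ℝ) := Real.rpow_pos_of_pos hpos _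
            have h5 : 0 < ε n ^ (3 / 5 : ℝ) := Real.rpow_pos_of_pos hpos _
            rw [hed, Real.sqrt_eq_rpow, h1]
            nth_rewrite 1 [h2]
            simp only [hA]
            field_simp

variable {ε : ℕ → ℝ} {k : ℕ → ℕ}

namespace AdmissibleBlockCount

variable (hk : AdmissibleBlockCount ε k)
include hk

lemma eventually_ne_zero (hε : ∀ n, 0 < ε n) : ∀ᶠ n in atTop, k n ≠ 0 := by
  filter_upwards [hk.2.def one_pos, eventually_ne_atTop 0] with n h hn h0
  have hn' : (0 : ℝ) < n := by exact_mod_cast Nat.pos_of_ne_zero hn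
  have : 0 < √(n : ℝ) / ε n := div_pos (Real.sqrt_pos.2 hn') (hε n)
  rw [h0, Real.norm_of_nonneg this.le] at h
  simp at h
  linarith

/-- The variance of the noise is `o(1 / n)`. -/
lemma tendsto_sqrt_div_mul : Tendsto (fun n : ℕ => √(n : ℝ) / (k n * ε n)) atTop (𝓝 0) := by
  refine hk.2.tendsto_div_nhds_zero.congr fun n => ?_
  rw [div_div, mul_comm]

lemma tendsto_pow_three_div : Tendsto (fun n : ℕ => (k n : ℝ) ^ 3 / n ^ 2) atTop (𝓝 0) := by
  have h := (hk.1.tendsto_div_nhds_zero).pow 3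
  rw [zero_pow (by norm_num)] at h
  refine h.congr fun n => ?_
  rw [div_pow]
  congr 1
  rw [← Real.rpow_natCast, ← Real.rpow_mul (Nat.cast_nonneg n)]
  norm_num

lemma tendsto_div : Tendsto (fun n : ℕ => (k n : ℝ) / n) atTop (𝓝 0) := by
  have h := hk.1.tendsto_div_nhds_zero.mul
    (tendsto_rpow_natCast_neg (by norm_num : (0 : ℝ) < 1 / 3))
  rw [mul_zero] at h
  refine h.congr' ?_
  filter_upwards [eventually_ne_atTop 0] with n hn
  have hn' : (0 : ℝ) < n := by exact_mod_cast Nat.pos_of_ne_zero hn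
  rw [Real.rpow_neg hn'.le, ← div_eq_mul_inv, div_div, ← Real.rpow_add hn']
  norm_num

/-- Blocks are eventually nonempty, and rounding down costs at most a factor of two in their
size. -/
lemma eventually_block (hε : ∀ n, 0 < ε n) : ∀ᶠ n in atTop, k n ≠ 0 ∧ n / k n ≠ 0 ∧
    ((n / k n : ℕ) : ℝ)⁻¹ ≤ 2 * ((k n : ℝ) / n) ∧
    1 ≤ (n : ℝ) / (k n * (n / k n : ℕ)) ∧
    (n : ℝ) / (k n * (n / k n : ℕ)) ≤ 1 + 2 * ((k n : ℝ) / n) := by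
  filter_upwards [hk.eventually_ne_zero hε, eventually_ne_atTop 0,
    hk.tendsto_div.eventually_lt_const one_pos] with n hk0 hn hlt
  have hn' : (0 : ℝ) < n := by exact_mod_cast Nat.pos_of_ne_zero hn
  have hk' : (0 : ℝ) < k n := by exact_mod_cast Nat.pos_of_ne_zero hk0
  have hkn : k n ≤ n := by
    rw [div_lt_one hn'] at hlt
    exact_mod_cast hlt.le
  have ht1 : 1 ≤ n / k n := (Nat.one_le_div_iff (Nat.pos_of_ne_zero hk0)).2 hkn
  have ht' : (1 : ℝ) ≤ (n / k n : ℕ) := by exact_mod_cast ht1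
  set t : ℝ := ((n / k n : ℕ) : ℝ) with ht
  have hle : k n * t ≤ n := by
    rw [ht]; exact_mod_cast Nat.mul_div_le n (k n)
  have hlt' : (n : ℝ) < k n * (t + 1) := by
    rw [ht]; exact_mod_cast Nat.lt_mul_div_succ n (Nat.pos_of_ne_zero hk0)
  have hinv : t⁻¹ ≤ 2 * ((k n : ℝ) / n) := by
    rw [inv_eq_one_div, div_le_iff₀ (by linarith), ← mul_div_assoc, div_mul_eq_mul_div,
      le_div_iff₀ hn']
    nlinarith
  refine ⟨hk0, by omega, hinv, ?_, ?_⟩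
  · rw [le_div_iff₀ (by positivity)]; linarith
  · have : (n : ℝ) / (k n * t) ≤ 1 + t⁻¹ := by
      rw [div_le_iff₀ (by positivity)]
      have : (1 + t⁻¹) * (k n * t) = k n * (t + 1) := by field_simp
      linarith
    linarith

lemma tendsto_block_atTop (hε : ∀ n, 0 < ε n) : Tendsto (fun n => n / k n) atTop atTop := by
  rw [← tendsto_natCast_atTop_iff (R := ℝ)]
  have h : Tendsto (fun n : ℕ => 2 * ((k n : ℝ) / n)) atTop (𝓝[>] 0) := by
    refine tendsto_nhdsWithin_iff.2 ⟨by simpa using hk.tendsto_div.const_mul 2, ?_⟩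
    filter_upwards [hk.eventually_ne_zero hε, eventually_ne_atTop 0] with n hk0 hn
    have hn' : (0 : ℝ) < n := by exact_mod_cast Nat.pos_of_ne_zero hn
    have hk' : (0 : ℝ) < k n := by exact_mod_cast Nat.pos_of_ne_zero hk0
    exact (by positivity : (0 : ℝ) < 2 * ((k n : ℝ) / n))
  refine tendsto_atTop_mono' _ ?_ h.inv_tendsto_nhdsGT_zero
  filter_upwards [hk.eventually_block hε] with n ⟨_, ht, hinv, _⟩
  exact inv_le_of_inv_le₀ (by exact_mod_cast Nat.pos_of_ne_zero ht) hinv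

lemma tendsto_div_mul_block (hε : ∀ n, 0 < ε n) :
    Tendsto (fun n : ℕ => (n : ℝ) / (k n * (n / k n : ℕ))) atTop (𝓝 1) := by
  have hlim : Tendsto (fun n : ℕ => 1 + 2 * ((k n : ℝ) / n)) atTop (𝓝 1) := by
    simpa using (hk.tendsto_div.const_mul 2).const_add 1
  refine tendsto_of_tendsto_of_tendsto_of_le_of_le' tendsto_const_nhds hlim ?_ ?_
  · filter_upwards [hk.eventually_block hε] with n h using h.2.2.2.1
  · filter_upwards [hk.eventually_block hε] with n h using h.2.2.2.2

end AdmissibleBlockCount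

end Rates

namespace ParametricModel

variable {D : Type*} [MeasurableSpace D] {M : ParametricModel D}

variable {θhat : (n : ℕ) → (Fin n → D) → M.paramSpace} {ε : ℕ → ℝ} {k : ℕ → ℕ}

/-! ### Asymptotics of the private estimator -/

lemma Regular.integral_blockAverage (hM : M.Regular) (hθ : M.IsMLE θhat) (θ : M.paramSpace)
    {n k : ℕ} (hk : k ≠ 0) : ∫ x, M.blockAverage θhat n k x ∂(M.sampleLaw θ n) =
      ∫ x, M.bcMLE θhat (n / k) x ∂(M.sampleLaw θ (n / k)) :=
  integral_blockMean (M.law θ) hk (hM.memLp_bcMLE hθ θ (n / k) 2)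

/-- The bias of the private estimator is that of one block. -/
lemma Regular.exists_eventually_abs_bias_le (hM : M.Regular) (hθ : M.IsMLE θhat)
    (hε : ∀ n, 0 < ε n) (hk : AdmissibleBlockCount ε k) (θ : M.paramSpace)
    (hint : (θ : ℝ) ∈ interior M.paramSpace) : ∃ C, 0 ≤ C ∧ ∀ᶠ n in atTop,
      |M.bias θhat θ n (k n) (ε n)| ≤ C * √((k n : ℝ) / n) ^ 3 := by
  obtain ⟨C, hC, hexp⟩ := hM.exists_bcMLE_expansion hθ θ hint
  refine ⟨C * √2 ^ 3, by positivity, ?_⟩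
  filter_upwards [hk.eventually_block hε] with n ⟨hk0, ht, hinv, _⟩
  rw [hM.bias_eq hθ θ n (k n) (hε n), hM.integral_blockAverage hθ θ hk0]
  refine (hexp _ ht).2.trans ?_
  rw [mul_assoc, ← mul_pow, ← Real.sqrt_mul (by norm_num), ← Real.sqrt_inv]
  gcongr

lemma Regular.bias_isBigO (hM : M.Regular) (hθ : M.IsMLE θhat)
    (hε : ∀ n, 0 < ε n) (hk : AdmissibleBlockCount ε k) (θ : M.paramSpace)
    (hint : (θ : ℝ) ∈ interior M.paramSpace) :
    (fun n => M.bias θhat θ n (k n) (ε n)) =O[atTop] fun n => ((k n : ℝ) / n) ^ (3 / 2 : ℝ) := by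
  obtain ⟨C, -, h⟩ := hM.exists_eventually_abs_bias_le hθ hε hk θ hint
  refine IsBigO.of_bound C ?_
  filter_upwards [h] with n hn
  rw [Real.norm_of_nonneg (by positivity : (0 : ℝ) ≤ ((k n : ℝ) / n) ^ (3 / 2 : ℝ))]
  refine hn.trans_eq ?_
  rw [Real.sqrt_eq_rpow, ← Real.rpow_natCast, ← Real.rpow_mul (by positivity)]
  norm_num

lemma sqrt_mul_sqrt_div_pow_three {n : ℕ} (hn : n ≠ 0) (k : ℕ) :
    √(n : ℝ) * √((k : ℝ) / n) ^ 3 = √((k : ℝ) ^ 3 / n ^ 2) := by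
  have hn' : (0 : ℝ) < n := by exact_mod_cast Nat.pos_of_ne_zero hn
  have h3 (y : ℝ) (hy : 0 ≤ y) : √y ^ 3 = √(y ^ 3) := by
    rw [eq_comm, Real.sqrt_eq_iff_mul_self_eq (by positivity) (by positivity)]
    symm
    calc √y ^ 3 * √y ^ 3 = (√y ^ 2) ^ 3 := by ring
      _ = y ^ 3 := by rw [Real.sq_sqrt hy]
  rw [h3 _ (by positivity), ← Real.sqrt_mul hn'.le]
  congr 1
  field_simp

lemma Regular.tendsto_sqrt_mul_bias (hM : M.Regular) (hθ : M.IsMLE θhat)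
    (hε : ∀ n, 0 < ε n) (hk : AdmissibleBlockCount ε k) (θ : M.paramSpace)
    (hint : (θ : ℝ) ∈ interior M.paramSpace) :
    Tendsto (fun n : ℕ => √(n : ℝ) * M.bias θhat θ n (k n) (ε n)) atTop (𝓝 0) := by
  obtain ⟨C, -, h⟩ := hM.exists_eventually_abs_bias_le hθ hε hk θ hint
  have hlim : Tendsto (fun n : ℕ => C * √((k n : ℝ) ^ 3 / n ^ 2)) atTop (𝓝 0) := by
    simpa using hk.tendsto_pow_three_div.sqrt.const_mul C
  refine squeeze_zero_norm' ?_ hlim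
  filter_upwards [h, eventually_ne_atTop 0] with n hn hn0
  rw [norm_mul, Real.norm_of_nonneg (Real.sqrt_nonneg _), ← sqrt_mul_sqrt_div_pow_three hn0]
  calc _ ≤ √(n : ℝ) * (C * √((k n : ℝ) / n) ^ 3) := by gcongr; exact hn
    _ = _ := by ring

lemma Regular.tendsto_mul_variance_blockAverage (hM : M.Regular) (hθ : M.IsMLE θhat)
    (hε : ∀ n, 0 < ε n) (hk : AdmissibleBlockCount ε k) (θ : M.paramSpace)
    (hint : (θ : ℝ) ∈ interior M.paramSpace) :
    Tendsto (fun n : ℕ => n * Var[M.blockAverage θhat n (k n); M.sampleLaw θ n]) atTop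
      (𝓝 (1 / M.fisherInfo θ)) := by
  have h := (hk.tendsto_div_mul_block hε).mul
    ((hM.tendsto_mul_variance_bcMLE hθ θ hint).comp (hk.tendsto_block_atTop hε))
  rw [one_mul] at h
  refine h.congr' ?_
  filter_upwards [hk.eventually_block hε] with n ⟨hk0, ht, _⟩
  have hv : Var[M.blockAverage θhat n (k n); M.sampleLaw θ n] =
      Var[M.bcMLE θhat (n / k n); M.sampleLaw θ (n / k n)] / k n :=
    variance_blockMean (M.law θ) hk0 (hM.measurable_bcMLE hθ _) (hM.memLp_bcMLE hθ θ _ 2)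
  have hk' : (k n : ℝ) ≠ 0 := by exact_mod_cast hk0
  have ht' : ((n / k n : ℕ) : ℝ) ≠ 0 := by exact_mod_cast ht
  rw [hv]
  simp only [Function.comp]
  field_simp

lemma Regular.tendsto_mul_mse (hM : M.Regular) (hθ : M.IsMLE θhat)
    (hε : ∀ n, 0 < ε n) (hk : AdmissibleBlockCount ε k) (θ : M.paramSpace)
    (hint : (θ : ℝ) ∈ interior M.paramSpace) :
    Tendsto (fun n : ℕ => n * M.mse θhat θ n (k n) (ε n)) atTop (𝓝 (1 / M.fisherInfo θ)) := by
  have h1 := hM.tendsto_mul_variance_blockAverage hθ hε hk θ hint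
  have h2 := (hk.tendsto_sqrt_div_mul.pow 2).const_mul (2 * M.Lam ^ 2)
  have h3 := (hM.tendsto_sqrt_mul_bias hθ hε hk θ hint).pow 2
  have h := (h1.add h2).add h3
  simp only [ne_eq, OfNat.ofNat_ne_zero, not_false_eq_true, zero_pow, mul_zero, add_zero] at h
  refine h.congr fun n => ?_
  rw [hM.mse_eq hθ θ n (k n) (hε n), div_pow, mul_pow, mul_pow, Real.sq_sqrt (Nat.cast_nonneg n)]
  ring

/-- Averaging a statistic `Q` over independent blocks divides its variance, but not its mean, by the
number of blocks. -/
lemma integral_blockMean_sq_le (ν : Measure D) [IsProbabilityMeasure ν] {n k : ℕ} (hk : k ≠ 0)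
    {Q : (Fin (n / k) → D) → ℝ} (hQm : Measurable Q) (hQ : MemLp Q 2 (Measure.pi fun _ => ν)) :
    ∫ x, blockMean Q x ^ 2 ∂(Measure.pi fun _ : Fin n => ν) ≤
      (∫ y, Q y ^ 2 ∂(Measure.pi fun _ => ν)) / k + (∫ y, Q y ∂(Measure.pi fun _ => ν)) ^ 2 := by
  have h1 := variance_eq_sub (memLp_blockMean (n := n) ν hQ)
  have h2 := variance_eq_sub hQ
  rw [variance_blockMean ν hk hQm hQ, integral_blockMean ν hk hQ] at h1
  simp only [Pi.pow_apply] at h1 h2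
  have h3 : Var[Q; Measure.pi fun _ => ν] / k ≤ (∫ y, Q y ^ 2 ∂(Measure.pi fun _ => ν)) / k := by
    gcongr
    rw [h2]
    linarith [sq_nonneg (∫ y, Q y ∂(Measure.pi fun _ : Fin (n / k) => ν))]
  linarith

lemma blockMean_sub {D : Type*} {n k : ℕ} (hk : k ≠ 0) (Z X : (Fin (n / k) → D) → ℝ) (c : ℝ)
    (x : Fin n → D) : blockMean (fun y => Z y - c - X y) x =
      blockMean Z x - c - blockMean X x := by
  have hk' : (k : ℝ) ≠ 0 := by exact_mod_cast hk
  simp only [blockMean, Finset.sum_sub_distrib, sub_div]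
  simp
  field_simp

/-- The normalized error of the private estimator is asymptotically equivalent, in mean square,
to the normalized sum of the efficient influence function `ℓ' / I` over the whole sample. -/
lemma Regular.tendsto_integral_sq_tStar_sub (hM : M.Regular) (hθ : M.IsMLE θhat)
    (hε : ∀ n, 0 < ε n) (hk : AdmissibleBlockCount ε k) (θ : M.paramSpace)
    (hint : (θ : ℝ) ∈ interior M.paramSpace) :
    Tendsto (fun n : ℕ => ∫ xr : (Fin n → D) × ℝ, (√(n : ℝ) * (M.tStar θhat n (k n) xr - θ) -
      (√(n : ℝ))⁻¹ * ∑ i, M.dlog 1 (xr.1 i) θ / M.fisherInfo θ) ^ 2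
        ∂(M.jointLaw θ n (k n) (ε n))) atTop (𝓝 0) := by
  obtain ⟨C, hC, hexp⟩ := hM.exists_bcMLE_expansion hθ θ hint
  obtain ⟨G, H, hE⟩ := hM.exists_isEnvelope
  have hI := hM.fisherInfo_pos θ
  set I := M.fisherInfo θ with hIdef
  set g : D → ℝ := fun y => M.dlog 1 y θ / I with hg
  have m1 : Measurable fun x => M.dlog 1 x θ := hE.measurable_logDeriv (by norm_num) θ.2
  have p1 : MemLp (fun x => M.dlog 1 x θ) 2 (M.law θ) :=
    (hE.memLp_logDeriv le_rfl (by norm_num) θ.2 θ).two_of_four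
  have mg : Measurable g := m1.div_const I
  have pg : MemLp g 2 (M.law θ) := by
    simpa only [hg, div_eq_inv_mul] using p1.const_mul I⁻¹
  have eg : ∫ y, g y ∂(M.law θ) = 0 := by
    rw [hg, integral_div]
    have : ∫ y, M.dlog 1 y θ ∂(M.law θ) = 0 := (hE.integral_logDeriv_one_and_two θ hint).1
    rw [this, zero_div]
  set v := ∫ y, g y ^ 2 ∂(M.law θ) with hv
  have hlim : Tendsto (fun n : ℕ =>
      3 * (((n : ℝ) / (k n * (n / k n : ℕ))) * (C * (2 * ((k n : ℝ) / n))) +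
        C ^ 2 * (8 * ((k n : ℝ) ^ 3 / n ^ 2))) +
      3 * (2 * M.Lam ^ 2 * (√(n : ℝ) / (k n * ε n)) ^ 2) +
      3 * ((((n : ℝ) / (k n * (n / k n : ℕ))) - 1) * v)) atTop (𝓝 0) := by
    have a0 := hk.tendsto_div_mul_block hε
    have a1 := a0.mul ((hk.tendsto_div.const_mul 2).const_mul C)
    have a2 := (hk.tendsto_pow_three_div.const_mul 8).const_mul (C ^ 2)
    have a3 := (hk.tendsto_sqrt_div_mul.pow 2).const_mul (2 * M.Lam ^ 2)
    have a4 := (a0.sub_const 1).mul_const v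
    have := (((a1.add a2).const_mul 3).add (a3.const_mul 3)).add (a4.const_mul 3)
    simpa using this
  refine squeeze_zero' (Eventually.of_forall fun n => integral_nonneg fun _ => sq_nonneg _) ?_ hlim
  filter_upwards [hk.eventually_block hε, eventually_ne_atTop 0] with n ⟨hk0, ht, hinv, _, _⟩ hn
  have hn' : (0 : ℝ) < n := by exact_mod_cast Nat.pos_of_ne_zero hn
  have hk' : (0 : ℝ) < k n := by exact_mod_cast Nat.pos_of_ne_zero hk0
  set t := n / k n with htdef
  have ht' : (0 : ℝ) < t := by exact_mod_cast Nat.pos_of_ne_zero ht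
  obtain ⟨x1, x2⟩ := hexp t ht
  set Q : (Fin t → D) → ℝ := fun y => M.bcMLE θhat t y - θ - sampleMean g y with hQ
  have hsm (y : Fin t → D) : sampleMean g y = sampleMean (M.dlog 1 · θ) y / I := by
    simp only [sampleMean, hg, ← Finset.sum_div]
    rw [div_right_comm]
  have mQ : Measurable Q :=
    ((hM.measurable_bcMLE hθ t).sub_const _).sub (measurable_sampleMean mg t)
  have pZ : MemLp (M.bcMLE θhat t) 2 (M.sampleLaw θ t) := hM.memLp_bcMLE hθ θ t 2
  have pgt : MemLp (sampleMean g) 2 (M.sampleLaw θ t) := memLp_sampleMean (M.law θ) pg t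
  have pQ : MemLp Q 2 (M.sampleLaw θ t) := (pZ.sub (memLp_const _)).sub pgt
  have eQ2 : ∫ y, Q y ^ 2 ∂(M.sampleLaw θ t) ≤ C / t ^ 2 := by
    simpa only [hQ, hsm] using x1
  have eQ : ∫ y, Q y ∂(M.sampleLaw θ t) = ∫ y, M.bcMLE θhat t y ∂(M.sampleLaw θ t) - θ := by
    have h0 : ∫ y, sampleMean g y ∂(M.sampleLaw θ t) = 0 :=
      (integral_sampleMean (M.law θ) mg (pg.integrable (by norm_num)) ht).trans eg
    have iZ := pZ.integrable (by norm_num)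
    rw [hQ, integral_sub (iZ.sub' (integrable_const _)) (pgt.integrable (by norm_num)),
      integral_sub iZ (integrable_const _), h0]
    simp
  have eQsq : (∫ y, Q y ∂(M.sampleLaw θ t)) ^ 2 ≤ C ^ 2 * (t : ℝ)⁻¹ ^ 3 := by
    rw [eQ, ← sq_abs]
    calc _ ≤ (C * (√(t : ℝ))⁻¹ ^ 3) ^ 2 := by gcongr
      _ = C ^ 2 * ((√(t : ℝ))⁻¹ ^ 2) ^ 3 := by ring
      _ = _ := by rw [inv_pow (√(t : ℝ)), Real.sq_sqrt ht'.le]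
  -- the error splits into the remainders of the blocks, the noise, and the unused observations
  set U₁ : (Fin n → D) → ℝ := fun x => √(n : ℝ) * blockMean Q x with hU₁
  set U₃ : (Fin n → D) → ℝ := fun x => √(n : ℝ) * blockMean (k := k n) (sampleMean g) x -
    (√(n : ℝ))⁻¹ * ∑ i, g (x i) with hU₃
  have pU₁ : MemLp U₁ 2 (M.sampleLaw θ n) := (memLp_blockMean (M.law θ) pQ).const_mul _
  have pU₃ : MemLp U₃ 2 (M.sampleLaw θ n) :=
    ((memLp_blockMean (M.law θ) pgt).const_mul _).sub
      ((memLp_finsetSum Finset.univ fun i _ => memLp_comp_eval (M.law θ) pg i).const_mul _)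
  have hfst := measurePreserving_fst_jointLaw (M := M) θ n (k n) (ε n)
  have i1 : Integrable (fun xr : (Fin n → D) × ℝ => 3 * U₁ xr.1 ^ 2)
      (M.jointLaw θ n (k n) (ε n)) :=
    (hfst.integrable_comp_of_integrable pU₁.integrable_sq).const_mul 3
  have i3 : Integrable (fun xr : (Fin n → D) × ℝ => 3 * U₃ xr.1 ^ 2)
      (M.jointLaw θ n (k n) (ε n)) :=
    (hfst.integrable_comp_of_integrable pU₃.integrable_sq).const_mul 3
  have i2 : Integrable (fun xr : (Fin n → D) × ℝ => 3 * (n * xr.2 ^ 2))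
      (M.jointLaw θ n (k n) (ε n)) :=
    ((memLp_snd_jointLaw θ n (k n) (hε n)).integrable_sq.const_mul _).const_mul 3
  have hsqrt : √(n : ℝ) ^ 2 = n := Real.sq_sqrt hn'.le
  have b1 : ∫ x, U₁ x ^ 2 ∂(M.sampleLaw θ n) ≤
      ((n : ℝ) / (k n * t)) * (C * (2 * ((k n : ℝ) / n))) +
        C ^ 2 * (8 * ((k n : ℝ) ^ 3 / n ^ 2)) := by
    simp only [hU₁, mul_pow, hsqrt]
    rw [integral_const_mul]
    calc _ ≤ (n : ℝ) * ((∫ y, Q y ^ 2 ∂(M.sampleLaw θ t)) / k n +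
          (∫ y, Q y ∂(M.sampleLaw θ t)) ^ 2) := by
          gcongr
          exact integral_blockMean_sq_le (M.law θ) hk0 mQ pQ
      _ ≤ (n : ℝ) * ((C / t ^ 2) / k n + C ^ 2 * (t : ℝ)⁻¹ ^ 3) := by gcongr
      _ = ((n : ℝ) / (k n * t)) * (C * (t : ℝ)⁻¹) + n * (C ^ 2 * (t : ℝ)⁻¹ ^ 3) := by
          field_simp
      _ ≤ ((n : ℝ) / (k n * t)) * (C * (2 * ((k n : ℝ) / n))) +
          n * (C ^ 2 * (2 * ((k n : ℝ) / n)) ^ 3) := by gcongr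
      _ = _ := by field_simp; ring
  have b3 : ∫ x, U₃ x ^ 2 ∂(M.sampleLaw θ n) = ((n : ℝ) / (k n * t) - 1) * v :=
    integral_blockMean_sub_sum_sq (M.law θ) mg pg eg hk0 ht
  have b2 : ∫ r, (n : ℝ) * r ^ 2 ∂(laplaceReal (M.Lam / (k n * ε n))) =
      2 * M.Lam ^ 2 * (√(n : ℝ) / (k n * ε n)) ^ 2 := by
    rw [integral_const_mul, integral_sq_laplaceReal (noiseScale_nonneg (hε n) (k n)), div_pow,
      div_pow, hsqrt]
    ring
  calc _ ≤ ∫ xr : (Fin n → D) × ℝ, (3 * U₁ xr.1 ^ 2 + 3 * (n * xr.2 ^ 2) + 3 * U₃ xr.1 ^ 2)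
        ∂(M.jointLaw θ n (k n) (ε n)) := by
        refine integral_mono_of_nonneg (ae_of_all _ fun _ => sq_nonneg _)
          ((i1.fun_add i2).fun_add i3) (ae_of_all _ fun xr => ?_)
        have hsplit : √(n : ℝ) * (M.tStar θhat n (k n) xr - θ) -
            (√(n : ℝ))⁻¹ * ∑ i, M.dlog 1 (xr.1 i) θ / I =
              U₁ xr.1 + √(n : ℝ) * xr.2 + U₃ xr.1 := by
          simp only [hU₁, hU₃, hQ]
          rw [blockMean_sub hk0, tStar, blockAverage_eq_blockMean]
          ring
        simp only [hsplit]
        rw [show (3 : ℝ) * (n * xr.2 ^ 2) = 3 * (√(n : ℝ) * xr.2) ^ 2 by rw [mul_pow, hsqrt]]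
        linarith [sq_nonneg (U₁ xr.1 - √(n : ℝ) * xr.2), sq_nonneg (U₁ xr.1 - U₃ xr.1),
          sq_nonneg (√(n : ℝ) * xr.2 - U₃ xr.1)]
    _ = 3 * ∫ x, U₁ x ^ 2 ∂(M.sampleLaw θ n) +
          3 * ∫ r, (n : ℝ) * r ^ 2 ∂(laplaceReal (M.Lam / (k n * ε n))) +
          3 * ∫ x, U₃ x ^ 2 ∂(M.sampleLaw θ n) := by
        rw [integral_add (i1.fun_add i2) i3, integral_add i1 i2,
          integral_const_mul 3 fun xr : (Fin n → D) × ℝ => U₁ xr.1 ^ 2,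
          integral_const_mul 3 fun xr : (Fin n → D) × ℝ => (n : ℝ) * xr.2 ^ 2,
          integral_const_mul 3 fun xr : (Fin n → D) × ℝ => U₃ xr.1 ^ 2,
          integral_comp_fst_jointLaw θ n (k n) (ε n) fun x => U₁ x ^ 2,
          integral_comp_fst_jointLaw θ n (k n) (ε n) fun x => U₃ x ^ 2,
          integral_comp_snd_jointLaw θ n (k n) (ε n) fun r => (n : ℝ) * r ^ 2]
    _ ≤ _ := by rw [b2, b3]; gcongr

lemma Regular.tendstoInDistribution_tStar (hM : M.Regular) (hθ : M.IsMLE θhat)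
    (hε : ∀ n, 0 < ε n) (hk : AdmissibleBlockCount ε k) (θ : M.paramSpace)
    (hint : (θ : ℝ) ∈ interior M.paramSpace) :
    TendstoInDistribution
      (fun (n : ℕ) (xr : (Fin n → D) × ℝ) => √(n : ℝ) * (M.tStar θhat n (k n) xr - θ))
      atTop id (fun n => M.jointLaw θ n (k n) (ε n))
      (gaussianReal 0 (1 / M.fisherInfo θ).toNNReal) := by
  obtain ⟨G, H, hE⟩ := hM.exists_isEnvelope
  have hI := hM.fisherInfo_pos θ
  have m1 : Measurable fun x => M.dlog 1 x θ := hE.measurable_logDeriv (by norm_num) θ.2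
  have p1 : MemLp (fun x => M.dlog 1 x θ) 2 (M.law θ) :=
    (hE.memLp_logDeriv le_rfl (by norm_num) θ.2 θ).two_of_four
  set g : D → ℝ := fun y => M.dlog 1 y θ / M.fisherInfo θ with hg
  have mg : Measurable g := m1.div_const _
  have pg : MemLp g 2 (M.law θ) := by
    simpa only [hg, div_eq_inv_mul] using p1.const_mul (M.fisherInfo θ)⁻¹
  have eg : ∫ y, g y ∂(M.law θ) = 0 := by
    have : ∫ y, M.dlog 1 y θ ∂(M.law θ) = 0 := (hE.integral_logDeriv_one_and_two θ hint).1
    rw [hg, integral_div, this, zero_div]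
  have vg : ∫ y, g y ^ 2 ∂(M.law θ) = 1 / M.fisherInfo θ := by
    simp only [hg, div_pow]
    rw [integral_div]
    change M.fisherInfo θ / M.fisherInfo θ ^ 2 = _
    field_simp
  have mY (n : ℕ) : Measurable fun x : Fin n → D => (√(n : ℝ))⁻¹ * ∑ i, g (x i) :=
    (Finset.measurable_sum _ fun i _ => mg.comp (measurable_pi_apply i)).const_mul _
  have mT (n : ℕ) : Measurable (M.tStar θhat n (k n)) :=
    ((hM.measurable_blockAverage hθ n (k n)).comp measurable_fst).add measurable_snd
  have pY (n : ℕ) : MemLp (fun x : Fin n → D => (√(n : ℝ))⁻¹ * ∑ i, g (x i)) 2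
      (M.sampleLaw θ n) :=
    (memLp_finsetSum Finset.univ fun i _ => memLp_comp_eval (M.law θ) pg i).const_mul _
  refine tendstoInDistribution_of_tendsto_integral_sq
    (Y := fun (n : ℕ) (xr : (Fin n → D) × ℝ) => (√(n : ℝ))⁻¹ * ∑ i, g (xr.1 i))
    (fun n => ((mT n).sub_const _).const_mul _) (fun n => (mY n).comp measurable_fst)
    (fun n => ?_) (hM.tendsto_integral_sq_tStar_sub hθ hε hk θ hint) (fun s => ?_)
  · exact (((hM.memLp_tStar hθ θ n (k n) (hε n)).sub (memLp_const _)).const_mul _).sub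
      ((pY n).comp_measurePreserving (measurePreserving_fst_jointLaw θ n (k n) (ε n)))
  · rw [← vg]
    refine (tendsto_charFun_map_inv_sqrt_mul_sum (M.law θ) mg pg eg s).congr fun n => ?_
    congr 1
    have h := (measurePreserving_fst_jointLaw (M := M) θ n (k n) (ε n)).map_eq
    have hs : M.sampleLaw θ n = Measure.pi fun _ => M.law θ := rfl
    rw [← hs, ← h, Measure.map_map (mY n) measurable_fst]
    rfl

lemma Regular.mle_bias_isBigO (hM : M.Regular) (hθ : M.IsMLE θhat) (θ : M.paramSpace)
    (hint : (θ : ℝ) ∈ interior M.paramSpace) :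
    (fun n : ℕ => (∫ x, ((θhat n x : ℝ) - θ) ∂(M.sampleLaw θ n)) - M.b₁ θ / n)
      =O[atTop] fun n : ℕ => (n : ℝ) ^ (-(3 / 2) : ℝ) := by
  obtain ⟨C, -, h⟩ := hM.exists_mle_expansion hθ θ hint
  refine IsBigO.of_bound C ?_
  filter_upwards [eventually_ne_atTop 0] with n hn
  refine (h n hn).2.2.trans_eq ?_
  rw [Real.norm_of_nonneg (by positivity), Real.sqrt_eq_rpow, ← Real.rpow_neg (Nat.cast_nonneg n),
    ← Real.rpow_natCast, ← Real.rpow_mul (Nat.cast_nonneg n)]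
  norm_num

end ParametricModel

theorem mainTheorem2 {D : Type*} [MeasurableSpace D] (M : ParametricModel D) (hM : M.Regular)
    (θhat : (n : ℕ) → (Fin n → D) → M.paramSpace) (hθhat : M.IsMLE θhat)
    (ε : ℕ → ℝ) (hε : ∀ n, 0 < ε n)
    (hεω : (fun n : ℕ => (n : ℝ) ^ (-(1 / 6) : ℝ)) =o[atTop] ε) :
    AdmissibleBlockCount ε
      (fun n => ⌈(n : ℝ) ^ (3 / 5 : ℝ) * M.Lam ^ (2 / 5 : ℝ) / ε n ^ (2 / 5 : ℝ)⌉₊) ∧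
    ∀ θ : M.paramSpace, (θ : ℝ) ∈ interior M.paramSpace →
      -- `b₁` is the leading coefficient of the bias of the maximum likelihood estimator
      ((fun n : ℕ => (∫ x, ((θhat n x : ℝ) - θ) ∂(M.sampleLaw θ n)) - M.b₁ θ / n)
        =O[atTop] fun n : ℕ => (n : ℝ) ^ (-(3 / 2) : ℝ)) ∧
      ∀ k : ℕ → ℕ, AdmissibleBlockCount ε k →
        (∀ n, MemLp (M.tStar θhat n (k n)) 2 (M.jointLaw θ n (k n) (ε n))) ∧
        -- asymptotically unbiased
        ((fun n => M.bias θhat θ n (k n) (ε n))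
          =O[atTop] fun n => ((k n : ℝ) / n) ^ (3 / 2 : ℝ)) ∧
        Tendsto (fun n : ℕ => √(n : ℝ) * M.bias θhat θ n (k n) (ε n)) atTop (𝓝 0) ∧
        -- asymptotically normal
        TendstoInDistribution
          (fun (n : ℕ) (xr : (Fin n → D) × ℝ) => √(n : ℝ) * (M.tStar θhat n (k n) xr - θ))
          atTop id (fun n => M.jointLaw θ n (k n) (ε n))
          (gaussianReal 0 (1 / M.fisherInfo θ).toNNReal) ∧
        -- decomposition of the mean squared error, and efficiency
        (∀ n, M.mse θhat θ n (k n) (ε n) =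
          Var[M.blockAverage θhat n (k n); M.sampleLaw θ n] +
            2 * M.Lam ^ 2 / ((k n : ℝ) ^ 2 * ε n ^ 2) + M.bias θhat θ n (k n) (ε n) ^ 2) ∧
        Tendsto (fun n : ℕ => n * Var[M.blockAverage θhat n (k n); M.sampleLaw θ n]) atTop
          (𝓝 (1 / M.fisherInfo θ)) ∧
        Tendsto (fun n : ℕ => n * M.mse θhat θ n (k n) (ε n)) atTop
          (𝓝 (1 / M.fisherInfo θ)) := by
  exact ⟨admissibleBlockCount_ceil hε hεω M.Lam_pos, fun θ hθ =>
    ⟨hM.mle_bias_isBigO hθhat θ hθ, fun k hk =>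
      ⟨fun n => hM.memLp_tStar hθhat θ n (k n) (hε n), hM.bias_isBigO hθhat hε hk θ hθ,
        hM.tendsto_sqrt_mul_bias hθhat hε hk θ hθ,
        hM.tendstoInDistribution_tStar hθhat hε hk θ hθ,
        fun n => hM.mse_eq hθhat θ n (k n) (hε n),
        hM.tendsto_mul_variance_blockAverage hθhat hε hk θ hθ,
        hM.tendsto_mul_mse hθhat hε hk θ hθ⟩⟩⟩
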